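/- \textbf{Definitions.} A loss $\ell:[0,1]\times\{0,1\}\to\mathbb{R}$ is \emph{proper} if $\mathbb{E}_{y\sim\mathrm{Ber}(q)}[\ell(q,y)]\le \mathbb{E}_{y\sim\mathrm{Ber}(q)}[\ell(p,y)]$ for all $p,q\in[0,1]$; $\mathcal{L}^*$ is the class of proper losses with $|\ell(p,1)-\ell(p,0)|\le 1$ for all $p$. For $r\in\mathbb{N}$, $\mathcal{M}_r$ is the class of functions $\kappa:[0,1]\to[0,1]$ such that for every $v\in\mathbb{R}$ the set $\{p:\kappa(p)\ge v\}$ is a union of at most $r$ disjoint intervals (open, closed, half-open or singletons). For a probability distribution $J$ on $[0,1]\times\{0,1\}$, a function $\hat\kappa:[0,1]\to[0,1]$ is an \emph{$(\varepsilon,\mathcal{M}_r)$-omnipredictor for $J$} if $\mathbb{E}_{(p,y)\sim J}[\ell(\hat\kappa(p),y)]\le \mathbb{E}_{(p,y)\sim J}[\ell(\kappa(p),y)]+\varepsilon$ for all $\ell\in\mathcal{L}^*$ and all $\kappa\in\mathcal{M}_r$. Given a sample $S=((p_i,y_i))_{i\le m}$ in $[0,1]\times\{0,1\}$ and $\varepsilon'\in(0,1)$,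 an \emph{$\varepsilon'$-uniform-mass partition} is a partition of $[0,1]$ into $t\le 2/\varepsilon'+1$ intervals $I_1,\dots,I_t$ (empty ones allowed) such that each $I_j$ satisfies $|\{i: p_i\in I_j\}|\le\varepsilon' m$ or is a single point. The algorithm \textsc{UMB-Recalibration}$(S,\varepsilon')$ creates some $\varepsilon'$-uniform-mass partition and outputs the function $\hat\kappa$ that is constant on each $I_j$, with value the mean of the labels $y_i$ over all $i$ with $p_i\in I_j$ (and value $0$ if there is no such $i$). For $\varepsilon,\delta\in(0,1)$ and an integer $r\ge1$ put $B=B(\varepsilon,\delta,r)=r^2\max\{1,\log(1/\delta)\}/\varepsilon^4$. Time is the number of steps of a real RAM: unit-cost integer addition, truncated subtraction and halving, exact real $+,-,\times,\div$, comparisons, array access, and no rounding of reals to integers. \textbf{Theorem.} There are a universal constant $C>0$ and a fixed real RAM program that, for every finite sample $S$ and every $\varepsilon'\in(0,1)$, halts on input $(S,\varepsilon')$ and computes a piecewise constant description of an output of \textsc{UMB-Recalibration}$(S,\varepsilon')$, such that the following holds for all $\varepsilon,\delta\in(0,1)$ and all integers $r\ge1$, with $\varepsilon'=\varepsilon/(8r)$.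 \begin{enumerate} \item For every $m\ge C\,B$ and every distribution $J$ on $[0,1]\times\{0,1\}$: if $S$ consists of $m$ i.i.d. samples from $J$, then with probability at least $1-\delta$ every possible output of \textsc{UMB-Recalibration}$(S,\varepsilon')$ (for any choice of the $\varepsilon'$-uniform-mass partition) is an $(\varepsilon,\mathcal{M}_r)$-omnipredictor for $J$. \item There is a sample size $m\le C\,B$, depending only on $\varepsilon,\delta,r$, for which the guarantee in (1) holds for every distribution $J$, and for which the program halts on $(S,\varepsilon')$ within $C\,B$ steps for every sample $S$ of size $m$. \end{enumerate} -/

import Mathlib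

open MeasureTheory

/-! ### Proper losses, generalized monotone post-processings, omnipredictors

Predictions and post-processed predictions live in `unitInterval`, labels in `Bool`
(`true` is the label `1`). -/

/-- The expectation of `ℓ(p, y)` when the label `y` is Bernoulli with mean `q`. -/
noncomputable def bernoulliLoss (l : unitInterval → Bool → ℝ) (p q : unitInterval) : ℝ :=
  (q : ℝ) * l p true + (1 - (q : ℝ)) * l p false

/-- A loss is proper if predicting the true mean of the label is optimal. -/
def IsProperLoss (l : unitInterval → Bool → ℝ) : Prop :=
  ∀ p q : unitInterval, bernoulliLoss l q q ≤ bernoulliLoss l p q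

/-- The class of proper losses with `|ℓ(p, 1) - ℓ(p, 0)| ≤ 1` for all `p`. -/
def properLosses : Set (unitInterval → Bool → ℝ) :=
  {l | IsProperLoss l ∧ ∀ p, |l p true - l p false| ≤ 1}

/-- The class of `r`-generalized monotone functions: each superlevel set is a union of at most `r`
disjoint intervals of `[0,1]`. Intervals are the order-connected sets; since `∅` is one of them,
`r` possibly empty intervals amount to at most `r` intervals. -/
def generalizedMonotone (r : ℕ) : Set (unitInterval → unitInterval) :=
  {k | ∀ v : ℝ, ∃ A : Fin r → Set unitInterval,
    (∀ i, (A i).OrdConnected) ∧ Pairwise (fun i j => Disjoint (A i) (A j)) ∧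
    {p : unitInterval | v ≤ (k p : ℝ)} = ⋃ i, A i}

/-- The expected loss of the post-processing `k` under the distribution `J` of pairs `(p, y)`. -/
noncomputable def expectedLoss (J : Measure (unitInterval × Bool))
    (l : unitInterval → Bool → ℝ) (k : unitInterval → unitInterval) : ℝ :=
  ∫ z, l (k z.1) z.2 ∂J

/-- `(ε, K)`-omnipredictors for `J`. (Losses in `properLosses` are bounded and Borel, and so are
generalized monotone functions, so that the expectations exist for that class.) -/
def IsOmnipredictor (J : Measure (unitInterval × Bool)) (ε : ℝ)
    (K : Set (unitInterval → unitInterval)) (khat : unitInterval → unitInterval) : Prop :=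
  ∀ l ∈ properLosses, ∀ k ∈ K, expectedLoss J l khat ≤ expectedLoss J l k + ε

/-! ### Uniform-mass binning and recalibration -/

open Classical in
/-- The number of sample points in the bucket `A`. -/
noncomputable def bucketCount {m : ℕ} (S : Fin m → unitInterval × Bool)
    (A : Set unitInterval) : ℕ :=
  (Finset.univ.filter fun i => (S i).1 ∈ A).card

open Classical in
/-- The number of sample points with label `1` in the bucket `A`. -/
noncomputable def bucketPositives {m : ℕ} (S : Fin m → unitInterval × Bool)
    (A : Set unitInterval) : ℕ :=
  (Finset.univ.filter fun i => (S i).1 ∈ A ∧ (S i).2 = true).card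

/-- The empirical mean of the labels in the bucket `A`; it is `0` if the bucket is empty. -/
noncomputable def bucketMean {m : ℕ} (S : Fin m → unitInterval × Bool)
    (A : Set unitInterval) : ℝ :=
  (bucketPositives S A : ℝ) / (bucketCount S A : ℝ)

/-- An `η`-uniform-mass partition of `[0,1]` with respect to the points of the sample `S`: at most
`2 / η + 1` intervals, each of which holds at most an `η` fraction of the points (a small bucket)
or is a single point (an overflow bucket). -/
structure IsUniformMassPartition {m t : ℕ} (S : Fin m → unitInterval × Bool) (η : ℝ)
    (A : Fin t → Set unitInterval) : Prop where
  interval : ∀ j, (A j).OrdConnected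
  disjoint : Pairwise fun i j => Disjoint (A i) (A j)
  cover : ⋃ j, A j = Set.univ
  size : (t : ℝ) ≤ 2 / η + 1
  mass : ∀ j, (bucketCount S (A j) : ℝ) ≤ η * m ∨ ∃ a, A j = {a}

open Classical in
/-- `khat` is a possible output of uniform-mass binning followed by per-bucket recalibration on
the sample `S` with parameter `η`. -/
def IsUMBOutput {m : ℕ} (S : Fin m → unitInterval × Bool) (η : ℝ)
    (khat : unitInterval → unitInterval) : Prop :=
  ∃ (t : ℕ) (A : Fin t → Set unitInterval), IsUniformMassPartition S η A ∧
    ∀ p, (khat p : ℝ) = ∑ j, if p ∈ A j then bucketMean S (A j) else 0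

/-- On `m` i.i.d. samples from an arbitrary distribution `J`, with probability at least `1 - δ`
every possible output of uniform-mass binning and recalibration with parameter `ε / (8 r)` is an
`(ε, M_r)`-omnipredictor for `J`. The bound is on the outer measure of the failure event. -/
def UMBLearns (ε δ : ℝ) (r m : ℕ) : Prop :=
  ∀ J : Measure (unitInterval × Bool), IsProbabilityMeasure J →
    Measure.pi (fun _ : Fin m => J)
      {S | ¬ ∀ khat, IsUMBOutput S (ε / (8 * r)) khat →
        IsOmnipredictor J ε (generalizedMonotone r) khat} ≤ ENNReal.ofReal δ

/-- The bound `r² log(1/δ) / ε⁴`, with `log(1/δ)` replaced by `1` where it is smaller than `1`. -/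
noncomputable def umbBound (ε δ : ℝ) (r : ℕ) : ℝ :=
  (r : ℝ) ^ 2 * max 1 (Real.log (1 / δ)) / ε ^ 4

/-! ### A real RAM with unit cost steps

Structured programs over finitely many arrays of natural numbers and arrays of exact reals. There
is no operation that rounds a real to an integer. -/

namespace RealRAM

/-- A memory: `nat a i` and `real a i` are the entries with index `i` of the arrays named `a`. -/
structure Mem where
  nat : ℕ → ℕ → ℕ
  real : ℕ → ℕ → ℝ

/-- Write the number `x` at index `i` of the integer array `a`. -/
def Mem.setNat (s : Mem) (a i x : ℕ) : Mem :=
  { s with nat := Function.update s.nat a (Function.update (s.nat a) i x) }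

/-- Write the real `x` at index `i` of the real array `a`. -/
noncomputable def Mem.setReal (s : Mem) (a i : ℕ) (x : ℝ) : Mem :=
  { s with real := Function.update s.real a (Function.update (s.real a) i x) }

/-- Integer expressions. Array names are literals, indices are computed. -/
inductive NExp where
  | lit (n : ℕ)
  | get (a : ℕ) (i : NExp)
  | add (e f : NExp)
  | sub (e f : NExp)
  | half (e : NExp)

/-- Integer expressions are evaluated in `ℕ`: `sub` is truncated, `half` rounds down. -/
def NExp.eval (s : Mem) : NExp → ℕ
  | .lit n => n
  | .get a i => s.nat a (i.eval s)
  | .add e f => e.eval s + f.eval s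
  | .sub e f => e.eval s - f.eval s
  | .half e => e.eval s / 2

/-- Real expressions. -/
inductive RExp where
  | ofNat (e : NExp)
  | get (a : ℕ) (i : NExp)
  | add (e f : RExp)
  | sub (e f : RExp)
  | mul (e f : RExp)
  | div (e f : RExp)

/-- Real expressions are evaluated exactly; division by `0` returns `0`. -/
noncomputable def RExp.eval (s : Mem) : RExp → ℝ
  | .ofNat e => (e.eval s : ℝ)
  | .get a i => s.real a (i.eval s)
  | .add e f => e.eval s + f.eval s
  | .sub e f => e.eval s - f.eval s
  | .mul e f => e.eval s * f.eval s
  | .div e f => e.eval s / f.eval s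

/-- Tests. -/
inductive Test where
  | natLt (e f : NExp)
  | realLt (e f : RExp)
  | neg (b : Test)
  | conj (b c : Test)

/-- The truth of a test in a memory. -/
def Test.holds (s : Mem) : Test → Prop
  | .natLt e f => e.eval s < f.eval s
  | .realLt e f => e.eval s < f.eval s
  | .neg b => ¬ b.holds s
  | .conj b c => b.holds s ∧ c.holds s

/-- Programs. -/
inductive Prog where
  | skip
  | setNat (a : ℕ) (i e : NExp)
  | setReal (a : ℕ) (i : NExp) (e : RExp)
  | seq (c d : Prog)
  | ite (b : Test) (c d : Prog)
  | loop (b : Test) (c : Prog)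

/-- `Exec c s s' n`: started in the memory `s`, the program `c` halts in the memory `s'` after `n`
steps. Each assignment and each test is one step; as the expressions in a program have a fixed
size, that is the number of elementary operations up to a factor depending on the program only. -/
inductive Exec : Prog → Mem → Mem → ℕ → Prop
  | skip (s : Mem) : Exec .skip s s 1
  | setNat (a : ℕ) (i e : NExp) (s : Mem) :
      Exec (.setNat a i e) s (s.setNat a (i.eval s) (e.eval s)) 1
  | setReal (a : ℕ) (i : NExp) (e : RExp) (s : Mem) :
      Exec (.setReal a i e) s (s.setReal a (i.eval s) (e.eval s)) 1
  | seq {c d : Prog} {s s₁ s₂ : Mem} {n k : ℕ} :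
      Exec c s s₁ n → Exec d s₁ s₂ k → Exec (.seq c d) s s₂ (n + k)
  | ite_true {b : Test} {c d : Prog} {s s₁ : Mem} {n : ℕ} :
      b.holds s → Exec c s s₁ n → Exec (.ite b c d) s s₁ (n + 1)
  | ite_false {b : Test} {c d : Prog} {s s₁ : Mem} {n : ℕ} :
      ¬ b.holds s → Exec d s s₁ n → Exec (.ite b c d) s s₁ (n + 1)
  | loop_done {b : Test} {c : Prog} {s : Mem} :
      ¬ b.holds s → Exec (.loop b c) s s 1
  | loop_step {b : Test} {c : Prog} {s s₁ s₂ : Mem} {n k : ℕ} :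
      b.holds s → Exec c s s₁ n → Exec (.loop b c) s₁ s₂ k →
      Exec (.loop b c) s s₂ (n + k + 1)

/-- The memory that holds the input: the size `m` of the sample (integer array `0`, index `0`),
the labels (integer array `1`), the points (real array `0`) and the parameter `η` (real array `1`,
index `0`). All other entries are `0`. -/
noncomputable def input {m : ℕ} (S : Fin m → unitInterval × Bool) (η : ℝ) : Mem where
  nat a i :=
    if a = 0 ∧ i = 0 then m
    else if h : a = 1 ∧ i < m then (if (S ⟨i, h.2⟩).2 = true then 1 else 0)
    else 0
  real a i :=
    if h : a = 0 ∧ i < m then ((S ⟨i, h.2⟩).1 : ℝ)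
    else if a = 1 ∧ i = 0 then η
    else 0

/-- The `j`-th interval described by a memory. Its end points are entry `j` of the real arrays `2`
and `3`; the left (right) end point belongs to it if entry `j` of the integer array `3` (`4`) is
nonzero. -/
def outInterval (s : Mem) (j : ℕ) : Set unitInterval :=
  {p | (s.real 2 j < p ∨ (s.nat 3 j ≠ 0 ∧ s.real 2 j = p)) ∧
    ((p : ℝ) < s.real 3 j ∨ (s.nat 4 j ≠ 0 ∧ (p : ℝ) = s.real 3 j))}

open Classical in
/-- The memory `s` describes the function `khat` as a piecewise constant function: there are
`s.nat 2 0` intervals, and entry `j` of the real array `4` is the value on the `j`-th one. -/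
def Describes (s : Mem) (khat : unitInterval → unitInterval) : Prop :=
  ∀ p, (khat p : ℝ) =
    ∑ j ∈ Finset.range (s.nat 2 0), if p ∈ outInterval s j then s.real 4 j else 0

/-- On the sample `S` and the parameter `η`, the program `c` performs uniform-mass binning and
recalibration in `n` steps: it halts after `n` steps and describes a correct output. -/
def PerformsUMB (c : Prog) {m : ℕ} (S : Fin m → unitInterval × Bool) (η : ℝ) (n : ℕ) : Prop :=
  ∃ (s : Mem) (khat : unitInterval → unitInterval),
    Exec c (input S η) s n ∧ Describes s khat ∧ IsUMBOutput S η khat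

end RealRAM

/-! Statistics. Put T = r/ε, so that a uniform-mass partition has O(T) buckets. One event suffices,
`SmallDiscrepancy`: for every family of O(T) disjoint intervals, the deviations of the empirical
bucket frequencies, summed over the buckets, are at most ε/24, and likewise for the frequencies of
positive labels. To get it, cut [0,1] into O(K) cells which are single points or have mass at most
1/K (`exists_grid`). Every interval is a range of cells up to two cells of the second kind, so only
unions of O(T) ranges have to be controlled (`sum_abs_discrepancy_le`). Hoeffding's inequality and a
union bound over these unions give a sample size of order (T log T + log(1/δ))/ε².

On that event the rest is deterministic (`isOmnipredictor_of_smallDiscrepancy`). On each bucket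
replace κ by its value at one point. The price is the mass of the bucket times the oscillation of
φ∘κ, where φ(p) = ℓ(p,0) - ℓ(p,1) is monotone with values in [-1,1] and controls the change of ℓ
under either label (`IsProperLoss.abs_sub_le`). A one-point bucket has no oscillation, every other
one has empirical mass at most η = ε/(8r), and the oscillations add up to at most 4r up to an
arbitrary slack, because each level is crossed in at most 2r buckets (`card_crossing_le`). This
costs about ε/2. By propriety, a constant prediction on a bucket is no better than the empirical
mean, up to sampling error.

Algorithm. Sorting the sample takes m log m steps, which is too slow: m grows with log(1/δ), and log
m is not bounded in terms of T. The affordable cost is O(m log T). So blocks are merged until their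
length is of order 1/η, after O(log(1/η)) passes; from then on every round of merges is followed by
deleting every other entry, and the remaining cost is a geometric series (`ends_coarsen`). A
deletion miscounts an interval by at most one entry per sorted block; weighted, these errors add up
to at most ηm/2. Every g-th entry of the final sorted list is a separator. There are at most 4/η of
them, and an interval that avoids them holds at most ηm sample points. Binary search locates each
sample point among the atoms (separators and gaps), and a greedy merge of adjacent atoms leaves at
most 2/η + 1 buckets.

The remaining logarithms disappear in the bound B because (log T)² = O(T). -/

/-! ### Discrepancy of two measures on partitions into intervals -/

/-- The union of the cells `{p | a ≤ c p < b}` over the pairs `(a, b)` listed by `g`. -/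
def gridUnion {ι : Type*} (c : unitInterval → ℕ) (g : ι → ℕ × ℕ) : Set unitInterval :=
  ⋃ i, {p | (g i).1 ≤ c p ∧ c p < (g i).2}

/-- Padding with the empty range `(0, 0)` lets a deviation bound for exactly `n` ranges serve all
smaller families. -/
lemma gridUnion_extend {ι : Type*} [Fintype ι] {n : ℕ} (hn : Fintype.card ι ≤ n)
    (c : unitInterval → ℕ) {M : ℕ} (g : ι → ℕ × ℕ) (hg : ∀ i, (g i).1 ≤ M ∧ (g i).2 ≤ M) :
    ∃ g' : Fin n → ℕ × ℕ, (∀ i, (g' i).1 ≤ M ∧ (g' i).2 ≤ M) ∧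
      gridUnion c g' = gridUnion c g := by
  obtain ⟨e⟩ : Nonempty (ι ↪ Fin n) := by
    apply Function.Embedding.nonempty_of_card_le
    simpa using hn
  refine ⟨Function.extend e g fun _ => (0, 0), fun i => ?_, ?_⟩
  · by_cases h : ∃ j, e j = i
    · obtain ⟨j, rfl⟩ := h
      rw [e.injective.extend_apply]
      exact hg j
    · rw [Function.extend_apply' _ _ _ h]
      simp
  · ext p
    simp only [gridUnion, Set.mem_iUnion, Set.mem_ofPred_eq]
    constructor
    · rintro ⟨i, hi⟩
      by_cases h : ∃ j, e j = i
      · obtain ⟨j, rfl⟩ := h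
        rw [e.injective.extend_apply] at hi
        exact ⟨j, hi⟩
      · rw [Function.extend_apply' _ _ _ h] at hi
        simp at hi
    · rintro ⟨j, hj⟩
      exact ⟨e j, by rwa [e.injective.extend_apply]⟩

/-- Only the first and the last cell met by `A` can be cut by it. A cut cell meets `A` without being
contained in it, hence has at least two points; heavy one-point cells therefore never occur as
boundary cells. -/
lemma exists_grid_bracket {c : unitInterval → ℕ} (hc : Monotone c) {M : ℕ} (hM : ∀ p, c p < M)
    {A : Set unitInterval} (hA : A.OrdConnected) :
    ∃ a x y : ℕ × ℕ, (a.1 ≤ M ∧ a.2 ≤ M) ∧ (x.1 ≤ M ∧ x.2 ≤ M) ∧ (y.1 ≤ M ∧ y.2 ≤ M) ∧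
      {p | a.1 ≤ c p ∧ c p < a.2} ⊆ A ∧
      A ⊆ {p | a.1 ≤ c p ∧ c p < a.2} ∪
        ({p | x.1 ≤ c p ∧ c p < x.2} ∪ {p | y.1 ≤ c p ∧ c p < y.2}) ∧
      ∀ z, z = x ∨ z = y → {p | z.1 ≤ c p ∧ c p < z.2} = ∅ ∨
        ∃ v, {p | z.1 ≤ c p ∧ c p < z.2} = c ⁻¹' {v} ∧ ¬ (c ⁻¹' {v}).Subsingleton := by
  classical
  rcases A.eq_empty_or_nonempty with rfl | hne
  · refine ⟨(0, 0), (0, 0), (0, 0), ?_⟩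
    simp
  have hcell : ∀ v, {p | v ≤ c p ∧ c p < v + 1} = c ⁻¹' {v} := fun v => by
    ext p; simp only [Set.mem_ofPred_eq, Set.mem_preimage, Set.mem_singleton_iff]; omega
  have hpart : ∀ p ∈ A, ¬ c ⁻¹' {c p} ⊆ A → ¬ (c ⁻¹' {c p}).Subsingleton := by
    intro p hp hn hs
    exact hn fun q hq => by rwa [hs hq (by simp : p ∈ c ⁻¹' {c p})]
  obtain ⟨p, hp, hpmin⟩ : ∃ p ∈ A, ∀ q ∈ A, c p ≤ c q := by
    have := (c '' A).exists_min_image id ((Set.finite_lt_nat M).subset (by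
      rintro _ ⟨q, -, rfl⟩; exact hM q)) (hne.image c)
    obtain ⟨_, ⟨p, hp, rfl⟩, h⟩ := this
    exact ⟨p, hp, fun q hq => h _ ⟨q, hq, rfl⟩⟩
  obtain ⟨q, hq, hqmax⟩ : ∃ q ∈ A, ∀ p ∈ A, c p ≤ c q := by
    have := (c '' A).exists_max_image id ((Set.finite_lt_nat M).subset (by
      rintro _ ⟨q, -, rfl⟩; exact hM q)) (hne.image c)
    obtain ⟨_, ⟨p, hp, rfl⟩, h⟩ := this
    exact ⟨p, hp, fun q hq => h _ ⟨q, hq, rfl⟩⟩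
  have hpM := hM p
  have hqM := hM q
  have hmem : ∀ (v : ℕ) (z), c z = v → (c ⁻¹' {v} ⊆ A) → z ∈ A := fun v z hz h => h hz
  -- An extreme cell inside `A` joins the inner range, and its boundary range is the empty `(0, 0)`.
  -- A cut one is left out and becomes a boundary cell. If `p` and `q` share a cut cell, the inner
  -- range is empty.
  refine ⟨(if c ⁻¹' {c p} ⊆ A then c p else c p + 1, if c ⁻¹' {c q} ⊆ A then c q + 1 else c q),
    if c ⁻¹' {c p} ⊆ A then (0, 0) else (c p, c p + 1),
    if c ⁻¹' {c q} ⊆ A then (0, 0) else (c q, c q + 1), ?_, ?_, ?_, ?_, ?_, ?_⟩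
  · dsimp only
    split_ifs <;> omega
  · split_ifs <;> dsimp only <;> omega
  · split_ifs <;> dsimp only <;> omega
  · rintro z ⟨h1, h2⟩
    dsimp only at h1 h2
    by_cases e1 : c z = c p
    · split_ifs at h1 with h
      · exact hmem _ z e1 h
      · omega
    by_cases e2 : c z = c q
    · split_ifs at h2 with h
      · exact hmem _ z e2 h
      · omega
    have l1 : c p < c z := by split_ifs at h1 <;> omega
    have l2 : c z < c q := by split_ifs at h2 <;> omega
    exact hA.out hp hq ⟨(hc.reflect_lt l1).le, (hc.reflect_lt l2).le⟩
  · intro z hz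
    have h1 := hpmin z hz
    have h2 := hqmax z hz
    simp only [Set.mem_union, Set.mem_ofPred_eq]
    split_ifs <;> simp only <;> omega
  · rintro z (rfl | rfl)
    · split_ifs with h
      · left; simp
      · exact Or.inr ⟨c p, hcell _, hpart p hp h⟩
    · split_ifs with h
      · left; simp
      · exact Or.inr ⟨c q, hcell _, hpart q hq h⟩

lemma measurableSet_gridUnion {ι : Type*} [Finite ι] {c : unitInterval → ℕ} (hc : Monotone c)
    (g : ι → ℕ × ℕ) : MeasurableSet (gridUnion c g) := by
  have := hc.measurable
  refine MeasurableSet.iUnion fun i => ?_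
  exact (measurableSet_le measurable_const this).inter (measurableSet_lt this measurable_const)

/-- The inner approximations contribute `2 * β`. The remainders lie in at most `2 * t` boundary
cells of `μ`-mass at most `κ`, and one more deviation `β` transfers this to `ν`. The bound `β`
enters three times, whatever the number of intervals. -/
lemma sum_abs_discrepancy_le {μ ν : Measure unitInterval} [IsFiniteMeasure μ] [IsFiniteMeasure ν]
    {c : unitInterval → ℕ} (hc : Monotone c) {M : ℕ} (hM : ∀ p, c p < M) {κ β : ℝ} (hκ : 0 ≤ κ)
    (hfib : ∀ v, ¬ (c ⁻¹' {v}).Subsingleton → μ.real (c ⁻¹' {v}) ≤ κ) {n t : ℕ} (hn : 2 * t ≤ n)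
    (hdev : ∀ g : Fin n → ℕ × ℕ, (∀ i, (g i).1 ≤ M ∧ (g i).2 ≤ M) →
      |ν.real (gridUnion c g) - μ.real (gridUnion c g)| ≤ β)
    {A : Fin t → Set unitInterval} (hA : ∀ j, (A j).OrdConnected)
    (hd : Pairwise fun i j => Disjoint (A i) (A j)) :
    ∑ j, |ν.real (A j) - μ.real (A j)| ≤ 3 * β + 4 * t * κ := by
  classical
  have hdev' : ∀ {ι : Type} [Fintype ι], Fintype.card ι ≤ n → ∀ g : ι → ℕ × ℕ,
      (∀ i, (g i).1 ≤ M ∧ (g i).2 ≤ M) →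
      |ν.real (gridUnion c g) - μ.real (gridUnion c g)| ≤ β := by
    intro ι _ hι g hg
    obtain ⟨g', hg', h⟩ := gridUnion_extend hι c g hg
    rw [← h]
    exact hdev g' hg'
  choose a x y ha hx hy hin hcov hsmall using fun j => exists_grid_bracket hc hM (hA j)
  have hcm := hc.measurable
  have hcellm : ∀ z : ℕ × ℕ, MeasurableSet {p | z.1 ≤ c p ∧ c p < z.2} := fun z =>
    (measurableSet_le measurable_const hcm).inter (measurableSet_lt hcm measurable_const)
  set B : Fin t → Set unitInterval := fun j => {p | (a j).1 ≤ c p ∧ c p < (a j).2} with hB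
  have hBm : ∀ j, MeasurableSet (B j) := fun j => hcellm _
  have hAm : ∀ j, MeasurableSet (A j) := fun j => (hA j).measurableSet
  have hBd : Pairwise fun i j => Disjoint (B i) (B j) := fun i j hij =>
    (hd hij).mono (hin i) (hin j)
  -- the inner approximations
  have hpart : ∀ s : Finset (Fin t), |∑ j ∈ s, (ν.real (B j) - μ.real (B j))| ≤ β := by
    intro s
    have := hdev' (ι := s) (by
      have := s.card_le_univ
      simp at this ⊢; omega) (fun j => a j) (fun j => ha j)
    have e : gridUnion c (fun j : s => a j) = ⋃ j ∈ s, B j := by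
      ext p; simp [gridUnion, hB]
    rw [e, measureReal_biUnion_finset (fun i _ j _ hij => hBd hij) (fun j _ => hBm j),
      measureReal_biUnion_finset (fun i _ j _ hij => hBd hij) (fun j _ => hBm j),
      ← Finset.sum_sub_distrib] at this
    exact this
  -- Split the indices by the sign of the deviation: each half is the deviation of a single union of
  -- ranges.
  have hinner : ∑ j, |ν.real (B j) - μ.real (B j)| ≤ 2 * β := by
    rw [← Finset.sum_filter_add_sum_filter_not Finset.univ
      (fun j => 0 ≤ ν.real (B j) - μ.real (B j))]
    have h1 := (le_abs_self _).trans
      (hpart (Finset.univ.filter fun j => 0 ≤ ν.real (B j) - μ.real (B j)))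
    have h2 := (neg_le_abs _).trans
      (hpart (Finset.univ.filter fun j => ¬ 0 ≤ ν.real (B j) - μ.real (B j)))
    rw [← Finset.sum_neg_distrib] at h2
    have e1 : ∀ j ∈ Finset.univ.filter fun j => 0 ≤ ν.real (B j) - μ.real (B j),
        |ν.real (B j) - μ.real (B j)| = ν.real (B j) - μ.real (B j) := fun j hj =>
      abs_of_nonneg (Finset.mem_filter.1 hj).2
    have e2 : ∀ j ∈ Finset.univ.filter fun j => ¬ 0 ≤ ν.real (B j) - μ.real (B j),
        |ν.real (B j) - μ.real (B j)| = -(ν.real (B j) - μ.real (B j)) := fun j hj =>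
      abs_of_neg (not_le.1 (Finset.mem_filter.1 hj).2)
    rw [Finset.sum_congr rfl e1, Finset.sum_congr rfl e2]
    linarith
  -- the boundary cells
  let w : Fin t × Bool → ℕ × ℕ := fun z => if z.2 then x z.1 else y z.1
  have hw : ∀ z, (w z).1 ≤ M ∧ (w z).2 ≤ M := by
    rintro ⟨j, b⟩
    cases b
    · exact hy j
    · exact hx j
  -- The `μ`-mass of the boundary cells is small by hypothesis; this controls their `ν`-mass.
  have hW := hdev' (ι := Fin t × Bool) (by simp; omega) w hw
  have hκ' : ∀ z, μ.real {p | (w z).1 ≤ c p ∧ c p < (w z).2} ≤ κ := by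
    rintro ⟨j, b⟩
    have : {p | (w (j, b)).1 ≤ c p ∧ c p < (w (j, b)).2} = ∅ ∨
        ∃ v, {p | (w (j, b)).1 ≤ c p ∧ c p < (w (j, b)).2} = c ⁻¹' {v} ∧
          ¬ (c ⁻¹' {v}).Subsingleton := by
      apply hsmall j
      cases b <;> simp [w]
    obtain h | ⟨v, h, hv⟩ := this
    · rw [h]; simpa using hκ
    · rw [h]; exact hfib v hv
  have hμW : μ.real (gridUnion c w) ≤ 2 * t * κ := by
    refine (measureReal_iUnion_fintype_le _).trans ?_
    refine (Finset.sum_le_sum fun z _ => hκ' z).trans ?_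
    simp [mul_comm]
  have hrest : ∀ ρ : Measure unitInterval, IsFiniteMeasure ρ →
      ∑ j, ρ.real (A j \ B j) ≤ ρ.real (gridUnion c w) := by
    intro ρ _
    rw [← measureReal_iUnion_fintype (fun i j hij => (hd hij).mono Set.sdiff_subset Set.sdiff_subset)
      (fun j => (hAm j).diff (hBm j))]
    refine measureReal_mono (Set.iUnion_subset fun j p hp => ?_)
    rcases hcov j hp.1 with h | h | h
    · exact absurd h hp.2
    · exact Set.mem_iUnion.2 ⟨(j, true), by simpa [w] using h⟩
    · exact Set.mem_iUnion.2 ⟨(j, false), by simpa [w] using h⟩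
  have hsplit : ∀ ρ : Measure unitInterval, IsFiniteMeasure ρ → ∀ j,
      ρ.real (A j) = ρ.real (B j) + ρ.real (A j \ B j) := by
    intro ρ _ j
    rw [measureReal_sdiff (hin j) (hBm j)]
    ring
  have hj : ∀ j, |ν.real (A j) - μ.real (A j)| ≤
      |ν.real (B j) - μ.real (B j)| + ν.real (A j \ B j) + μ.real (A j \ B j) := by
    intro j
    rw [hsplit ν inferInstance j, hsplit μ inferInstance j]
    have h1 : 0 ≤ ν.real (A j \ B j) := measureReal_nonneg
    have h2 : 0 ≤ μ.real (A j \ B j) := measureReal_nonneg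
    rw [abs_le]
    constructor
    · have := neg_abs_le (ν.real (B j) - μ.real (B j)); linarith
    · have := le_abs_self (ν.real (B j) - μ.real (B j)); linarith
  refine (Finset.sum_le_sum fun j _ => hj j).trans ?_
  rw [Finset.sum_add_distrib, Finset.sum_add_distrib]
  have h1 := hrest ν inferInstance
  have h2 := hrest μ inferInstance
  have h3 := (abs_le.1 hW).2
  linarith

/-! ### Grids of small cells -/

/-- Rounding only the distribution function `F` would put a heavy atom into one cell with its
neighbours. Adding the rounded left limit `G` separates them: wherever mass more than `1 / K` sits
on a point, one of the two floors jumps there. -/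
lemma exists_grid (μ : Measure unitInterval) [IsProbabilityMeasure μ] {K : ℕ} (hK : 0 < K) :
    ∃ c : unitInterval → ℕ, Monotone c ∧ (∀ p, c p < 2 * K + 1) ∧
      ∀ v, ¬ (c ⁻¹' {v}).Subsingleton → μ.real (c ⁻¹' {v}) ≤ 1 / K := by
  have hK' : (0 : ℝ) < K := by exact_mod_cast hK
  set F : unitInterval → ℝ := fun p => μ.real (Set.Iic p) with hF
  set G : unitInterval → ℝ := fun p => μ.real (Set.Iio p) with hG
  have hFm : Monotone fun p => ⌊K * F p⌋₊ := fun p q h =>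
    Nat.floor_mono (mul_le_mul_of_nonneg_left
      (measureReal_mono (Set.Iic_subset_Iic.2 h)) hK'.le)
  have hGm : Monotone fun p => ⌊K * G p⌋₊ := fun p q h =>
    Nat.floor_mono (mul_le_mul_of_nonneg_left
      (measureReal_mono (Set.Iio_subset_Iio h)) hK'.le)
  have hbd : ∀ x : ℝ, x ≤ 1 → ⌊K * x⌋₊ ≤ K := fun x hx =>
    Nat.floor_le_of_le (by nlinarith)
  refine ⟨fun p => ⌊K * G p⌋₊ + ⌊K * F p⌋₊, hGm.add hFm, fun p => ?_, fun v hv => ?_⟩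
  · have h1 := hbd (F p) measureReal_le_one
    have h2 := hbd (G p) measureReal_le_one
    dsimp only
    omega
  set c : unitInterval → ℕ := fun p => ⌊K * G p⌋₊ + ⌊K * F p⌋₊ with hc
  have hcm : Measurable c := (hGm.add hFm).measurable
  have hpair : ∀ p q, c p = v → c q = v → p < q → μ.real (Set.Icc p q) ≤ 1 / K := by
    intro p q hp hq hpq
    have h1 := hFm hpq.le
    have h2 := hGm hpq.le
    have h3 : ⌊K * F p⌋₊ ≤ ⌊K * G q⌋₊ := Nat.floor_mono (mul_le_mul_of_nonneg_left
      (measureReal_mono fun x (hx : x ≤ p) => lt_of_le_of_lt hx hpq) hK'.le)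
    have h4 : ⌊K * G p⌋₊ ≤ ⌊K * F p⌋₊ := Nat.floor_mono (mul_le_mul_of_nonneg_left
      (measureReal_mono fun x (hx : x < p) => hx.le) hK'.le)
    -- Since `G p ≤ F p ≤ G q ≤ F q`, equality of the two sums forces all four floors to agree.
    have h5 : ⌊K * F q⌋₊ = ⌊K * G p⌋₊ := by
      simp only [hc] at hp hq
      dsimp only at h1 h2
      omega
    have h6 := Nat.lt_floor_add_one (K * F q)
    have h7 : (⌊K * G p⌋₊ : ℝ) ≤ K * G p := Nat.floor_le (by positivity)
    rw [h5] at h6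
    have h8 : μ.real (Set.Icc p q) = F q - G p := by
      have := measureReal_sdiff (μ := μ) (s₁ := Set.Iic q) (s₂ := Set.Iio p)
        (fun x (hx : x < p) => (hx.trans hpq).le) measurableSet_Iio
      rw [← this]
      congr 1
      ext x
      simp
    rw [h8, le_div_iff₀ hK']
    nlinarith
  -- The cell need not contain its end points. Its compact subsets exhaust its mass and have a least
  -- and a greatest element.
  rw [Measure.real, (hcm (measurableSet_singleton v)).measure_eq_iSup_isCompact]
  refine ENNReal.toReal_le_of_le_ofReal (by positivity) ?_
  refine iSup_le fun C => iSup_le fun hCs => iSup_le fun hC => ?_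
  rw [← ofReal_measureReal]
  refine ENNReal.ofReal_le_ofReal ?_
  rcases C.eq_empty_or_nonempty with rfl | hne
  · simp
  obtain ⟨p, hp⟩ := hC.exists_isLeast hne
  obtain ⟨q, hq⟩ := hC.exists_isGreatest hne
  have hsub : ∀ p' q', c p' = v → c q' = v → p' < q' → p' ≤ p → q ≤ q' → μ.real C ≤ 1 / K :=
    fun p' q' h1 h2 h3 h4 h5 => (measureReal_mono (s₁ := C) (s₂ := Set.Icc p' q') fun x hx =>
      ⟨h4.trans (hp.2 hx), (hq.2 hx).trans h5⟩).trans (hpair p' q' h1 h2 h3)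
  rcases (hp.2 hq.1).lt_or_eq with h | h
  · exact hsub p q (hCs hp.1) (hCs hq.1) h le_rfl le_rfl
  -- A one-point compact set is enlarged by a second point of the cell, so that the bound for pairs
  -- applies.
  · rw [Set.not_subsingleton_iff] at hv
    obtain ⟨z, hz, hzp⟩ := hv.exists_ne p
    rcases lt_or_gt_of_ne hzp with h' | h'
    · exact hsub z p hz (hCs hp.1) h' h'.le h.ge
    · exact hsub p z (hCs hp.1) hz h' le_rfl (h.ge.trans h'.le)

/-! ### Empirical measures and concentration -/

/-- The empirical distribution of a sample. -/
noncomputable def empiricalMeasure {α : Type*} [MeasurableSpace α] {m : ℕ} (S : Fin m → α) :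
    Measure α :=
  (m : ENNReal)⁻¹ • ∑ i, Measure.dirac (S i)

lemma empiricalMeasure_real {α : Type*} [MeasurableSpace α] {m : ℕ} (S : Fin m → α)
    {E : Set α} (hE : MeasurableSet E) :
    (empiricalMeasure S).real E = (∑ i, E.indicator (fun _ => (1 : ℝ)) (S i)) / m := by
  rw [empiricalMeasure, measureReal_ennreal_smul_apply, measureReal_def, Measure.finsetSum_apply,
    ENNReal.toReal_sum (by simp), div_eq_inv_mul]
  · simp only [ENNReal.toReal_inv, ENNReal.toReal_natCast]
    congr 1
    refine Finset.sum_congr rfl fun i _ => ?_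
    rw [Measure.dirac_apply' _ hE]
    by_cases h : S i ∈ E <;> simp [h]

lemma isProbabilityMeasure_empiricalMeasure {α : Type*} [MeasurableSpace α] {m : ℕ} (hm : 0 < m)
    (S : Fin m → α) : IsProbabilityMeasure (empiricalMeasure S) := by
  constructor
  have : (m : ENNReal) ≠ 0 := by exact_mod_cast hm.ne'
  simp [empiricalMeasure, ENNReal.inv_mul_cancel this]

/-- Hoeffding's inequality: a centred variable with range in an interval of length one is
sub-Gaussian with parameter 1/4. -/
lemma measure_empirical_sub_ge_le {α : Type*} [MeasurableSpace α] (J : Measure α)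
    [IsProbabilityMeasure J] {m : ℕ} (hm : 0 < m) {X : α → ℝ} (hX : Measurable X)
    (hX1 : ∀ z, X z ∈ Set.Icc (0 : ℝ) 1) {β : ℝ} (hβ : 0 ≤ β) :
    (Measure.pi fun _ : Fin m => J).real {S | β * m ≤ ∑ i, (X (S i) - ∫ z, X z ∂J)} ≤
      Real.exp (-(2 * m * β ^ 2)) := by
  have hm' : (0 : ℝ) < m := by exact_mod_cast hm
  have hind : ProbabilityTheory.iIndepFun (fun i (S : Fin m → α) => X (S i) - ∫ z, X z ∂J)
      (Measure.pi fun _ : Fin m => J) :=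
    ProbabilityTheory.iIndepFun_pi (X := fun _ z => X z - ∫ z, X z ∂J)
      fun i => (hX.sub_const _).aemeasurable
  have hsub : ∀ i ∈ (Finset.univ : Finset (Fin m)), ProbabilityTheory.HasSubgaussianMGF
      (fun S : Fin m → α => X (S i) - ∫ z, X z ∂J) ((‖(1 : ℝ) - 0‖₊ / 2) ^ 2)
      (Measure.pi fun _ : Fin m => J) := by
    intro i _
    have := ProbabilityTheory.hasSubgaussianMGF_of_mem_Icc (μ := Measure.pi fun _ : Fin m => J)
      (X := fun S => X (S i)) (hX.comp (measurable_pi_apply i)).aemeasurable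
      (Filter.Eventually.of_forall fun S => hX1 (S i))
    have e : ∫ S, X (S i) ∂(Measure.pi fun _ : Fin m => J) = ∫ z, X z ∂J :=
      integral_comp_eval (μ := fun _ : Fin m => J) hX.aestronglyMeasurable
    rwa [e] at this
  refine (ProbabilityTheory.HasSubgaussianMGF.measure_sum_ge_le_of_iIndepFun hind hsub
    (by positivity : 0 ≤ β * m)).trans (Real.exp_le_exp.2 (le_of_eq ?_))
  simp
  field_simp

/-- The lower tail for `E` is the upper tail for its complement. -/
lemma measure_abs_empirical_sub_gt_le {α : Type*} [MeasurableSpace α] (J : Measure α)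
    [IsProbabilityMeasure J] {m : ℕ} (hm : 0 < m) {E : Set α} (hE : MeasurableSet E) {β : ℝ}
    (hβ : 0 ≤ β) :
    (Measure.pi fun _ : Fin m => J) {S | β < |(empiricalMeasure S).real E - J.real E|} ≤
      ENNReal.ofReal (2 * Real.exp (-(2 * m * β ^ 2))) := by
  have hm' : (0 : ℝ) < m := by exact_mod_cast hm
  have hi : ∀ E : Set α, MeasurableSet E →
      ∫ z, E.indicator (fun _ => (1 : ℝ)) z ∂J = J.real E := fun E hE => by
    rw [integral_indicator_const _ hE]; simp
  have key : ∀ E : Set α, MeasurableSet E → (Measure.pi fun _ : Fin m => J).real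
      {S | β * m ≤ ∑ i, (E.indicator (fun _ => (1 : ℝ)) (S i) - J.real E)} ≤
        Real.exp (-(2 * m * β ^ 2)) := by
    intro E hE
    have := measure_empirical_sub_ge_le J hm (X := E.indicator fun _ => (1 : ℝ))
      (measurable_const.indicator hE) (fun z => by
        by_cases h : z ∈ E <;> simp [h]) hβ
    rwa [hi E hE] at this
  have h1 := key E hE
  have h2 := key Eᶜ hE.compl
  rw [← ofReal_measureReal]
  refine ENNReal.ofReal_le_ofReal ?_
  refine (measureReal_mono (s₂ := {S | β * m ≤ ∑ i, (E.indicator (fun _ => (1 : ℝ)) (S i) -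
    J.real E)} ∪ {S | β * m ≤ ∑ i, (Eᶜ.indicator (fun _ => (1 : ℝ)) (S i) - J.real Eᶜ)})
    ?_ (measure_ne_top _ _)).trans ((measureReal_union_le _ _).trans (by linarith))
  intro S hS
  simp only [Set.mem_ofPred_eq, empiricalMeasure_real S hE] at hS
  have e1 : ∑ i, (E.indicator (fun _ => (1 : ℝ)) (S i) - J.real E) =
      ((∑ i, E.indicator (fun _ => (1 : ℝ)) (S i)) / m - J.real E) * m := by
    simp [Finset.sum_sub_distrib]; field_simp
  have e2 : ∑ i, (Eᶜ.indicator (fun _ => (1 : ℝ)) (S i) - J.real Eᶜ) =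
      -(((∑ i, E.indicator (fun _ => (1 : ℝ)) (S i)) / m - J.real E) * m) := by
    rw [← e1, ← Finset.sum_neg_distrib]
    refine Finset.sum_congr rfl fun i _ => ?_
    rw [measureReal_compl hE, probReal_univ]
    by_cases h : S i ∈ E <;> simp [h]
  simp only [Set.mem_union, Set.mem_ofPred_eq, e1, e2, ← neg_mul]
  rcases lt_abs.1 hS with h | h
  · exact Or.inl (mul_le_mul_of_nonneg_right h.le hm'.le)
  · exact Or.inr (mul_le_mul_of_nonneg_right h.le hm'.le)

/-- The distribution of `p` on the event `y ∈ T`. -/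
noncomputable def labelMarginal (J : Measure (unitInterval × Bool)) (T : Set Bool) :
    Measure unitInterval :=
  (J.restrict (Prod.snd ⁻¹' T)).map Prod.fst

lemma labelMarginal_apply (J : Measure (unitInterval × Bool)) (T : Set Bool)
    {A : Set unitInterval} (hA : MeasurableSet A) : labelMarginal J T A = J (A ×ˢ T) := by
  rw [labelMarginal, Measure.map_apply measurable_fst hA,
    Measure.restrict_apply (measurable_fst hA), Set.prod_eq]

lemma labelMarginal_real (J : Measure (unitInterval × Bool)) (T : Set Bool)
    {A : Set unitInterval} (hA : MeasurableSet A) :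
    (labelMarginal J T).real A = J.real (A ×ˢ T) := by
  rw [Measure.real, labelMarginal_apply J T hA, Measure.real]

instance (J : Measure (unitInterval × Bool)) [IsFiniteMeasure J] (T : Set Bool) :
    IsFiniteMeasure (labelMarginal J T) := by
  unfold labelMarginal; infer_instance

/-- On every partition into at most `t` intervals, the total deviation of the empirical frequencies
of the buckets, and of the positive labels in them, is at most `x`. -/
def SmallDiscrepancy (P Q : Measure (unitInterval × Bool)) (t : ℕ) (x : ℝ) : Prop :=
  ∀ (b : Bool) (t' : ℕ), t' ≤ t → ∀ A : Fin t' → Set unitInterval, (∀ j, (A j).OrdConnected) →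
    (Pairwise fun i j => Disjoint (A i) (A j)) →
    ∑ j, |Q.real (A j ×ˢ (if b then Set.univ else {true})) -
      P.real (A j ×ˢ (if b then Set.univ else {true}))| ≤ x

/-- The grid depends on `J` only, not on the sample, so a union bound over the finitely many unions
of `2 * t` ranges is legitimate. -/
lemma measure_not_smallDiscrepancy_le (J : Measure (unitInterval × Bool)) [IsProbabilityMeasure J]
    {m K t : ℕ} (hm : 0 < m) (hK : 0 < K) {β : ℝ} (hβ : 0 ≤ β) :
    (Measure.pi fun _ : Fin m => J)
      {S | ¬ SmallDiscrepancy J (empiricalMeasure S) t (3 * β + 4 * t * (1 / K))} ≤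
      ENNReal.ofReal (4 * (2 * K + 2) ^ (4 * t) * Real.exp (-(2 * m * β ^ 2))) := by
  have hJ' : IsProbabilityMeasure (labelMarginal J Set.univ) := by
    constructor
    rw [labelMarginal_apply J _ MeasurableSet.univ, Set.univ_prod_univ]
    exact measure_univ
  obtain ⟨c, hc, hM, hfib⟩ := exists_grid (labelMarginal J Set.univ) hK
  let lab : Bool → Set Bool := fun b => if b then Set.univ else {true}
  let E : (Fin (2 * t) → Fin (2 * K + 2) × Fin (2 * K + 2)) × Bool → Set (unitInterval × Bool) :=
    fun z => gridUnion c (fun i => (((z.1 i).1 : ℕ), ((z.1 i).2 : ℕ))) ×ˢ lab z.2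
  have hEm : ∀ z, MeasurableSet (E z) := fun z =>
    (measurableSet_gridUnion hc _).prod (Set.to_countable _).measurableSet
  have hsub : {S : Fin m → _ | ¬ SmallDiscrepancy J (empiricalMeasure S) t
      (3 * β + 4 * t * (1 / K))} ⊆
      ⋃ z, {S | β < |(empiricalMeasure S).real (E z) - J.real (E z)|} := by
    intro S hS
    by_contra hcon
    apply hS
    simp only [Set.mem_iUnion, Set.mem_ofPred_eq, not_exists, not_lt] at hcon
    have := isProbabilityMeasure_empiricalMeasure hm S
    intro b t' ht' A hA hd
    have hAm : ∀ j, MeasurableSet (A j) := fun j => (hA j).measurableSet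
    have key := sum_abs_discrepancy_le (μ := labelMarginal J (lab b))
      (ν := labelMarginal (empiricalMeasure S) (lab b)) hc hM (κ := 1 / K) (β := β)
      (by positivity) (fun v hv => ?_) (n := 2 * t) (t := t') (by omega) (fun g hg => ?_) hA hd
    · simp only [labelMarginal_real _ _ (hAm _)] at key
      refine key.trans ?_
      gcongr
    -- The grid for the full marginal also serves the positive labels, whose marginal is smaller.
    · refine le_trans ?_ (hfib v hv)
      have hmv : MeasurableSet (c ⁻¹' {v}) := hc.measurable (measurableSet_singleton v)
      rw [labelMarginal_real _ _ hmv, labelMarginal_real _ _ hmv]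
      exact measureReal_mono (Set.prod_mono le_rfl (Set.subset_univ _))
    · have hgm := measurableSet_gridUnion hc g
      rw [labelMarginal_real _ _ hgm, labelMarginal_real _ _ hgm]
      exact hcon (fun i => (⟨(g i).1, by have := hg i; omega⟩, ⟨(g i).2, by have := hg i; omega⟩),
        b)
  refine (measure_mono hsub).trans ((measure_iUnion_fintype_le _ _).trans ?_)
  refine (Finset.sum_le_sum fun z _ => measure_abs_empirical_sub_gt_le J hm (hEm z) hβ).trans ?_
  rw [Finset.sum_const, nsmul_eq_mul, ← ENNReal.ofReal_natCast, ← ENNReal.ofReal_mul (by positivity)]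
  -- Each of the `2 * t` ranges has two end points with `2 * K + 2` choices; the factor 4 is two
  -- label sets times two tails.
  refine ENNReal.ofReal_le_ofReal (le_of_eq ?_)
  simp
  have : ((2 * K + 2 : ℝ) * (2 * K + 2)) ^ (2 * t) = (2 * K + 2) ^ (4 * t) := by
    rw [← pow_two, ← pow_mul]; congr 1; ring
  rw [this]
  ring

/-! ### Proper losses -/

/-- Propriety at `a` and at `b` gives `a * u ≤ (1 - a) * w` and `(1 - b) * w ≤ b * u`. Eliminating
`u` leaves `0 ≤ (b - a) * w`, hence `0 ≤ w`, and then `0 ≤ u`. -/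
lemma IsProperLoss.mono_labels {l : unitInterval → Bool → ℝ} (h : IsProperLoss l)
    {a b : unitInterval} (hab : a ≤ b) : l b true ≤ l a true ∧ l a false ≤ l b false := by
  rcases hab.eq_or_lt with rfl | hlt
  · simp
  have h1 := h b a
  have h2 := h a b
  simp only [bernoulliLoss] at h1 h2
  have hlt' : (a : ℝ) < b := hlt
  have ha := a.2.1
  have hb := b.2.2
  set u := l a true - l b true with hu
  set w := l b false - l a false with hw
  have e1 : (a : ℝ) * u ≤ (1 - a) * w := by rw [hu, hw]; linarith
  have e2 : (1 - (b : ℝ)) * w ≤ b * u := by rw [hu, hw]; linarith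
  have hw0 : 0 ≤ w := by
    by_contra hneg
    push Not at hneg
    nlinarith [mul_le_mul_of_nonneg_left e1 (by linarith : (0 : ℝ) ≤ b),
      mul_le_mul_of_nonneg_left e2 ha]
  have hu0 : 0 ≤ u := by
    by_contra hneg
    push Not at hneg
    nlinarith [mul_nonneg (sub_nonneg.2 hb) hw0]
  constructor <;> linarith

/-- The losses under the two labels move in opposite directions, so the change of their difference
is the sum of both changes and dominates each. -/
lemma IsProperLoss.abs_sub_le {l : unitInterval → Bool → ℝ} (h : IsProperLoss l)
    (a b : unitInterval) (y : Bool) :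
    |l a y - l b y| ≤ |(l a true - l a false) - (l b true - l b false)| := by
  rcases le_total a b with hab | hab
  · obtain ⟨h1, h2⟩ := h.mono_labels hab
    rw [abs_of_nonneg (by linarith : 0 ≤ (l a true - l a false) - (l b true - l b false))]
    cases y
    · rw [abs_of_nonpos (by linarith)]; linarith
    · rw [abs_of_nonneg (by linarith)]; linarith
  · obtain ⟨h1, h2⟩ := h.mono_labels hab
    rw [abs_of_nonpos (by linarith : (l a true - l a false) - (l b true - l b false) ≤ 0)]
    cases y
    · rw [abs_of_nonneg (by linarith)]; linarith
    · rw [abs_of_nonpos (by linarith)]; linarith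

lemma IsProperLoss.measurable {l : unitInterval → Bool → ℝ} (h : IsProperLoss l) :
    Measurable fun z : unitInterval × Bool => l z.1 z.2 := by
  refine measurable_from_prod_countable_left fun y => ?_
  cases y
  · exact Monotone.measurable (f := fun p => l p false) fun a b hab => (h.mono_labels hab).2
  · exact Antitone.measurable (f := fun p => l p true) fun a b hab => (h.mono_labels hab).1

lemma IsProperLoss.exists_bound {l : unitInterval → Bool → ℝ} (h : IsProperLoss l) :
    ∃ C, ∀ p y, ‖l p y‖ ≤ C := by
  refine ⟨|l 0 true| + |l 1 true| + |l 0 false| + |l 1 false|, fun p y => ?_⟩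
  obtain ⟨h1, h2⟩ := h.mono_labels (unitInterval.nonneg' : 0 ≤ p)
  obtain ⟨h3, h4⟩ := h.mono_labels (unitInterval.le_one' : p ≤ 1)
  have := le_abs_self (l 0 true)
  have := neg_abs_le (l 1 true)
  have := neg_abs_le (l 0 false)
  have := le_abs_self (l 1 false)
  have := abs_nonneg (l 0 true)
  have := abs_nonneg (l 1 true)
  have := abs_nonneg (l 0 false)
  have := abs_nonneg (l 1 false)
  rw [Real.norm_eq_abs, abs_le]
  cases y <;> constructor <;> linarith

lemma measurable_of_mem_generalizedMonotone {r : ℕ} {k : unitInterval → unitInterval}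
    (hk : k ∈ generalizedMonotone r) : Measurable k := by
  refine measurable_of_Ici fun v => ?_
  obtain ⟨A, hA, -, h⟩ := hk v
  have : k ⁻¹' Set.Ici v = ⋃ i, A i := by
    rw [← h]; ext p; simp
  rw [this]
  exact MeasurableSet.iUnion fun i => (hA i).measurableSet

lemma IsProperLoss.integrable_comp {l : unitInterval → Bool → ℝ} (h : IsProperLoss l)
    (J : Measure (unitInterval × Bool)) [IsFiniteMeasure J] {k : unitInterval → unitInterval}
    (hk : Measurable k) : Integrable (fun z => l (k z.1) z.2) J := by
  obtain ⟨C, hC⟩ := h.exists_bound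
  refine Integrable.of_bound (C := C) ?_ (Filter.Eventually.of_forall fun z => hC _ _)
  exact (h.measurable.comp ((hk.comp measurable_fst).prodMk measurable_snd)).aestronglyMeasurable

/-! ### Variation of generalized monotone functions over disjoint intervals -/

/-- Send a crossing bucket to the interval of the superlevel set that contains `b j`, together with
the side on which `a j` lies. This is injective: if two buckets had the same image, then either some
`a` would lie between two points of that interval and hence in the superlevel set, or one bucket
would contain a point of the other. -/
lemma card_crossing_le {ι : Type*} [Fintype ι] {A : ι → Set unitInterval}
    (hA : ∀ j, (A j).OrdConnected) (hd : Pairwise fun i j => Disjoint (A i) (A j))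
    {r : ℕ} {k : unitInterval → unitInterval} (hk : k ∈ generalizedMonotone r)
    {a b : ι → unitInterval} (hab : ∀ j, a j = b j ∨ (a j ∈ A j ∧ b j ∈ A j)) (u : unitInterval) :
    (Finset.univ.filter fun j => k (a j) < u ∧ u ≤ k (b j)).card ≤ 2 * r := by
  classical
  obtain ⟨I, hI, -, hU⟩ := hk u
  have hmem : ∀ p, u ≤ k p ↔ ∃ i, p ∈ I i := fun p => by
    have := Set.ext_iff.1 hU p
    simpa using this
  set s := Finset.univ.filter fun j => k (a j) < u ∧ u ≤ k (b j) with hs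
  have hs' : ∀ j ∈ s, (∀ i, a j ∉ I i) ∧ (∃ i, b j ∈ I i) ∧ a j ∈ A j ∧ b j ∈ A j ∧ a j ≠ b j := by
    intro j hj
    obtain ⟨h1, h2⟩ := (Finset.mem_filter.1 hj).2
    have hne : a j ≠ b j := fun h => by rw [h] at h1; exact absurd h1 (not_lt.2 h2)
    refine ⟨fun i hi => absurd ((hmem _).2 ⟨i, hi⟩) (not_le.2 h1), (hmem _).1 h2, ?_⟩
    obtain h | h := hab j
    · exact absurd h hne
    · exact ⟨h.1, h.2, hne⟩
  -- `none` is a default for the irrelevant `j`, needed since `Fin r` may be empty.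
  have hex : ∀ j, ∃ i : Option (Fin r), j ∈ s → ∃ i', i = some i' ∧ b j ∈ I i' := by
    intro j
    by_cases hj : j ∈ s
    · obtain ⟨i, hi⟩ := (hs' j hj).2.1
      exact ⟨some i, fun _ => ⟨i, rfl, hi⟩⟩
    · exact ⟨none, fun h => absurd h hj⟩
  choose i hi using hex
  have hcard : ((Finset.univ : Finset (Fin r × Bool)).map
      ⟨fun z => (some z.1, z.2), fun x y h => by simpa [Prod.ext_iff] using h⟩).card = 2 * r := by
    simp [mul_comm]
  rw [← hcard]
  refine Finset.card_le_card_of_injOn (fun j => (i j, decide (a j < b j))) (fun j hj => ?_) ?_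
  · obtain ⟨i', h, -⟩ := hi j hj
    exact Finset.mem_coe.2 (Finset.mem_map.2
      ⟨(i', decide (a j < b j)), Finset.mem_univ _, Prod.ext h.symm rfl⟩)
  · have key : ∀ j ∈ s, ∀ j' ∈ s, i j = i j' → (a j < b j ↔ a j' < b j') → b j < b j' → j = j' := by
      intro j hj j' hj' hii hlt hbb
      by_contra hne
      obtain ⟨i1, h1, hb1⟩ := hi j hj
      obtain ⟨i2, h2, hb2⟩ := hi j' hj'
      obtain rfl : i1 = i2 := by rw [h1, h2] at hii; exact Option.some.inj hii
      obtain ⟨n1, -, ha1, hbA1, ne1⟩ := hs' j hj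
      obtain ⟨n2, -, ha2, hbA2, ne2⟩ := hs' j' hj'
      by_cases hl : a j < b j
      · have hl' := hlt.1 hl
        by_cases hcmp : b j ≤ a j'
        · exact n2 i1 ((hI i1).out hb1 hb2 ⟨hcmp, hl'.le⟩)
        · push Not at hcmp
          exact Set.disjoint_left.1 (hd hne) hbA1 ((hA j').out ha2 hbA2 ⟨hcmp.le, hbb.le⟩)
      · have hl' : b j' < a j' := lt_of_le_of_ne (not_lt.1 fun h => hl (hlt.2 h)) ne2.symm
        have hl : b j < a j := lt_of_le_of_ne (not_lt.1 hl) ne1.symm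
        by_cases hcmp : a j ≤ b j'
        · exact n1 i1 ((hI i1).out hb1 hb2 ⟨hl.le, hcmp⟩)
        · push Not at hcmp
          exact Set.disjoint_left.1 (hd hne) ((hA j).out hbA1 ha1 ⟨hbb.le, hcmp.le⟩) hbA2
    intro j hj j' hj' h
    simp only [Prod.mk.injEq, decide_eq_decide] at h
    rcases lt_trichotomy (b j) (b j') with hb | hb | hb
    · exact key j hj j' hj' h.1 h.2 hb
    · by_contra hne
      have e1 := (hs' j hj).2.2.2.1
      have e2 := (hs' j' hj').2.2.2.1
      rw [← hb] at e2
      exact Set.disjoint_left.1 (hd hne) e1 e2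
    · exact (key j' hj' j hj h.1.symm h.2.symm hb).symm

/-- Each increment is at most the length of an interval of values; integrate over the value `v` the
number of intervals that contain it. -/
lemma sum_monotone_sub_le {ι : Type*} [Fintype ι] {φ : unitInterval → ℝ} (hφ : Monotone φ)
    {x y : ι → unitInterval} {N : ℕ}
    (hN : ∀ u, (Finset.univ.filter fun j => y j < u ∧ u ≤ x j).card ≤ N) :
    ∑ j, (φ (x j) - φ (y j)) ≤ N * (φ 1 - φ 0) := by
  classical
  have hN' : ∀ v, (Finset.univ.filter fun j => v ∈ Set.Ioc (φ (y j)) (φ (x j))).card ≤ N := by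
    intro v
    set s := Finset.univ.filter fun j => v ∈ Set.Ioc (φ (y j)) (φ (x j)) with hs
    rcases s.eq_empty_or_nonempty with h | hne
    · simp [h]
    -- As `φ` may jump, `v` need not be a value of `φ`. The smallest `x i` is a common threshold in
    -- the domain: `φ (y j) < v ≤ φ (x i)` gives `y j < x i`.
    obtain ⟨i, hi, hmin⟩ := s.exists_min_image x hne
    refine le_trans (Finset.card_le_card fun j hj => ?_) (hN (x i))
    refine Finset.mem_filter.2 ⟨Finset.mem_univ _, ?_, hmin j hj⟩
    exact hφ.reflect_lt ((Finset.mem_filter.1 hj).2.1.trans_le (Finset.mem_filter.1 hi).2.2)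
  have h01 : φ 0 ≤ φ 1 := hφ zero_le_one
  calc ∑ j, (φ (x j) - φ (y j))
      ≤ ∑ j, ∫ v, (Set.Ioc (φ (y j)) (φ (x j))).indicator (fun _ => (1 : ℝ)) v := by
        refine Finset.sum_le_sum fun j _ => ?_
        rw [integral_indicator_const _ measurableSet_Ioc]
        simp [Measure.real, ENNReal.toReal_ofReal']
    _ = ∫ v, ∑ j, (Set.Ioc (φ (y j)) (φ (x j))).indicator (fun _ => (1 : ℝ)) v := by
        rw [integral_finsetSum]
        intro j _
        exact (integrable_indicator_iff measurableSet_Ioc).2 (by simp)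
    _ ≤ ∫ v, (Set.Ioc (φ 0) (φ 1)).indicator (fun _ => (N : ℝ)) v := by
        refine integral_mono ?_ ?_ fun v => ?_
        · exact integrable_finsetSum _ fun j _ =>
            (integrable_indicator_iff measurableSet_Ioc).2 (by simp)
        · exact (integrable_indicator_iff measurableSet_Ioc).2 (by simp)
        · have hle := hN' v
          simp only [Set.indicator_apply, Finset.sum_boole]
          split_ifs with hv
          · exact_mod_cast hle
          · refine le_of_eq ?_
            rw [Nat.cast_eq_zero, Finset.card_eq_zero, Finset.filter_eq_empty_iff]
            intro j _ hj
            exact hv ⟨(hφ unitInterval.nonneg').trans_lt hj.1, hj.2.trans (hφ unitInterval.le_one')⟩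
    _ = N * (φ 1 - φ 0) := by
        rw [integral_indicator_const _ measurableSet_Ioc]
        simp [Measure.real, h01, mul_comm]

/-- The oscillation need not be attained, but the crossing argument needs actual points of the
bucket; hence the slack `θ`. -/
lemma exists_approx_oscillation {α : Type*} {f : α → ℝ} {A : Set α} (hne : A.Nonempty) {C : ℝ}
    (hf : ∀ p, |f p| ≤ C) {θ : ℝ} (hθ : 0 < θ) :
    ∃ a ∈ A, ∃ b ∈ A, f a ≤ f b ∧ ∀ p ∈ A, ∀ q ∈ A, f p - f q ≤ f b - f a + θ := by
  have hba : BddAbove (f '' A) := ⟨C, by rintro _ ⟨p, -, rfl⟩; exact (abs_le.1 (hf p)).2⟩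
  have hbb : BddBelow (f '' A) := ⟨-C, by rintro _ ⟨p, -, rfl⟩; exact (abs_le.1 (hf p)).1⟩
  obtain ⟨_, ⟨b, hb, rfl⟩, hb'⟩ := exists_lt_of_lt_csSup (hne.image f)
    (by linarith : sSup (f '' A) - θ / 2 < sSup (f '' A))
  obtain ⟨_, ⟨a, ha, rfl⟩, ha'⟩ := exists_lt_of_csInf_lt (hne.image f)
    (by linarith : sInf (f '' A) < sInf (f '' A) + θ / 2)
  have hle : ∀ p ∈ A, ∀ q ∈ A, f p - f q ≤ sSup (f '' A) - sInf (f '' A) := fun p hp q hq =>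
    sub_le_sub (le_csSup hba ⟨p, hp, rfl⟩) (csInf_le hbb ⟨q, hq, rfl⟩)
  rcases le_total (f a) (f b) with h | h
  · exact ⟨a, ha, b, hb, h, fun p hp q hq => (hle p hp q hq).trans (by linarith)⟩
  · exact ⟨a, ha, a, ha, le_rfl, fun p hp q hq => (hle p hp q hq).trans (by linarith)⟩

/-! ### Recalibration on buckets with small discrepancy gives an omnipredictor -/

lemma integral_const_prediction (J : Measure (unitInterval × Bool)) [IsFiniteMeasure J]
    (l : unitInterval → Bool → ℝ) (w : unitInterval) {A : Set unitInterval}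
    (hA : MeasurableSet A) :
    ∫ z in A ×ˢ Set.univ, l w z.2 ∂J = J.real (A ×ˢ {true}) * l w true +
      (J.real (A ×ˢ Set.univ) - J.real (A ×ˢ {true})) * l w false := by
  have h1 : A ×ˢ (Set.univ : Set Bool) = (A ×ˢ {true}) ∪ (A ×ˢ {false}) := by
    rw [← Set.prod_union]; congr 1; ext b; cases b <;> simp
  have hm : ∀ b : Bool, MeasurableSet (A ×ˢ {b}) := fun b =>
    hA.prod (measurableSet_singleton b)
  have hd : Disjoint (A ×ˢ ({true} : Set Bool)) (A ×ˢ {false}) := by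
    rw [Set.disjoint_prod]; right; simp
  have hc : ∀ b : Bool, ∫ z in A ×ˢ {b}, l w z.2 ∂J = J.real (A ×ˢ {b}) * l w b := by
    intro b
    rw [setIntegral_congr_fun (g := fun _ => l w b) (hm b) (fun z hz => by
      obtain ⟨-, h⟩ := hz
      simp only [Set.mem_singleton_iff] at h
      simp [h])]
    simp
  have hi : ∀ b : Bool, IntegrableOn (fun z : unitInterval × Bool => l w z.2) (A ×ˢ {b}) J := by
    intro b
    refine (integrableOn_congr_fun (g := fun _ => l w b) (fun z hz => ?_) (hm b)).2
      (integrableOn_const (by finiteness))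
    obtain ⟨-, h⟩ := hz
    simp only [Set.mem_singleton_iff] at h
    simp [h]
  rw [h1, setIntegral_union hd (hm false) (hi true) (hi false), hc, hc,
    measureReal_union hd (hm false)]
  ring

/-- If the positive mass were exactly `P * v`, this would be propriety at `v`. Moving it to `P₁`
changes each side by at most `|P₁ - P * v|`. -/
lemma calibrated_bucket_le {l : unitInterval → Bool → ℝ} (hl : l ∈ properLosses)
    (v w : unitInterval) {P P₁ : ℝ} (hP : 0 ≤ P) :
    P₁ * l v true + (P - P₁) * l v false ≤
      P₁ * l w true + (P - P₁) * l w false + 2 * |P₁ - P * v| := by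
  have h1 := mul_le_mul_of_nonneg_left (hl.1 w v) hP
  simp only [bernoulliLoss] at h1
  have hv := abs_le.1 (hl.2 v)
  have hw := abs_le.1 (hl.2 w)
  have h2 : (P₁ - P * v) * ((l v true - l v false) - (l w true - l w false)) ≤
      |P₁ - P * v| * 2 := by
    refine (le_abs_self _).trans ?_
    rw [abs_mul]
    refine mul_le_mul_of_nonneg_left ?_ (abs_nonneg _)
    rw [abs_le]
    constructor <;> linarith [hv.1, hv.2, hw.1, hw.2]
  linarith

/-- The budget: `η * (4 * r) = ε / 2` for the oscillations, `θ = ε / 4` for choosing nearly extremal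
points, and `6 * x ≤ ε / 4` for the discrepancies. -/
theorem isOmnipredictor_of_smallDiscrepancy {P Q : Measure (unitInterval × Bool)}
    [IsProbabilityMeasure P] [IsProbabilityMeasure Q] {t r : ℕ} {ε x η : ℝ} (hr : 1 ≤ r)
    (hε : 0 < ε) (hη : η = ε / (8 * r)) (hx : x ≤ ε / 24)
    {A : Fin t → Set unitInterval} (hA : ∀ j, (A j).OrdConnected)
    (hd : Pairwise fun i j => Disjoint (A i) (A j)) (hcov : ⋃ j, A j = Set.univ)
    (hmass : ∀ j, Q.real (A j ×ˢ Set.univ) ≤ η ∨ ∃ a, A j = {a})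
    (hPQ : SmallDiscrepancy P Q t x) {khat : unitInterval → unitInterval} {v : Fin t → ℝ}
    (hk : ∀ j, ∀ p ∈ A j, (khat p : ℝ) = v j)
    (hv : ∀ j, v j * Q.real (A j ×ˢ Set.univ) = Q.real (A j ×ˢ {true})) :
    IsOmnipredictor P ε (generalizedMonotone r) khat := by
  classical
  intro l hl k hkM
  have hAm : ∀ j, MeasurableSet (A j) := fun j => (hA j).measurableSet
  have hAum : ∀ j, MeasurableSet (A j ×ˢ (Set.univ : Set Bool)) := fun j =>
    (hAm j).prod MeasurableSet.univ
  have hkm := measurable_of_mem_generalizedMonotone hkM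
  have hcov' : ⋃ j, A j ×ˢ (Set.univ : Set Bool) = Set.univ := by
    rw [← Set.iUnion_prod_const, hcov, Set.univ_prod_univ]
  have hd' : Pairwise fun i j =>
      Disjoint (A i ×ˢ (Set.univ : Set Bool)) (A j ×ˢ (Set.univ : Set Bool)) := fun i j hij =>
    Set.disjoint_prod.2 (Or.inl (hd hij))
  have hkhatm : Measurable khat := by
    have : Measurable fun p => (khat p : ℝ) := by
      have e : (fun p => (khat p : ℝ)) = fun p => ∑ j, (A j).indicator (fun _ => v j) p := by
        funext p
        obtain ⟨j, hj⟩ : ∃ j, p ∈ A j := by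
          have : p ∈ ⋃ j, A j := by rw [hcov]; trivial
          simpa using this
        rw [Finset.sum_eq_single j]
        · rw [Set.indicator_of_mem hj, hk j p hj]
        · intro i _ hij
          exact Set.indicator_of_notMem (fun hi => Set.disjoint_left.1 (hd hij) hi hj) _
        · simp
      rw [e]
      exact Finset.measurable_sum _ fun j _ => measurable_const.indicator (hAm j)
    exact this.subtype_mk (p := fun x => x ∈ unitInterval) (h := fun p => (khat p).2)
  have hint := hl.1.integrable_comp P hkm
  have hsplit : ∀ {k' : unitInterval → unitInterval}, Measurable k' →
      expectedLoss P l k' = ∑ j, ∫ z in A j ×ˢ Set.univ, l (k' z.1) z.2 ∂P := by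
    intro k' hk'
    rw [expectedLoss, ← setIntegral_univ, ← hcov', integral_iUnion_fintype hAum hd']
    exact fun j => (hl.1.integrable_comp P hk').integrableOn
  rw [hsplit hkhatm, hsplit hkm]
  -- nearly extremal points of the buckets
  set φ : unitInterval → ℝ := fun p => -(l p true - l p false) with hφ
  have hφm : Monotone φ := fun a b hab => by
    have := hl.1.mono_labels hab
    simp only [hφ]
    linarith [this.1, this.2]
  have hφb : ∀ p, |φ p| ≤ 1 := fun p => by
    simp only [hφ, abs_neg]; exact hl.2 p
  set θ := ε / 4 with hθ
  have hθ0 : 0 < θ := by positivity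
  -- An empty bucket receives `a = b = 0`, which `card_crossing_le` allows and which has no
  -- oscillation.
  have hosc : ∀ j, ∃ a b, (a = b ∨ (a ∈ A j ∧ b ∈ A j)) ∧ φ (k a) ≤ φ (k b) ∧
      ((A j).Nonempty → a ∈ A j ∧ b ∈ A j) ∧
      ∀ p ∈ A j, ∀ q ∈ A j, φ (k p) - φ (k q) ≤ φ (k b) - φ (k a) + θ := by
    intro j
    rcases (A j).eq_empty_or_nonempty with h | h
    · refine ⟨0, 0, Or.inl rfl, le_rfl, ?_, ?_⟩ <;> simp [h]
    · obtain ⟨a, ha, b, hb, hle, h'⟩ := exists_approx_oscillation (f := fun p => φ (k p)) h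
        (fun p => hφb (k p)) hθ0
      exact ⟨a, b, Or.inr ⟨ha, hb⟩, hle, fun _ => ⟨ha, hb⟩, h'⟩
  choose a b hab hle hmem ho using hosc
  have hsum : ∑ j, (φ (k (b j)) - φ (k (a j))) ≤ 4 * r := by
    refine (sum_monotone_sub_le hφm (N := 2 * r) fun u =>
      card_crossing_le hA hd hkM hab u).trans ?_
    have h1 := abs_le.1 (hφb 1)
    have h0 := abs_le.1 (hφb 0)
    push_cast
    nlinarith [h1.2, h0.1, (Nat.cast_nonneg r : (0 : ℝ) ≤ r)]
  -- the comparison on one bucket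
  set dev : Fin t → ℝ := fun j => |Q.real (A j ×ˢ Set.univ) - P.real (A j ×ˢ Set.univ)|
  set dev₁ : Fin t → ℝ := fun j => |Q.real (A j ×ˢ {true}) - P.real (A j ×ˢ {true})|
  have hη0 : 0 ≤ η := by rw [hη]; positivity
  have hbucket : ∀ j, ∫ z in A j ×ˢ Set.univ, l (khat z.1) z.2 ∂P ≤
      ∫ z in A j ×ˢ Set.univ, l (k z.1) z.2 ∂P + (η * (φ (k (b j)) - φ (k (a j))) +
        θ * P.real (A j ×ˢ Set.univ) + 4 * dev j + 2 * dev₁ j) := by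
    intro j
    have hdev : 0 ≤ dev j := abs_nonneg _
    have hdev₁ : 0 ≤ dev₁ j := abs_nonneg _
    have ho0 := sub_nonneg.2 (hle j)
    rcases (A j).eq_empty_or_nonempty with hempty | hne
    · simp only [hempty, Set.empty_prod, setIntegral_empty, measureReal_empty]
      nlinarith [mul_nonneg hη0 ho0]
    obtain ⟨haj, hbj⟩ := hmem j hne
    have e1 : ∫ z in A j ×ˢ Set.univ, l (khat z.1) z.2 ∂P =
        ∫ z in A j ×ˢ Set.univ, l (khat (a j)) z.2 ∂P := by
      refine setIntegral_congr_fun (hAum j) fun z hz => ?_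
      have : khat z.1 = khat (a j) := Subtype.ext ((hk j _ hz.1).trans (hk j _ haj).symm)
      simp only [this]
    have e2 := calibrated_bucket_le hl (khat (a j)) (k (a j))
      (P := P.real (A j ×ˢ Set.univ)) (P₁ := P.real (A j ×ˢ {true})) measureReal_nonneg
    have e3 : |P.real (A j ×ˢ {true}) - P.real (A j ×ˢ Set.univ) * khat (a j)| ≤
        dev₁ j + dev j := by
      have hv' := hv j
      rw [← hk j _ haj] at hv'
      have : P.real (A j ×ˢ {true}) - P.real (A j ×ˢ Set.univ) * khat (a j) =
          -(Q.real (A j ×ˢ {true}) - P.real (A j ×ˢ {true})) +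
          khat (a j) * (Q.real (A j ×ˢ Set.univ) - P.real (A j ×ˢ Set.univ)) := by
        rw [← hv']; ring
      rw [this]
      refine (abs_add_le _ _).trans ?_
      rw [abs_neg, abs_mul, abs_of_nonneg (khat (a j)).2.1]
      have := mul_le_mul_of_nonneg_right (khat (a j)).2.2 hdev
      linarith
    -- The competitor is replaced by its value at `a j`; by `IsProperLoss.abs_sub_le` this changes
    -- the loss at each point by at most the oscillation of `φ ∘ k` on the bucket.
    have e4 : ∫ z in A j ×ˢ Set.univ, l (k (a j)) z.2 ∂P ≤
        ∫ z in A j ×ˢ Set.univ, (l (k z.1) z.2 + (φ (k (b j)) - φ (k (a j)) + θ)) ∂P := by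
      refine setIntegral_mono_on (hl.1.integrable_comp P measurable_const).integrableOn
        (hint.add (integrable_const _)).integrableOn (hAum j) fun z hz => ?_
      have h1 := (abs_le.1 (hl.1.abs_sub_le (k (a j)) (k z.1) z.2)).2
      have h2 : |(l (k (a j)) true - l (k (a j)) false) - (l (k z.1) true - l (k z.1) false)| ≤
          φ (k (b j)) - φ (k (a j)) + θ := by
        rw [abs_le]
        have h3 := ho j _ hz.1 _ haj
        have h4 := ho j _ haj _ hz.1
        simp only [hφ] at h3 h4 ⊢
        constructor <;> linarith
      linarith
    rw [integral_add hint.integrableOn (integrable_const _), setIntegral_const, smul_eq_mul,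
      integral_const_prediction P l _ (hAm j)] at e4
    rw [e1, integral_const_prediction P l _ (hAm j)]
    -- Small buckets have `P`-mass at most `η + dev j`, and the oscillation is at most 2. On a
    -- one-point bucket the oscillation vanishes, whatever its mass.
    have e5 : P.real (A j ×ˢ Set.univ) * (φ (k (b j)) - φ (k (a j))) ≤
        η * (φ (k (b j)) - φ (k (a j))) + 2 * dev j := by
      rcases hmass j with h | ⟨c, hc⟩
      · have h1 : P.real (A j ×ˢ Set.univ) ≤ η + dev j := by
          have := neg_abs_le (Q.real (A j ×ˢ Set.univ) - P.real (A j ×ˢ Set.univ))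
          simp only [dev]
          linarith
        have h2 : φ (k (b j)) - φ (k (a j)) ≤ 2 := by
          have h1 := abs_le.1 (hφb (k (b j)))
          have h0 := abs_le.1 (hφb (k (a j)))
          linarith [h1.2, h0.1]
        nlinarith [mul_le_mul_of_nonneg_right h1 ho0]
      · have : a j = b j := by
          rw [hc] at haj hbj
          exact haj.trans hbj.symm
        rw [this, sub_self]
        linarith
    linarith
  refine (Finset.sum_le_sum fun j _ => hbucket j).trans ?_
  simp only [Finset.sum_add_distrib, ← Finset.mul_sum]
  have s1 : ∑ j, P.real (A j ×ˢ (Set.univ : Set Bool)) = 1 := by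
    rw [← measureReal_iUnion_fintype hd' hAum, hcov', probReal_univ]
  have s2 : ∑ j, dev j ≤ x := by simpa [dev] using hPQ true t le_rfl A hA hd
  have s3 : ∑ j, dev₁ j ≤ x := by simpa [dev₁] using hPQ false t le_rfl A hA hd
  have s4 : η * ∑ j, (φ (k (b j)) - φ (k (a j))) ≤ ε / 2 := by
    refine (mul_le_mul_of_nonneg_left hsum hη0).trans (le_of_eq ?_)
    have : (r : ℝ) ≠ 0 := by positivity
    rw [hη]; field_simp; norm_num
  rw [s1]
  linarith

/-! ### Sample complexity of uniform-mass binning -/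

lemma empiricalMeasure_prod_univ {m : ℕ} (S : Fin m → unitInterval × Bool)
    {A : Set unitInterval} (hA : MeasurableSet A) :
    (empiricalMeasure S).real (A ×ˢ Set.univ) = bucketCount S A / m := by
  classical
  rw [empiricalMeasure_real S (hA.prod MeasurableSet.univ), bucketCount]
  congr 1
  simp [Set.indicator_apply]

lemma empiricalMeasure_prod_true {m : ℕ} (S : Fin m → unitInterval × Bool)
    {A : Set unitInterval} (hA : MeasurableSet A) :
    (empiricalMeasure S).real (A ×ˢ {true}) = bucketPositives S A / m := by
  classical
  rw [empiricalMeasure_real S (hA.prod (measurableSet_singleton _)), bucketPositives]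
  congr 1
  simp [Set.indicator_apply]

lemma bucketPositives_le {m : ℕ} (S : Fin m → unitInterval × Bool) (A : Set unitInterval) :
    bucketPositives S A ≤ bucketCount S A :=
  Finset.card_le_card fun _ hi => by
    simp only [Finset.mem_filter, Finset.mem_univ, true_and] at hi ⊢
    exact hi.1

lemma umbLearns_of_exp_le {ε δ β : ℝ} {r m K t : ℕ} (hε : 0 < ε) (hr : 1 ≤ r) (hm : 0 < m)
    (hK : 0 < K) (hβ : 0 ≤ β) (ht : 16 * (r / ε) < t)
    (hx : 3 * β + 4 * t * (1 / K) ≤ ε / 24)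
    (hδ : 4 * (2 * K + 2) ^ (4 * t) * Real.exp (-(2 * m * β ^ 2)) ≤ δ) :
    UMBLearns ε δ r m := by
  classical
  intro J hJ
  have hm' : (0 : ℝ) < m := by exact_mod_cast hm
  have hr' : (0 : ℝ) < r := by exact_mod_cast hr
  refine le_trans (measure_mono fun S hS => ?_) ((measure_not_smallDiscrepancy_le J hm hK hβ
    (t := t)).trans (ENNReal.ofReal_le_ofReal hδ))
  intro hdisc
  apply hS
  rintro khat ⟨t', A, hA, hk⟩
  have hQ := isProbabilityMeasure_empiricalMeasure hm S
  have hAm : ∀ j, MeasurableSet (A j) := fun j => (hA.interval j).measurableSet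
  -- For `η = ε / (8 r)` the size bound `2 / η + 1` is `16 r / ε + 1`, which is less than `t + 1`.
  have ht' : t' ≤ t := by
    have h1 := hA.size
    have h2 : 2 / (ε / (8 * r)) = 16 * (r / ε) := by field_simp; norm_num
    rw [h2] at h1
    have h3 : (t' : ℝ) < (t + 1 : ℕ) := by push_cast; linarith
    exact Nat.lt_succ_iff.1 (by exact_mod_cast h3)
  refine isOmnipredictor_of_smallDiscrepancy (P := J) (Q := empiricalMeasure S) hr hε rfl hx
    hA.interval hA.disjoint hA.cover (fun j => ?_) (fun b s hs => hdisc b s (hs.trans ht'))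
    (v := fun j => bucketMean S (A j)) (fun j p hp => ?_) (fun j => ?_)
  · refine (hA.mass j).imp_left fun h => ?_
    rw [empiricalMeasure_prod_univ S (hAm j), div_le_iff₀ hm']
    exact h
  · rw [hk p, Finset.sum_eq_single j]
    · rw [if_pos hp]
    · intro i _ hij
      exact if_neg fun hi => Set.disjoint_left.1 (hA.disjoint hij) hi hp
    · simp
  · rw [empiricalMeasure_prod_univ S (hAm j), empiricalMeasure_prod_true S (hAm j), bucketMean]
    rcases Nat.eq_zero_or_pos (bucketCount S (A j)) with h | h
    · have := bucketPositives_le S (A j)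
      have h0 : bucketPositives S (A j) = 0 := by omega
      simp [h, h0]
    · have : (bucketCount S (A j) : ℝ) ≠ 0 := by exact_mod_cast h.ne'
      field_simp

/-- `H` stands for the logarithm of `r / ε`: the union bound has `exp (O(T H))` events, each of
probability `exp (-Ω(m ε²))`. -/
theorem umbLearns_of_sample_size {ε δ : ℝ} {r m H : ℕ} (hε : 0 < ε) (hε1 : ε < 1) (hδ : 0 < δ)
    (hr : 1 ≤ r) (hH : 256 * (r / ε) ≤ 2 ^ H)
    (hm : 1500000 * (r / ε * H + max 1 (Real.log (1 / δ))) / ε ^ 2 ≤ m) :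
    UMBLearns ε δ r m := by
  have hr' : (1 : ℝ) ≤ r := by exact_mod_cast hr
  set T : ℝ := r / ε with hT
  set L : ℝ := max 1 (Real.log (1 / δ)) with hL
  have hT1 : 1 ≤ T := by rw [hT, le_div_iff₀ hε]; linarith
  have hTε : 1 / ε ≤ T := by rw [hT]; gcongr
  have hL1 : 1 ≤ L := le_max_left _ _
  have hH1 : 1 ≤ H := by
    by_contra h
    obtain rfl : H = 0 := by omega
    norm_num at hH
    linarith
  have hH1' : (1 : ℝ) ≤ H := by exact_mod_cast hH1
  have hm0 : 0 < m := by
    have : (0 : ℝ) < 1500000 * (T * H + L) / ε ^ 2 := by positivity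
    exact_mod_cast this.trans_le hm
  set t : ℕ := ⌊16 * T⌋₊ + 1 with ht
  have ht1 : 16 * T < t := by rw [ht]; push_cast; exact Nat.lt_floor_add_one _
  have ht2 : (t : ℝ) ≤ 17 * T := by
    rw [ht]; push_cast
    have := Nat.floor_le (by positivity : (0 : ℝ) ≤ 16 * T)
    linarith
  -- Chosen so that `4 t / K ≤ 68 T / K ≤ ε / 48`. With `β = ε / 144` below, `3 β` is the other `ε /
  -- 48`.
  set K : ℕ := ⌈192 * 17 * T / ε⌉₊ with hK
  have hK1 : 192 * 17 * T / ε ≤ K := Nat.le_ceil _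
  have hK0 : (0 : ℝ) < K := lt_of_lt_of_le (by positivity) hK1
  have hTT : T / ε ≤ T ^ 2 := by
    calc T / ε = T * (1 / ε) := by ring
      _ ≤ T * T := by gcongr
      _ = T ^ 2 := by ring
  have hK2 : (2 * K + 2 : ℝ) ≤ 6532 * T ^ 2 := by
    have h1 : (K : ℝ) < 192 * 17 * T / ε + 1 := Nat.ceil_lt_add_one (by positivity)
    have h2 : 192 * 17 * T / ε = 3264 * (T / ε) := by ring
    nlinarith
  have hlogK : Real.log (2 * K + 2) ≤ 2 * H := by
    have h1 : (2 * K + 2 : ℝ) ≤ 2 ^ (2 * H) := by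
      rw [pow_mul']
      have : (256 * T) ^ 2 ≤ ((2 : ℝ) ^ H) ^ 2 := by gcongr
      nlinarith [sq_nonneg T]
    refine (Real.log_le_log (by positivity) h1).trans ?_
    rw [Real.log_pow]
    push_cast
    have := Real.log_two_lt_d9
    nlinarith
  refine umbLearns_of_exp_le (β := ε / 144) (K := K) (t := t) hε hr hm0 (by exact_mod_cast hK0)
    (by positivity) ht1 ?_ ?_
  · have : 4 * (t : ℝ) * (1 / K) ≤ ε / 48 := by
      rw [mul_one_div, div_le_iff₀ hK0]
      have h1 : ε / 48 * (192 * 17 * T / ε) = 68 * T := by field_simp; norm_num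
      have h2 := mul_le_mul_of_nonneg_left hK1 (by positivity : 0 ≤ ε / 48)
      linarith
    linarith
  · have hlogδ : -L ≤ Real.log δ := by
      have : Real.log (1 / δ) ≤ L := le_max_right _ _
      rw [one_div, Real.log_inv] at this
      linarith
    have hm2 : 1500000 * (T * H + L) ≤ m * ε ^ 2 := by
      rwa [div_le_iff₀ (by positivity)] at hm
    have h4 : (4 : ℝ) ≤ Real.exp 2 := by
      have := Real.add_one_le_exp (1 : ℝ)
      rw [show (2 : ℝ) = 1 + 1 by norm_num, Real.exp_add]
      nlinarith
    have hpow : ((2 * K + 2 : ℝ)) ^ (4 * t) ≤ Real.exp (136 * (T * H)) := by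
      rw [← Real.exp_log (by positivity : (0 : ℝ) < (2 * K + 2) ^ (4 * t)), Real.log_pow]
      apply Real.exp_le_exp.2
      push_cast
      have : 0 ≤ Real.log (2 * K + 2) := Real.log_nonneg (by linarith)
      calc 4 * (t : ℝ) * Real.log (2 * K + 2) ≤ 4 * (17 * T) * (2 * H) := by
            gcongr
        _ = 136 * (T * H) := by ring
    calc 4 * (2 * K + 2 : ℝ) ^ (4 * t) * Real.exp (-(2 * m * (ε / 144) ^ 2))
        ≤ Real.exp 2 * Real.exp (136 * (T * H)) * Real.exp (-(2 * m * (ε / 144) ^ 2)) := by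
          gcongr
      _ = Real.exp (2 + 136 * (T * H) - 2 * m * (ε / 144) ^ 2) := by
          rw [← Real.exp_add, ← Real.exp_add, sub_eq_add_neg]
      _ ≤ Real.exp (Real.log δ) := by
          apply Real.exp_le_exp.2
          have hTH : 1 ≤ T * H := one_le_mul_of_one_le_of_one_le hT1 hH1'
          -- The exponent `2 m β²` is at least `(3000000 / 144²) (T H + L)`, and `3000000 / 144² >
          -- 144` exceeds `2 + 136`.
          nlinarith
      _ = δ := Real.exp_log hδ

namespace RealRAM

/-! ### Total correctness with a bound on the number of steps -/

/-- Started in `s`, the program `c` can halt within `n` steps in a memory that satisfies `Q`. -/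
def Ends (c : Prog) (s : Mem) (n : ℕ) (Q : Mem → Prop) : Prop :=
  ∃ s' k, Exec c s s' k ∧ k ≤ n ∧ Q s'

/-- The program contains no assignment to the integer array `a`. -/
def Prog.KeepsNat (a : ℕ) : Prog → Prop
  | .skip => True
  | .setNat b _ _ => a ≠ b
  | .setReal _ _ _ => True
  | .seq c d => c.KeepsNat a ∧ d.KeepsNat a
  | .ite _ c d => c.KeepsNat a ∧ d.KeepsNat a
  | .loop _ c => c.KeepsNat a

/-- The program contains no assignment to the real array `a`. -/
def Prog.KeepsReal (a : ℕ) : Prog → Prop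
  | .skip => True
  | .setNat _ _ _ => True
  | .setReal b _ _ => a ≠ b
  | .seq c d => c.KeepsReal a ∧ d.KeepsReal a
  | .ite _ c d => c.KeepsReal a ∧ d.KeepsReal a
  | .loop _ c => c.KeepsReal a

/-- The memories agree on all arrays that `c` does not assign to. -/
structure Frame (c : Prog) (s s' : Mem) : Prop where
  nat : ∀ a, c.KeepsNat a → s'.nat a = s.nat a
  real : ∀ a, c.KeepsReal a → s'.real a = s.real a

lemma Frame.refl (c : Prog) (s : Mem) : Frame c s s := ⟨fun _ _ => rfl, fun _ _ => rfl⟩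

lemma Frame.trans {c : Prog} {s s₁ s₂ : Mem} (h : Frame c s s₁) (h' : Frame c s₁ s₂) :
    Frame c s s₂ :=
  ⟨fun a ha => (h'.nat a ha).trans (h.nat a ha), fun a ha => (h'.real a ha).trans (h.real a ha)⟩

/-- The condition is syntactic, so for a concrete program `simp` decides which arrays survive. -/
lemma Exec.frame {c : Prog} {s s' : Mem} {n : ℕ} (h : Exec c s s' n) : Frame c s s' := by
  induction h with
  | skip s => exact Frame.refl _ _
  | setNat a i e s =>
    refine ⟨fun b hb => ?_, fun _ _ => rfl⟩
    simp only [Prog.KeepsNat] at hb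
    simp [Mem.setNat, Function.update_of_ne hb]
  | setReal a i e s =>
    refine ⟨fun _ _ => rfl, fun b hb => ?_⟩
    simp only [Prog.KeepsReal] at hb
    simp [Mem.setReal, Function.update_of_ne hb]
  | seq _ _ h1 h2 =>
    exact ⟨fun a ha => (h2.nat a ha.2).trans (h1.nat a ha.1),
      fun a ha => (h2.real a ha.2).trans (h1.real a ha.1)⟩
  | ite_true _ _ h => exact ⟨fun a ha => h.nat a ha.1, fun a ha => h.real a ha.1⟩
  | ite_false _ _ h => exact ⟨fun a ha => h.nat a ha.2, fun a ha => h.real a ha.2⟩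
  | loop_done _ => exact Frame.refl _ _
  | loop_step _ _ _ h1 h2 =>
    exact ⟨fun a ha => (h2.nat a ha).trans (h1.nat a ha),
      fun a ha => (h2.real a ha).trans (h1.real a ha)⟩

variable {c d : Prog} {s : Mem} {n k : ℕ} {Q R : Mem → Prop}

lemma Ends.mono (h : Ends c s n Q) (hn : n ≤ k) (hQ : ∀ s', Q s' → R s') : Ends c s k R := by
  obtain ⟨s', j, h1, h2, h3⟩ := h
  exact ⟨s', j, h1, h2.trans hn, hQ _ h3⟩

lemma Ends.frame (h : Ends c s n Q) : Ends c s n fun s' => Q s' ∧ Frame c s s' := by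
  obtain ⟨s', j, h1, h2, h3⟩ := h
  exact ⟨s', j, h1, h2, h3, h1.frame⟩

lemma Ends.skip (h : Q s) : Ends .skip s 1 Q := ⟨_, _, .skip s, le_rfl, h⟩

lemma Ends.setNat {a : ℕ} {i e : NExp} (h : Q (s.setNat a (i.eval s) (e.eval s))) :
    Ends (.setNat a i e) s 1 Q := ⟨_, _, .setNat a i e s, le_rfl, h⟩

lemma Ends.setReal {a : ℕ} {i : NExp} {e : RExp} (h : Q (s.setReal a (i.eval s) (e.eval s))) :
    Ends (.setReal a i e) s 1 Q := ⟨_, _, .setReal a i e s, le_rfl, h⟩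

lemma Ends.seq (h : Ends c s n fun s' => Ends d s' k Q) : Ends (.seq c d) s (n + k) Q := by
  obtain ⟨s₁, j, h1, h2, s₂, j', h3, h4, h5⟩ := h
  exact ⟨s₂, j + j', .seq h1 h3, by omega, h5⟩

lemma Ends.ite {b : Test} (h : b.holds s → Ends c s n Q) (h' : ¬ b.holds s → Ends d s n Q) :
    Ends (.ite b c d) s (n + 1) Q := by
  by_cases hb : b.holds s
  · obtain ⟨s', j, h1, h2, h3⟩ := h hb
    exact ⟨s', j + 1, .ite_true hb h1, by omega, h3⟩
  · obtain ⟨s', j, h1, h2, h3⟩ := h' hb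
    exact ⟨s', j + 1, .ite_false hb h1, by omega, h3⟩

/-- A loop with invariant `I` and potential `V`, which pays for the steps. -/
lemma Ends.loop {b : Test} (I : Mem → Prop) (V : Mem → ℕ) (h0 : I s)
    (h : ∀ s', I s' → Frame c s s' → b.holds s' →
      ∃ k, Ends c s' k fun s'' => I s'' ∧ V s'' + k + 1 ≤ V s') :
    Ends (.loop b c) s (V s + 1) fun s' => I s' ∧ Frame c s s' ∧ ¬ b.holds s' := by
  have key : ∀ v s', V s' ≤ v → I s' → Frame c s s' →
      Ends (.loop b c) s' (V s' + 1) fun s' => I s' ∧ Frame c s s' ∧ ¬ b.holds s' := by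
    intro v
    induction v with
    | zero =>
      intro s' hv hI hF
      by_cases hb : b.holds s'
      · obtain ⟨k, s'', j, -, -, -, h3⟩ := h s' hI hF hb
        omega
      · exact ⟨s', 1, .loop_done hb, by omega, hI, hF, hb⟩
    | succ v ih =>
      intro s' hv hI hF
      by_cases hb : b.holds s'
      · obtain ⟨k, s'', j, h1, h2, hI', h3⟩ := h s' hI hF hb
        obtain ⟨s₂, j', e1, e2, e3⟩ := ih s'' (by omega) hI' (hF.trans h1.frame)
        exact ⟨s₂, j + j' + 1, .loop_step hb h1 e1, by omega, e3⟩
      · exact ⟨s', 1, .loop_done hb, by omega, hI, hF, hb⟩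
  exact key _ s le_rfl h0 (Frame.refl _ _)

/-! ### Abbreviations for programs with scalar variables -/

/-- The scalar integer variable `a`. -/
abbrev NExp.var (a : ℕ) : NExp := .get a (.lit 0)

/-- Assignment to the scalar integer variable `a`. -/
abbrev Prog.assign (a : ℕ) (e : NExp) : Prog := .setNat a (.lit 0) e

/-- Increment of the scalar integer variable `a`. -/
abbrev Prog.incr (a : ℕ) : Prog := .assign a (.add (.var a) (.lit 1))

/-- The minimum of two integer expressions. -/
abbrev NExp.min (e f : NExp) : NExp := .sub e (.sub e f)

@[simp] lemma Mem.setNat_nat (s : Mem) (a i x b : ℕ) : (s.setNat a i x).nat b =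
    if b = a then Function.update (s.nat a) i x else s.nat b := by
  simp only [Mem.setNat, Function.update_apply]

@[simp] lemma Mem.setNat_real (s : Mem) (a i x : ℕ) : (s.setNat a i x).real = s.real := rfl

@[simp] lemma Mem.setReal_nat (s : Mem) (a i : ℕ) (x : ℝ) : (s.setReal a i x).nat = s.nat := rfl

@[simp] lemma Mem.setReal_real (s : Mem) (a i : ℕ) (x : ℝ) (b : ℕ) : (s.setReal a i x).real b =
    if b = a then Function.update (s.real a) i x else s.real b := by
  simp only [Mem.setReal, Function.update_apply]

/-! ### Merging sorted blocks -/

/-- Each block `[q w, q w + w)` of the first `n` entries is sorted. -/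
def BlockSorted (f : ℕ → ℝ) (n w : ℕ) : Prop :=
  ∀ q x y, q * w ≤ x → x ≤ y → y < q * w + w → y < n → f x ≤ f y

/-- The state of the merge of the runs `[b, c)` and `[c, e)` of `f` into the entries of `d` from
`b` on: the entries before `i`, respectively `j`, have been moved to the entries before `k`. -/
structure MergeInv (f d : ℕ → ℝ) (b c e i j k : ℕ) : Prop where
  bi : b ≤ i
  ic : i ≤ c
  cj : c ≤ j
  je : j ≤ e
  pos : k + c = i + j
  sorted : ∀ x y, b ≤ x → x ≤ y → y < k → d x ≤ d y
  left : ∀ x y, b ≤ x → x < k → i ≤ y → y < c → d x ≤ f y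
  right : ∀ x y, b ≤ x → x < k → j ≤ y → y < e → d x ≤ f y
  -- Sums of an arbitrary `g` encode the equality of multisets.
  sum : ∀ g : ℝ → ℕ, ∑ x ∈ Finset.Ico b k, g (d x) =
    ∑ x ∈ Finset.Ico b i, g (f x) + ∑ x ∈ Finset.Ico c j, g (f x)

lemma sum_Ico_update {d : ℕ → ℝ} {b k : ℕ} (hk : b ≤ k) (v : ℝ) (g : ℝ → ℕ) :
    ∑ x ∈ Finset.Ico b (k + 1), g (Function.update d k v x) =
      ∑ x ∈ Finset.Ico b k, g (d x) + g v := by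
  rw [Finset.sum_Ico_succ_top hk, Function.update_self]
  congr 1
  refine Finset.sum_congr rfl fun x hx => ?_
  rw [Function.update_of_ne (Finset.mem_Ico.1 hx).2.ne]

lemma MergeInv.takeLeft {f d : ℕ → ℝ} {b c e i j k : ℕ} (h : MergeInv f d b c e i j k)
    (hf : ∀ x y, b ≤ x → x ≤ y → y < c → f x ≤ f y)
    (hf' : ∀ x y, c ≤ x → x ≤ y → y < e → f x ≤ f y) (hi : i < c) (hle : j < e → f i ≤ f j) :
    MergeInv f (Function.update d k (f i)) b c e (i + 1) j (k + 1) := by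
  obtain ⟨h1, h2, h3, h4, h5, h6, h7, h8, h9⟩ := h
  refine ⟨by omega, hi, h3, h4, by omega, fun x y hx hxy hy => ?_, fun x y hx hxk hy hyc => ?_,
    fun x y hx hxk hy hyc => ?_, fun g => ?_⟩
  · simp only [Function.update_apply]
    split_ifs with e1 e2 e2
    · rfl
    · omega
    · exact h7 x i hx (by omega) le_rfl hi
    · exact h6 x y hx hxy (by omega)
  · simp only [Function.update_apply]
    split_ifs with e1
    · exact hf i y h1 (by omega) hyc
    · exact h7 x y hx (by omega) (by omega) hyc
  · simp only [Function.update_apply]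
    split_ifs with e1
    · exact (hle (by omega)).trans (hf' j y h3 hy hyc)
    · exact h8 x y hx (by omega) (by omega) hyc
  · rw [sum_Ico_update (by omega), h9, Finset.sum_Ico_succ_top h1]
    ring

lemma MergeInv.takeRight {f d : ℕ → ℝ} {b c e i j k : ℕ} (h : MergeInv f d b c e i j k)
    (hf : ∀ x y, b ≤ x → x ≤ y → y < c → f x ≤ f y)
    (hf' : ∀ x y, c ≤ x → x ≤ y → y < e → f x ≤ f y) (hj : j < e) (hle : i < c → f j ≤ f i) :
    MergeInv f (Function.update d k (f j)) b c e i (j + 1) (k + 1) := by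
  obtain ⟨h1, h2, h3, h4, h5, h6, h7, h8, h9⟩ := h
  refine ⟨h1, h2, by omega, hj, by omega, fun x y hx hxy hy => ?_, fun x y hx hxk hy hyc => ?_,
    fun x y hx hxk hy hyc => ?_, fun g => ?_⟩
  · simp only [Function.update_apply]
    split_ifs with e1 e2 e2
    · rfl
    · omega
    · exact h8 x j hx (by omega) le_rfl hj
    · exact h6 x y hx hxy (by omega)
  · simp only [Function.update_apply]
    split_ifs with e1
    · exact (hle (by omega)).trans (hf i y h1 hy hyc)
    · exact h7 x y hx (by omega) (by omega) hyc
  · simp only [Function.update_apply]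
    split_ifs with e1
    · exact hf' j y h3 (by omega) hyc
    · exact h8 x y hx (by omega) (by omega) hyc
  · rw [sum_Ico_update (by omega), h9, Finset.sum_Ico_succ_top h3]
    ring

/-- Merge the runs `[i, c)` and `[j, e)` of the real array `src` into `dst`, where `i`, `j`, `k`,
`c` and `e` are the variables `13`, `14`, `17`, `15` and `16`. -/
def mergeRuns (src dst : ℕ) : Prog :=
  .loop (.natLt (.var 17) (.var 16))
    (.seq
      (.ite (.conj (.natLt (.var 13) (.var 15))
          (.neg (.conj (.natLt (.var 14) (.var 16))
            (.realLt (.get src (.var 14)) (.get src (.var 13))))))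
        (.seq (.setReal dst (.var 17) (.get src (.var 13))) (.incr 13))
        (.seq (.setReal dst (.var 17) (.get src (.var 14))) (.incr 14)))
      (.incr 17))

/-- Every iteration takes five steps, two of them tests, and writes one entry. -/
lemma ends_mergeRuns {src dst : ℕ} (hne : src ≠ dst) {s : Mem} {b c e i j k : ℕ}
    (h13 : s.nat 13 0 = i) (h14 : s.nat 14 0 = j) (h15 : s.nat 15 0 = c) (h16 : s.nat 16 0 = e)
    (h17 : s.nat 17 0 = k)
    (hf : ∀ x y, b ≤ x → x ≤ y → y < c → s.real src x ≤ s.real src y)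
    (hf' : ∀ x y, c ≤ x → x ≤ y → y < e → s.real src x ≤ s.real src y)
    (h : MergeInv (s.real src) (s.real dst) b c e i j k) :
    Ends (mergeRuns src dst) s (5 * (e - k) + 1) fun s' =>
      MergeInv (s.real src) (s'.real dst) b c e c e e ∧
      ∀ x, x < k → s'.real dst x = s.real dst x := by
  have hloop := Ends.loop (s := s) (b := .natLt (.var 17) (.var 16))
    (c := .seq
      (.ite (.conj (.natLt (.var 13) (.var 15))
          (.neg (.conj (.natLt (.var 14) (.var 16))
            (.realLt (.get src (.var 14)) (.get src (.var 13))))))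
        (.seq (.setReal dst (.var 17) (.get src (.var 13))) (.incr 13))
        (.seq (.setReal dst (.var 17) (.get src (.var 14))) (.incr 14)))
      (.incr 17))
    (fun s' => MergeInv (s.real src) (s'.real dst) b c e (s'.nat 13 0) (s'.nat 14 0) (s'.nat 17 0) ∧
      k ≤ s'.nat 17 0 ∧ ∀ x, x < k → s'.real dst x = s.real dst x)
    (fun s' => 5 * (e - s'.nat 17 0)) (by rw [h13, h14, h17]; exact ⟨h, le_rfl, fun _ _ => rfl⟩)
    (by
      rintro s' ⟨hI, hk, hx⟩ hF hb
      have e15 : s'.nat 15 = s.nat 15 := hF.nat 15 (by simp [Prog.KeepsNat])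
      have e16 : s'.nat 16 = s.nat 16 := hF.nat 16 (by simp [Prog.KeepsNat])
      have esrc : s'.real src = s.real src := hF.real src (by simp [Prog.KeepsReal, hne])
      simp only [Test.holds, NExp.eval, e16, h16] at hb
      refine ⟨4, Ends.seq (n := 3) (k := 1) (Ends.ite (n := 2) (fun ht => ?_) fun ht => ?_)⟩
      · simp only [Test.holds, NExp.eval, RExp.eval, e15, h15, e16, h16, esrc, not_and, not_lt] at ht
        refine Ends.seq (n := 1) (k := 1) (Ends.setReal (Ends.setNat (Ends.setNat ?_)))
        have := hI.takeLeft hf hf' ht.1 ht.2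
        simp only [Mem.setNat_nat, Mem.setNat_real, Mem.setReal_nat, Mem.setReal_real, NExp.eval,
          RExp.eval, Nat.reduceEqDiff, if_false, if_true, Function.update_self, esrc]
        refine ⟨⟨this, by omega, fun x hx' => ?_⟩, by omega⟩
        rw [Function.update_of_ne (by omega)]
        exact hx x hx'
      · simp only [Test.holds, NExp.eval, RExp.eval, e15, h15, e16, h16, esrc] at ht
        refine Ends.seq (n := 1) (k := 1) (Ends.setReal (Ends.setNat (Ends.setNat ?_)))
        have hpos := hI.pos
        have hic := hI.ic
        have := hI.takeRight hf hf' (by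
          by_contra hje
          apply ht
          exact ⟨by omega, fun h => hje h.1⟩) (fun hi => by
          by_contra hlt
          push Not at hlt
          exact ht ⟨hi, fun h => absurd h.2 (not_lt.2 hlt.le)⟩)
        simp only [Mem.setNat_nat, Mem.setNat_real, Mem.setReal_nat, Mem.setReal_real, NExp.eval,
          RExp.eval, Nat.reduceEqDiff, if_false, if_true, Function.update_self, esrc]
        refine ⟨⟨this, by omega, fun x hx' => ?_⟩, by omega⟩
        rw [Function.update_of_ne (by omega)]
        exact hx x hx')
  refine Ends.mono hloop (by simp only [h17]; exact le_rfl) ?_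
  rintro s' ⟨⟨hI, hk, hx⟩, hF, hb⟩
  have e16 : s'.nat 16 = s.nat 16 := hF.nat 16 (by simp [Prog.KeepsNat])
  simp only [Test.holds, NExp.eval, e16, h16, not_lt] at hb
  have h1 := hI.ic
  have h2 := hI.je
  have h3 := hI.pos
  have i13 : s'.nat 13 0 = c := by omega
  have i14 : s'.nat 14 0 = e := by omega
  have i17 : s'.nat 17 0 = e := by omega
  rw [i13, i14, i17] at hI
  exact ⟨hI, hx⟩

end RealRAM

/-! ### Merge passes and in-place decimation. -/

namespace RealRAM

/-- Merge adjacent sorted blocks of `src` into `dst`; the variables `10` and `11` hold the number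
of entries and the block size. -/
def mergePass (src dst : ℕ) : Prog :=
  .seq (.assign 12 (.lit 0)) (.loop (.natLt (.var 12) (.var 10))
    (.seq (.assign 13 (.var 12))
    (.seq (.assign 15 (.min (.add (.var 12) (.var 11)) (.var 10)))
    (.seq (.assign 14 (.var 15))
    (.seq (.assign 16 (.min (.add (.var 12) (.add (.var 11) (.var 11))) (.var 10)))
    (.seq (.assign 17 (.var 12))
    (.seq (mergeRuns src dst)
      (.assign 12 (.add (.var 12) (.add (.var 11) (.var 11)))))))))))

/-- A pair of blocks with `e - b ≥ 1` entries costs `5 (e - b) + 8 ≤ 13 (e - b)` steps. Truncation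
at `n` covers incomplete and missing blocks at the end. -/
lemma ends_mergePass {src dst : ℕ} (hne : src ≠ dst) {s : Mem} {n w : ℕ} (hw : 0 < w)
    (h10 : s.nat 10 0 = n) (h11 : s.nat 11 0 = w) (hs : BlockSorted (s.real src) n w) :
    Ends (mergePass src dst) s (13 * n + 2) fun s' =>
      BlockSorted (s'.real dst) n (w + w) ∧
      ∀ g : ℝ → ℕ, ∑ x ∈ Finset.Ico 0 n, g (s'.real dst x) =
        ∑ x ∈ Finset.Ico 0 n, g (s.real src x) := by
  rw [mergePass, show 13 * n + 2 = 1 + (13 * n + 1) by ring]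
  refine Ends.seq (Ends.setNat ?_)
  set s₀ := s.setNat 12 ((NExp.lit 0).eval s) ((NExp.lit 0).eval s) with hs₀
  have k10 : s₀.nat 10 0 = n := by simpa [hs₀] using h10
  have k11 : s₀.nat 11 0 = w := by simpa [hs₀] using h11
  have k12 : s₀.nat 12 0 = 0 := by simp [hs₀, NExp.eval]
  have ksrc : s₀.real src = s.real src := rfl
  refine Ends.mono (Ends.loop
    (fun s' => ∃ q, s'.nat 12 0 = q * (w + w) ∧
      (∀ q' x y, q' < q → q' * (w + w) ≤ x → x ≤ y → y < q' * (w + w) + (w + w) → y < n →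
        s'.real dst x ≤ s'.real dst y) ∧
      ∀ g : ℝ → ℕ, ∑ x ∈ Finset.Ico 0 (min (s'.nat 12 0) n), g (s'.real dst x) =
        ∑ x ∈ Finset.Ico 0 (min (s'.nat 12 0) n), g (s.real src x))
    (fun s' => 13 * (n - s'.nat 12 0)) ⟨0, by simp [k12], by simp, by simp [k12]⟩ ?_)
    (by simp [k12]) ?_
  · rintro s' ⟨q, hb, hsort, hsum⟩ hF ht
    have e10 : s'.nat 10 0 = n := by
      rw [hF.nat 10 (by simp [Prog.KeepsNat, mergeRuns]), k10]
    have e11 : s'.nat 11 0 = w := by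
      rw [hF.nat 11 (by simp [Prog.KeepsNat, mergeRuns]), k11]
    have esrc : s'.real src = s.real src := by
      rw [hF.real src (by simp [Prog.KeepsReal, mergeRuns, hne]), ksrc]
    simp only [Test.holds, NExp.eval, e10] at ht
    set b := s'.nat 12 0 with hbdef
    set c := b + w - (b + w - n) with hc
    set e := b + (w + w) - (b + (w + w) - n) with he
    refine ⟨1 + (1 + (1 + (1 + (1 + (5 * (e - b) + 1 + 1))))), ?_⟩
    refine Ends.seq (Ends.setNat (Ends.seq (Ends.setNat (Ends.seq (Ends.setNat (Ends.seq
      (Ends.setNat (Ends.seq (Ends.setNat (Ends.seq ?_))))))))))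
    set s₁ := ((((s'.setNat 13 _ _).setNat 15 _ _).setNat 14 _ _).setNat 16 _ _).setNat 17 _ _
      with hs₁
    have r1 : s₁.real = s'.real := rfl
    have f10 : s₁.nat 10 0 = n := by simpa [hs₁] using e10
    have f11 : s₁.nat 11 0 = w := by simpa [hs₁] using e11
    have f12 : s₁.nat 12 0 = b := by simp [hs₁, hbdef]
    have f13 : s₁.nat 13 0 = b := by simp [hs₁, hbdef, NExp.eval]
    have f15 : s₁.nat 15 0 = c := by simp [hs₁, hc, hbdef, NExp.eval, e10, e11]
    have f14 : s₁.nat 14 0 = c := by simp [hs₁, hc, hbdef, NExp.eval, e10, e11]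
    have f16 : s₁.nat 16 0 = e := by simp [hs₁, he, hbdef, NExp.eval, e10, e11]
    have f17 : s₁.nat 17 0 = b := by simp [hs₁, hbdef, NExp.eval]
    -- The two runs are the blocks `2 q` and `2 q + 1` of size `w`.
    have hsL : ∀ x y, b ≤ x → x ≤ y → y < c → s₁.real src x ≤ s₁.real src y := by
      intro x y hx hxy hy
      rw [r1, esrc]
      refine hs (2 * q) x y ?_ hxy ?_ (by omega)
      · rw [mul_assoc, mul_left_comm, two_mul, ← hb]; exact hx
      · rw [mul_assoc, mul_left_comm, two_mul, ← hb]; omega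
    have hsR : ∀ x y, c ≤ x → x ≤ y → y < e → s₁.real src x ≤ s₁.real src y := by
      intro x y hx hxy hy
      rw [r1, esrc]
      have hq : (2 * q + 1) * w = b + w := by rw [hb]; ring
      refine hs (2 * q + 1) x y ?_ hxy ?_ (by omega)
      · rw [hq]; omega
      · rw [hq]; omega
    have hinit : MergeInv (s₁.real src) (s₁.real dst) b c e b c b :=
      ⟨le_rfl, by omega, le_rfl, by omega, by omega, by omega, by omega, by omega, by simp⟩
    refine Ends.mono (Ends.frame (ends_mergeRuns hne f13 f14 f15 f16 f17 hsL hsR hinit)) le_rfl ?_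
    rintro s₂ ⟨⟨hM, hx⟩, hF₂⟩
    refine Ends.setNat ?_
    have g11 : s₂.nat 11 0 = w := by
      rw [hF₂.nat 11 (by simp [Prog.KeepsNat, mergeRuns]), f11]
    have g12 : s₂.nat 12 0 = b := by
      rw [hF₂.nat 12 (by simp [Prog.KeepsNat, mergeRuns]), f12]
    simp only [Mem.setNat_nat, Mem.setNat_real, NExp.eval, if_true, Function.update_self, g11, g12]
    refine ⟨⟨q + 1, by rw [hb]; ring, fun q' x y hq' h1 h2 h3 h4 => ?_, fun g => ?_⟩, by omega⟩
    · rcases Nat.lt_succ_iff_lt_or_eq.1 hq' with hlt | rfl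
      · have : q' * (w + w) + (w + w) ≤ b := by
          rw [hb]
          calc q' * (w + w) + (w + w) = (q' + 1) * (w + w) := by ring
            _ ≤ q * (w + w) := Nat.mul_le_mul_right _ hlt
        rw [hx x (by omega), hx y (by omega)]
        exact hsort q' x y hlt h1 h2 h3 h4
      · rw [← hb] at h1 h3
        exact hM.sorted x y h1 h2 (by omega)
    · have e1 : min (b + (w + w)) n = e := by omega
      have e2 : min b n = b := by omega
      have hsum' := hsum g
      rw [e2] at hsum'
      rw [e1, ← Finset.sum_Ico_consecutive _ (Nat.zero_le b) (by omega : b ≤ e),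
        ← Finset.sum_Ico_consecutive _ (Nat.zero_le b) (by omega : b ≤ e), hM.sum g,
        Finset.sum_Ico_consecutive _ (by omega) (by omega), r1, esrc]
      congr 1
      rw [← hsum']
      refine Finset.sum_congr rfl fun x hxx => ?_
      rw [hx x (Finset.mem_Ico.1 hxx).2, r1]
  · rintro s' ⟨⟨q, hb, hsort, hsum⟩, hF, ht⟩
    have e10 : s'.nat 10 0 = n := by
      rw [hF.nat 10 (by simp [Prog.KeepsNat, mergeRuns]), k10]
    simp only [Test.holds, NExp.eval, e10, not_lt] at ht
    rw [min_eq_right ht] at hsum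
    refine ⟨fun q' x y h1 h2 h3 h4 => hsort q' x y ?_ h1 h2 h3 h4, hsum⟩
    by_contra hq
    push Not at hq
    have := Nat.mul_le_mul_right (w + w) hq
    omega

/-- Keep every other one of the first `n` entries of the real array `5`, where the variable `10`
holds `n`. -/
def decimate : Prog :=
  .seq (.assign 13 (.lit 0))
  (.seq (.loop (.natLt (.add (.var 13) (.add (.var 13) (.lit 1))) (.var 10))
    (.seq (.setReal 5 (.var 13) (.get 5 (.add (.var 13) (.add (.var 13) (.lit 1))))) (.incr 13)))
  (.assign 10 (.half (.var 10))))

/-- Working in place is safe: entry `x` is read from position `2 x + 1 > x`, which has not been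
overwritten yet. -/
lemma ends_decimate {s : Mem} {n : ℕ} (h10 : s.nat 10 0 = n) :
    Ends decimate s (3 * n + 3) fun s' => s'.nat 10 0 = n / 2 ∧
      ∀ x, x < n / 2 → s'.real 5 x = s.real 5 (2 * x + 1) := by
  refine Ends.mono (k := 3 * n + 3) (n := 1 + (3 * n + 1 + 1))
    (Ends.seq (Ends.setNat (Ends.seq (k := 1) (n := 3 * n + 1) ?_))) (by omega) (fun _ h => h)
  set s₀ := s.setNat 13 ((NExp.lit 0).eval s) ((NExp.lit 0).eval s) with hs₀
  have k10 : s₀.nat 10 0 = n := by simpa [hs₀] using h10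
  have k13 : s₀.nat 13 0 = 0 := by simp [hs₀, NExp.eval]
  have k5 : s₀.real 5 = s.real 5 := rfl
  refine Ends.mono (Ends.loop
    (fun s' => (∀ x, x < s'.nat 13 0 → s'.real 5 x = s.real 5 (2 * x + 1)) ∧
      (∀ x, s'.nat 13 0 ≤ x → s'.real 5 x = s.real 5 x) ∧ s'.nat 13 0 ≤ n / 2)
    (fun s' => 3 * (n - s'.nat 13 0)) ⟨by simp [k13], by simp [k5], by simp [k13]⟩ ?_)
    (by simp [k13]) ?_
  · rintro s' ⟨h1, h2, h3⟩ hF ht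
    have e10 : s'.nat 10 0 = n := by
      rw [hF.nat 10 (by simp [Prog.KeepsNat]), k10]
    simp only [Test.holds, NExp.eval, e10] at ht
    refine ⟨1 + 1, Ends.seq (Ends.setReal (Ends.setNat ?_))⟩
    simp only [Mem.setNat_nat, Mem.setNat_real, Mem.setReal_nat, Mem.setReal_real, NExp.eval,
      RExp.eval, if_true, Function.update_self, Function.update_apply]
    refine ⟨⟨fun x hx => ?_, fun x hx => ?_, by omega⟩, by omega⟩
    · split_ifs with h
      · rw [h, h2 _ (by omega)]; congr 1; ring
      · exact h1 x (by omega)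
    · rw [if_neg (by omega)]
      exact h2 x (by omega)
  · rintro s' ⟨⟨h1, h2, h3⟩, hF, ht⟩
    have e10 : s'.nat 10 0 = n := by
      rw [hF.nat 10 (by simp [Prog.KeepsNat]), k10]
    simp only [Test.holds, NExp.eval, e10] at ht
    refine Ends.setNat ?_
    simp only [Mem.setNat_nat, Mem.setNat_real, NExp.eval, if_true, Function.update_self, e10]
    exact ⟨trivial, fun x hx => h1 x (by omega)⟩

end RealRAM

/-! ### Counting in intervals, and the error of decimating sorted blocks. -/

namespace RealRAM

open Classical in
/-- The number of indices in `[a, b)` at which `f` has its value in `G`. -/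
noncomputable def occ (f : ℕ → ℝ) (a b : ℕ) (G : Set ℝ) : ℕ :=
  ((Finset.Ico a b).filter fun x => f x ∈ G).card

open Classical in
lemma occ_eq_sum (f : ℕ → ℝ) (a b : ℕ) (G : Set ℝ) :
    occ f a b G = ∑ x ∈ Finset.Ico a b, (fun v => if v ∈ G then 1 else 0) (f x) := by
  rw [occ, Finset.card_filter]

lemma occ_add (f : ℕ → ℝ) {a b c : ℕ} (hab : a ≤ b) (hbc : b ≤ c) (G : Set ℝ) :
    occ f a c G = occ f a b G + occ f b c G := by
  rw [occ_eq_sum, occ_eq_sum, occ_eq_sum, Finset.sum_Ico_consecutive _ hab hbc]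

lemma occ_congr {f f' : ℕ → ℝ} {a b : ℕ} (h : ∀ x, a ≤ x → x < b → f x = f' x) (G : Set ℝ) :
    occ f a b G = occ f' a b G := by
  classical
  rw [occ_eq_sum, occ_eq_sum]
  refine Finset.sum_congr rfl fun x hx => ?_
  rw [h x (Finset.mem_Ico.1 hx).1 (Finset.mem_Ico.1 hx).2]

/-- In a sorted run the entries with value in an interval occupy consecutive positions, and among
consecutive positions the even ones exceed the odd ones by at most one. -/
lemma occ_run_le {f : ℕ → ℝ} {a b : ℕ} (hf : ∀ x y, a ≤ x → x ≤ y → y < b → f x ≤ f y)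
    {G : Set ℝ} (hG : G.OrdConnected) :
    occ f a b G ≤ 2 * occ (fun x => f (2 * x + 1)) (a / 2) (b / 2) G + 1 := by
  classical
  set U := (Finset.Ico a b).filter fun x => f x ∈ G with hU
  have hmem : ∀ x, x ∈ U ↔ (a ≤ x ∧ x < b) ∧ f x ∈ G := fun x => by
    rw [hU, Finset.mem_filter, Finset.mem_Ico]
  rcases U.eq_empty_or_nonempty with h | hne
  · rw [occ, ← hU, h]; simp
  obtain ⟨l, hl, hlmin⟩ := U.exists_min_image id hne
  obtain ⟨r, hr, hrmax⟩ := U.exists_max_image id hne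
  have hl' := (hmem l).1 hl
  have hr' := (hmem r).1 hr
  have hlr : l ≤ r := hlmin r hr
  have h1 : occ f a b G ≤ r + 1 - l := by
    rw [occ, ← hU, ← Nat.card_Icc]
    exact Finset.card_le_card fun x hx => Finset.mem_Icc.2 ⟨hlmin x hx, hrmax x hx⟩
  have h2 : (r + 1) / 2 - l / 2 ≤ occ (fun x => f (2 * x + 1)) (a / 2) (b / 2) G := by
    rw [occ, ← Nat.card_Ico]
    refine Finset.card_le_card fun x hx => ?_
    rw [Finset.mem_Ico] at hx
    rw [Finset.mem_filter, Finset.mem_Ico]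
    refine ⟨by omega, hG.out hl'.2 hr'.2 ⟨hf _ _ ?_ ?_ ?_, hf _ _ ?_ ?_ ?_⟩⟩ <;> omega
  omega

/-- One lost entry per block, by induction on the number of blocks. -/
lemma occ_decimate_le {f : ℕ → ℝ} {n w : ℕ} (hf : BlockSorted f n (w + w)) {G : Set ℝ}
    (hG : G.OrdConnected) (B : ℕ) :
    occ f 0 (min (B * (w + w)) n) G ≤
      2 * occ (fun x => f (2 * x + 1)) 0 (min (B * (w + w)) n / 2) G + B := by
  induction B with
  | zero => simp [occ]
  | succ B ih =>
    rcases le_total n (B * (w + w)) with h | h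
    · have h' : n ≤ (B + 1) * (w + w) := h.trans (Nat.mul_le_mul_right _ B.le_succ)
      rw [min_eq_right h] at ih
      rw [min_eq_right h']
      omega
    · rw [min_eq_left h] at ih
      set e := min ((B + 1) * (w + w)) n with he
      have hBe : B * (w + w) ≤ e := le_min (Nat.mul_le_mul_right _ B.le_succ) h
      have hrun := occ_run_le (f := f) (a := B * (w + w)) (b := e) (fun x y hx hxy hy => by
        have : (B + 1) * (w + w) = B * (w + w) + (w + w) := by ring
        exact hf B x y hx hxy (by omega) (by omega)) hG
      rw [occ_add f (Nat.zero_le _) hBe, occ_add _ (Nat.zero_le _) (Nat.div_le_div_right hBe)]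
      omega

lemma BlockSorted.decimate {f d : ℕ → ℝ} {n w : ℕ} (hf : BlockSorted f n (w + w))
    (hd : ∀ x, x < n / 2 → d x = f (2 * x + 1)) : BlockSorted d (n / 2) w := by
  intro q x y h1 h2 h3 h4
  rw [hd x (by omega), hd y h4]
  have : q * (w + w) = q * w + q * w := by ring
  exact hf q _ _ (by omega) (by omega) (by omega) (by omega)

/-- `z`, `n` is a summary of the `m` points `f`: up to an error `E`, an interval holds at most
`w` times as many points as there are among the `n` entries of `z`. -/
structure IsSummary (f : ℕ → ℝ) (m : ℕ) (z : ℕ → ℝ) (n w E : ℕ) : Prop where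
  weight : w * n ≤ m
  card : n ≤ m
  count : ∀ G : Set ℝ, G.OrdConnected → occ f 0 m G ≤ w * occ z 0 n G + E

lemma IsSummary.decimate {f z d : ℕ → ℝ} {m n w E v : ℕ} (h : IsSummary f m z n w E) (hv : 0 < v)
    (hz : BlockSorted z n (v + v)) (hd : ∀ x, x < n / 2 → d x = z (2 * x + 1)) :
    IsSummary f m d (n / 2) (2 * w) (E + w * (n / (v + v) + 1)) := by
  refine ⟨?_, ?_, fun G hG => ?_⟩
  · refine le_trans ?_ h.weight
    rw [mul_comm 2 w, mul_assoc]
    exact Nat.mul_le_mul_left _ (Nat.mul_div_le n 2)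
  · exact (Nat.div_le_self _ _).trans h.card
  · have h1 := occ_decimate_le hz hG (n / (v + v) + 1)
    have h2 : n ≤ (n / (v + v) + 1) * (v + v) := by
      rw [add_mul, one_mul]
      exact (Nat.lt_div_mul_add (by omega)).le
    rw [min_eq_right h2, ← occ_congr (f := d) (fun x _ hx => hd x hx)] at h1
    calc occ f 0 m G ≤ w * occ z 0 n G + E := h.count G hG
      _ ≤ w * (2 * occ d 0 (n / 2) G + (n / (v + v) + 1)) + E := by gcongr
      _ = 2 * w * occ d 0 (n / 2) G + (E + w * (n / (v + v) + 1)) := by ring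

/-- One round: merge twice, and halve the summary if the blocks are large. -/
def coarsenRound : Prog :=
  .seq (mergePass 5 6)
  (.seq (.assign 11 (.add (.var 11) (.var 11)))
  (.seq (mergePass 6 5)
  (.seq (.assign 11 (.add (.var 11) (.var 11)))
  (.ite (.neg (.realLt (.mul (.ofNat (.var 11)) (.get 1 (.lit 0))) (.ofNat (.lit 32))))
    (.seq decimate (.assign 11 (.half (.var 11))))
    .skip))))

/-- Two passes bring the list back to array `5` with blocks four times as long. After a decimation
the blocks are still twice as long as before, so the loop makes progress in both cases. -/
lemma ends_coarsenRound {f : ℕ → ℝ} {m w E n v : ℕ} {η : ℝ} {s : Mem} (hv : 0 < v)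
    (h10 : s.nat 10 0 = n) (h11 : s.nat 11 0 = v) (hη : s.real 1 0 = η)
    (hs : BlockSorted (s.real 5) n v) (hsum : IsSummary f m (s.real 5) n w E) :
    Ends coarsenRound s (29 * n + 11) fun s' =>
      ((4 * v * η < 32) ∧ s'.nat 10 0 = n ∧ s'.nat 11 0 = 4 * v ∧
        BlockSorted (s'.real 5) n (4 * v) ∧ IsSummary f m (s'.real 5) n w E) ∨
      ((32 ≤ 4 * v * η) ∧ s'.nat 10 0 = n / 2 ∧ s'.nat 11 0 = 2 * v ∧
        BlockSorted (s'.real 5) (n / 2) (2 * v) ∧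
        IsSummary f m (s'.real 5) (n / 2) (2 * w) (E + w * (n / (4 * v) + 1))) := by
  rw [coarsenRound]
  refine Ends.mono (n := (13 * n + 2) + (1 + ((13 * n + 2) + (1 + ((3 * n + 3 + 1) + 1)))))
    (Ends.seq (Ends.mono (Ends.frame (ends_mergePass (by norm_num) hv h10 h11 hs)) le_rfl ?_))
    (by omega) (fun _ h => h)
  rintro s₁ ⟨⟨hs₁, hc₁⟩, hF₁⟩
  refine Ends.seq (Ends.setNat ?_)
  set s₂ := s₁.setNat 11 _ _ with hs₂
  have e10 : s₂.nat 10 0 = n := by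
    simp only [hs₂, Mem.setNat_nat, Nat.reduceEqDiff, if_false]
    rw [hF₁.nat 10 (by simp [Prog.KeepsNat, mergePass, mergeRuns]), h10]
  have e11 : s₂.nat 11 0 = v + v := by
    simp only [hs₂, Mem.setNat_nat, if_true, NExp.eval, Function.update_self]
    rw [hF₁.nat 11 (by simp [Prog.KeepsNat, mergePass, mergeRuns]), h11]
  refine Ends.seq (Ends.mono (Ends.frame (ends_mergePass (src := 6) (dst := 5) (by norm_num)
    (by omega : 0 < v + v) e10 e11 hs₁)) le_rfl ?_)
  rintro s₃ ⟨⟨hs₃, hc₃⟩, hF₃⟩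
  refine Ends.seq (Ends.setNat ?_)
  set s₄ := s₃.setNat 11 _ _ with hs₄
  have f10 : s₄.nat 10 0 = n := by
    simp only [hs₄, Mem.setNat_nat, Nat.reduceEqDiff, if_false]
    rw [hF₃.nat 10 (by simp [Prog.KeepsNat, mergePass, mergeRuns]), e10]
  have f11 : s₄.nat 11 0 = 2 * v + 2 * v := by
    simp only [hs₄, Mem.setNat_nat, if_true, NExp.eval, Function.update_self]
    rw [hF₃.nat 11 (by simp [Prog.KeepsNat, mergePass, mergeRuns]), e11]
    ring
  have fη : s₄.real 1 0 = η := by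
    simp only [hs₄, Mem.setNat_real]
    rw [hF₃.real 1 (by simp [Prog.KeepsReal, mergePass, mergeRuns]), hs₂, Mem.setNat_real,
      hF₁.real 1 (by simp [Prog.KeepsReal, mergePass, mergeRuns]), hη]
  have hsort : BlockSorted (s₄.real 5) n (2 * v + 2 * v) := by
    rw [show 2 * v + 2 * v = v + v + (v + v) by ring]; exact hs₃
  have hsum' : IsSummary f m (s₄.real 5) n w E := by
    refine ⟨hsum.weight, hsum.card, fun G hG => (hsum.count G hG).trans (le_of_eq ?_)⟩
    have : occ (s₄.real 5) 0 n G = occ (s.real 5) 0 n G := by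
      classical
      rw [occ_eq_sum, occ_eq_sum, hs₄, Mem.setNat_real]
      exact (hc₃ fun v => if v ∈ G then 1 else 0).trans
        (hc₁ fun v => if v ∈ G then 1 else 0)
    rw [this]
  have h4 : 2 * v + 2 * v = 4 * v := by ring
  have hcond : (Test.neg (.realLt (.mul (.ofNat (.var 11)) (.get 1 (.lit 0)))
      (.ofNat (.lit 32)))).holds s₄ ↔ 32 ≤ 4 * v * η := by
    simp only [Test.holds, RExp.eval, NExp.eval, f11, fη, not_lt]
    push_cast
    rw [show (2 * v + 2 * v : ℝ) = 4 * v by ring]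
  refine Ends.ite (fun ht => ?_) (fun ht => ?_)
  · rw [hcond] at ht
    refine Ends.seq (n := 3 * n + 3) (k := 1) (Ends.mono (Ends.frame (ends_decimate f10)) le_rfl ?_)
    rintro s₅ ⟨⟨g10, hx⟩, hF₅⟩
    refine Ends.setNat (Or.inr ?_)
    have g11 : s₅.nat 11 0 = 2 * v + 2 * v := by
      rw [hF₅.nat 11 (by simp [Prog.KeepsNat, decimate]), f11]
    simp only [Mem.setNat_nat, Mem.setNat_real, Nat.reduceEqDiff, if_false, if_true, NExp.eval,
      Function.update_self, g10, g11]
    refine ⟨ht, trivial, by omega, hsort.decimate hx, ?_⟩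
    rw [← h4]
    exact hsum'.decimate (by omega) hsort hx
  · rw [hcond, not_le] at ht
    refine Ends.mono (Ends.skip (Or.inl ?_)) (by omega) (fun _ h => h)
    rw [← h4]
    exact ⟨ht, f10, f11, hsort, hsum'⟩

/-- With `w n ≤ m` and `v < n`, a decimation adds at most `(5/4) m / v` to the error. As `v`
doubles, these terms form a geometric series, whose tail is reserved by `4 m / v`. At the first
decimation `v ≥ 8 / η`, so the reserve fits into `η m / 2`. -/
lemma summary_error_step {m w n v E : ℕ} {η : ℝ} (hv : 0 < v) (hvn : v < n) (hw : w * n ≤ m)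
    (hE : E = 0 ∨ (E : ℝ) + 4 * m / v ≤ η * m / 2) (hη : 32 ≤ 4 * v * η) :
    ((E + w * (n / (4 * v) + 1) : ℕ) : ℝ) + 4 * m / (2 * v : ℕ) ≤ η * m / 2 := by
  have hv' : (0 : ℝ) < v := by exact_mod_cast hv
  have hm0 : (0 : ℝ) ≤ m := Nat.cast_nonneg m
  have hw' : (w : ℝ) * n ≤ m := by exact_mod_cast hw
  have h1 : ((n / (4 * v) : ℕ) : ℝ) ≤ n / (4 * v) := by
    have := Nat.cast_div_le (α := ℝ) (m := n) (n := 4 * v)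
    push_cast at this
    exact this
  have h2 : (w : ℝ) * ((n / (4 * v) : ℕ) + 1) ≤ 5 / 4 * (m / v) := by
    have h3 : (w : ℝ) * (n / (4 * v)) ≤ 1 / 4 * (m / v) := by
      calc (w : ℝ) * (n / (4 * v)) = 1 / 4 * (w * n / v) := by field_simp
        _ ≤ 1 / 4 * (m / v) := by gcongr
    have h4 : (w : ℝ) ≤ m / v := by
      rw [le_div_iff₀ hv']
      have : (v : ℝ) ≤ n := by exact_mod_cast hvn.le
      exact (mul_le_mul_of_nonneg_left this (Nat.cast_nonneg w)).trans hw'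
    have h5 := mul_le_mul_of_nonneg_left h1 (Nat.cast_nonneg w : (0 : ℝ) ≤ w)
    linarith
  have h6 : 4 * (m : ℝ) / (2 * v : ℕ) = 2 * (m / v) := by push_cast; field_simp; ring
  have h7 : 4 * (m : ℝ) / v = 4 * (m / v) := by ring
  rw [h6]
  push_cast
  have h8 : 0 ≤ (m : ℝ) / v := by positivity
  rcases hE with hE | hE
  · have h9 : (m : ℝ) / v ≤ η * m / 8 := by
      rw [div_le_iff₀ hv']
      nlinarith
    rw [hE]
    push_cast
    linarith
  · rw [h7] at hE
    linarith

/-- Sort and coarsen until one sorted block is left. -/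
def coarsen : Prog := .loop (.natLt (.var 11) (.var 10)) coarsenRound

lemma ends_coarsen {m H : ℕ} {η : ℝ} {s : Mem} (hη0 : 0 < η) (hH : 32 / η ≤ 2 ^ H)
    (h10 : s.nat 10 0 = m) (h11 : s.nat 11 0 = 1) (hη : s.real 1 0 = η) :
    Ends coarsen s (70 * (m * (2 + H)) + 1) fun s' => ∃ w E : ℕ,
      (∀ x y, x ≤ y → y < s'.nat 10 0 → s'.real 5 x ≤ s'.real 5 y) ∧
      IsSummary (s.real 5) m (s'.real 5) (s'.nat 10 0) w E ∧ (E : ℝ) ≤ η * m / 2 := by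
  have hm0 : (0 : ℝ) ≤ m := Nat.cast_nonneg m
  refine Ends.mono (Ends.loop
    (fun s' => ∃ q w E : ℕ, s'.nat 11 0 = 2 ^ q ∧ BlockSorted (s'.real 5) (s'.nat 10 0) (2 ^ q) ∧
      IsSummary (s.real 5) m (s'.real 5) (s'.nat 10 0) w E ∧
      (E = 0 ∨ (E : ℝ) + 4 * m / (2 ^ q : ℕ) ≤ η * m / 2))
    -- Before decimation starts, each round lowers the logarithmic factor by two; afterwards each
    -- round halves `n`, and the summand 2 keeps the drop proportional to `n`.
    (fun s' => 70 * (s'.nat 10 0 * (2 + (H - Nat.log 2 (s'.nat 11 0))))) ?_ ?_) ?_ ?_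
  · refine ⟨0, 1, 0, by simpa using h11, fun q x y h1 h2 h3 h4 => ?_, ⟨?_, ?_, ?_⟩, Or.inl rfl⟩
    · have : x = y := by simp at h1 h3; omega
      rw [this]
    · simp [h10]
    · simp [h10]
    · simp [h10]
  · rintro s' ⟨q, w, E, hq, hs, hsum, hE⟩ hF ht
    have hη' : s'.real 1 0 = η := by
      rw [hF.real 1 (by simp [Prog.KeepsReal, coarsenRound, mergePass, mergeRuns, decimate]), hη]
    simp only [Test.holds, NExp.eval, hq] at ht
    have hpos : 0 < 2 ^ q := by positivity
    set n := s'.nat 10 0 with hn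
    refine ⟨_, Ends.mono (ends_coarsenRound hpos hn.symm hq hη' hs hsum) le_rfl ?_⟩
    rintro s'' (⟨hc, e10, e11, hs'', hsum''⟩ | ⟨hc, e10, e11, hs'', hsum''⟩)
    · have e4 : 4 * 2 ^ q = 2 ^ (q + 2) := by ring
      rw [e4] at e11 hs''
      rw [← e10] at hs'' hsum''
      refine ⟨⟨q + 2, w, E, e11, hs'', hsum'', ?_⟩, ?_⟩
      · refine hE.imp_right fun h => le_trans ?_ h
        gcongr <;> omega
      · rw [e10, e11, hq, Nat.log_pow (by norm_num), Nat.log_pow (by norm_num)]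
        -- No decimation means `2 ^ (q + 2) < 32 / η ≤ 2 ^ H`, so the truncated subtractions are
        -- exact here.
        have hqH : q + 2 < H := by
          have h1 : (2 : ℝ) ^ (q + 2) < 2 ^ H := by
            refine lt_of_lt_of_le ?_ hH
            rw [lt_div_iff₀ hη0]
            push_cast at hc
            calc (2 : ℝ) ^ (q + 2) * η = 4 * 2 ^ q * η := by ring
              _ < 32 := hc
          exact (pow_lt_pow_iff_right₀ (by norm_num)).1 h1
        obtain ⟨R, rfl⟩ : ∃ R, H = q + 2 + R := ⟨H - (q + 2), by omega⟩
        have e1 : q + 2 + R - (q + 2) = R := by omega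
        have e2 : q + 2 + R - q = R + 2 := by omega
        rw [e1, e2]
        nlinarith
    · have e4 : 2 * 2 ^ q = 2 ^ (q + 1) := by ring
      have hE' := summary_error_step hpos ht hsum.weight hE hc
      rw [e4] at e11 hs'' hE'
      rw [← e10] at hs'' hsum''
      refine ⟨⟨q + 1, _, _, e11, hs'', hsum'', Or.inr hE'⟩, ?_⟩
      rw [e10, e11, hq, Nat.log_pow (by norm_num), Nat.log_pow (by norm_num)]
      have h1 : H - (q + 1) ≤ H - q := by omega
      have h2 : n / 2 * (2 + (H - (q + 1))) ≤ n / 2 * (2 + (H - q)) := Nat.mul_le_mul_left _ (by omega)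
      have h3 : 2 * (n / 2) * (2 + (H - q)) ≤ n * (2 + (H - q)) :=
        Nat.mul_le_mul_right _ (Nat.mul_div_le n 2)
      have h4 : n * 2 ≤ n * (2 + (H - q)) := Nat.mul_le_mul_left _ (by omega)
      rw [mul_assoc] at h3
      omega
  · rw [h10, h11]; simp
  · rintro s' ⟨⟨q, w, E, hq, hs, hsum, hE⟩, hF, ht⟩
    simp only [Test.holds, NExp.eval, hq, not_lt] at ht
    refine ⟨w, E, fun x y hxy hy => hs 0 x y (by omega) hxy (by omega) hy, hsum, ?_⟩
    rcases hE with hE | hE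
    · rw [hE]; push_cast; positivity
    · have : 0 ≤ 4 * (m : ℝ) / (2 ^ q : ℕ) := by positivity
      linarith

end RealRAM

/-! ### Separators of the sample points. -/

namespace RealRAM

/-- Copy the points of the sample to the real array `5`. -/
def copyPoints : Prog :=
  .seq (.assign 10 (.var 0))
  (.seq (.assign 11 (.lit 1))
  (.seq (.assign 13 (.lit 0))
  (.loop (.natLt (.var 13) (.var 0))
    (.seq (.setReal 5 (.var 13) (.get 0 (.var 13))) (.incr 13)))))

lemma ends_copyPoints {s : Mem} {m : ℕ} (h0 : s.nat 0 0 = m) :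
    Ends copyPoints s (3 * m + 4) fun s' => s'.nat 10 0 = m ∧ s'.nat 11 0 = 1 ∧
      ∀ x, x < m → s'.real 5 x = s.real 0 x := by
  refine Ends.mono (n := 1 + (1 + (1 + (3 * m + 1))))
    (Ends.seq (Ends.setNat (Ends.seq (Ends.setNat (Ends.seq (Ends.setNat ?_))))))
    (by omega) (fun _ h => h)
  set s₀ := ((s.setNat 10 _ _).setNat 11 _ _).setNat 13 _ _ with hs₀
  have k0 : s₀.nat 0 0 = m := by simpa [hs₀] using h0
  have k10 : s₀.nat 10 0 = m := by simpa [hs₀, NExp.eval] using h0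
  have k11 : s₀.nat 11 0 = 1 := by simp [hs₀, NExp.eval]
  have k13 : s₀.nat 13 0 = 0 := by simp [hs₀, NExp.eval]
  have kr : s₀.real = s.real := rfl
  refine Ends.mono (Ends.loop
    (fun s' => ∀ x, x < s'.nat 13 0 → s'.real 5 x = s.real 0 x)
    (fun s' => 3 * (m - s'.nat 13 0)) (by simp [k13]) ?_) (by simp [k13]) ?_
  · rintro s' h1 hF ht
    have e0 : s'.nat 0 0 = m := by rw [hF.nat 0 (by simp [Prog.KeepsNat]), k0]
    have er : s'.real 0 = s.real 0 := by rw [hF.real 0 (by simp [Prog.KeepsReal]), kr]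
    simp only [Test.holds, NExp.eval, e0] at ht
    refine ⟨1 + 1, Ends.seq (Ends.setReal (Ends.setNat ?_))⟩
    simp only [Mem.setNat_nat, Mem.setNat_real, Mem.setReal_nat, Mem.setReal_real, NExp.eval,
      RExp.eval, if_true, Function.update_self, Function.update_apply]
    refine ⟨fun x hx => ?_, by omega⟩
    split_ifs with h
    · rw [h, er]
    · exact h1 x (by omega)
  · rintro s' ⟨h1, hF, ht⟩
    have e0 : s'.nat 0 0 = m := by rw [hF.nat 0 (by simp [Prog.KeepsNat]), k0]
    simp only [Test.holds, NExp.eval, e0] at ht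
    refine ⟨?_, ?_, fun x hx => h1 x (by omega)⟩
    · rw [hF.nat 10 (by simp [Prog.KeepsNat]), k10]
    · rw [hF.nat 11 (by simp [Prog.KeepsNat]), k11]

/-- Find the least stride `g ≥ 1` with `4 g ≥ η n`. -/
def pickStride : Prog :=
  .seq (.assign 18 (.lit 1))
  (.loop (.realLt (.ofNat (.add (.add (.var 18) (.var 18)) (.add (.var 18) (.var 18))))
      (.mul (.get 1 (.lit 0)) (.ofNat (.var 10))))
    (.incr 18))

lemma ends_pickStride {s : Mem} {n : ℕ} {η : ℝ} (hη1 : η < 1) (h10 : s.nat 10 0 = n)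
    (hη : s.real 1 0 = η) :
    Ends pickStride s (2 * n + 2) fun s' => 1 ≤ s'.nat 18 0 ∧ η * n ≤ 4 * s'.nat 18 0 ∧
      (s'.nat 18 0 = 1 ∨ 4 * ((s'.nat 18 0 : ℝ) - 1) ≤ η * n) := by
  refine Ends.mono (n := 1 + (2 * n + 1)) (Ends.seq (Ends.setNat ?_)) (by omega) (fun _ h => h)
  set s₀ := s.setNat 18 ((NExp.lit 0).eval s) ((NExp.lit 1).eval s) with hs₀
  have k10 : s₀.nat 10 0 = n := by simpa [hs₀] using h10
  have k18 : s₀.nat 18 0 = 1 := by simp [hs₀, NExp.eval]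
  have kη : s₀.real 1 0 = η := hη
  refine Ends.mono (Ends.loop
    (fun s' => 1 ≤ s'.nat 18 0 ∧ (s'.nat 18 0 = 1 ∨ 4 * ((s'.nat 18 0 : ℝ) - 1) ≤ η * n))
    (fun s' => 2 * (n - s'.nat 18 0)) (by simp [k18]) ?_) (by omega) ?_
  · rintro s' ⟨h1, h2⟩ hF ht
    have e10 : s'.nat 10 0 = n := by rw [hF.nat 10 (by simp [Prog.KeepsNat]), k10]
    have eη : s'.real 1 0 = η := by rw [hF.real 1 (by simp [Prog.KeepsReal]), kη]
    simp only [Test.holds, NExp.eval, RExp.eval, e10, eη] at ht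
    push_cast at ht
    refine ⟨1, Ends.setNat ?_⟩
    simp only [Mem.setNat_nat, NExp.eval, if_true, Function.update_self]
    -- Linear search is affordable: `η < 1` keeps the stride below `n` while the test holds.
    have hlt : s'.nat 18 0 < n := by
      have h3 : (0 : ℝ) ≤ n := Nat.cast_nonneg n
      have h4 : (0 : ℝ) ≤ s'.nat 18 0 := Nat.cast_nonneg _
      have : (s'.nat 18 0 : ℝ) < n := by nlinarith
      exact_mod_cast this
    refine ⟨⟨by omega, Or.inr ?_⟩, by omega⟩
    push_cast
    linarith
  · rintro s' ⟨⟨h1, h2⟩, hF, ht⟩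
    have e10 : s'.nat 10 0 = n := by rw [hF.nat 10 (by simp [Prog.KeepsNat]), k10]
    have eη : s'.real 1 0 = η := by rw [hF.real 1 (by simp [Prog.KeepsReal]), kη]
    simp only [Test.holds, NExp.eval, RExp.eval, e10, eη, not_lt] at ht
    push_cast at ht
    exact ⟨h1, by linarith, h2⟩

/-- Collect every `g`-th of the `n` sorted entries of the real array `5`, without repetitions, in
the real array `7`, where the variables `10` and `18` hold `n` and `g`. The variable `19` holds
the number of entries collected. -/
def collectSeparators : Prog :=
  .seq (.assign 19 (.lit 0))
  (.seq (.assign 13 (.sub (.var 18) (.lit 1)))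
  (.loop (.natLt (.var 13) (.var 10))
    (.seq
      (.ite (.conj (.natLt (.lit 0) (.var 19))
          (.neg (.realLt (.get 7 (.sub (.var 19) (.lit 1))) (.get 5 (.var 13)))))
        .skip
        (.seq (.setReal 7 (.var 19) (.get 5 (.var 13))) (.incr 19)))
      (.assign 13 (.add (.var 13) (.var 18))))))

/-- The state of the collection: `u` entries of `z` have been looked at, the next one is `i`. -/
structure CollectInv (z q : ℕ → ℝ) (n g N i u : ℕ) : Prop where
  index : i + 1 = (u + 1) * g
  card : N ≤ u
  le : u * g ≤ n
  strict : ∀ x y, x < y → y < N → q x < q y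
  found : ∀ v, v < u → ∃ x, x < N ∧ q x = z ((v + 1) * g - 1)
  lower : ∀ x y, x < N → i ≤ y → y < n → q x ≤ z y

/-- The list is sorted, so an entry that does not exceed the last separator equals it. -/
lemma CollectInv.skip {z q : ℕ → ℝ} {n g N i u : ℕ} (h : CollectInv z q n g N i u) (hi : i < n)
    (hN : 0 < N) (hle : z i ≤ q (N - 1)) : CollectInv z q n g N (i + g) (u + 1) := by
  obtain ⟨h1, h2, h3, h4, h5, h6⟩ := h
  have e : (u + 1 + 1) * g = (u + 1) * g + g := by ring
  refine ⟨by omega, by omega, by omega, h4, fun v hv => ?_, fun x y hx hy => h6 x y hx (by omega)⟩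
  rcases Nat.lt_succ_iff_lt_or_eq.1 hv with hv | rfl
  · exact h5 v hv
  · refine ⟨N - 1, by omega, le_antisymm ?_ ?_⟩
    · exact h6 _ _ (by omega) (by omega) (by omega)
    · rwa [← h1, Nat.add_sub_cancel]

lemma CollectInv.append {z q : ℕ → ℝ} {n g N i u : ℕ} (h : CollectInv z q n g N i u) (hi : i < n)
    (hz : ∀ x y, x ≤ y → y < n → z x ≤ z y) (hlt : 0 < N → q (N - 1) < z i) :
    CollectInv z (Function.update q N (z i)) n g (N + 1) (i + g) (u + 1) := by
  obtain ⟨h1, h2, h3, h4, h5, h6⟩ := h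
  have e : (u + 1 + 1) * g = (u + 1) * g + g := by ring
  refine ⟨by omega, by omega, by omega, fun x y hxy hy => ?_, fun v hv => ?_, fun x y hx hy hyn => ?_⟩
  · rw [Function.update_of_ne (by omega)]
    rcases Nat.lt_succ_iff_lt_or_eq.1 hy with hy | rfl
    · rw [Function.update_of_ne (by omega)]
      exact h4 x y hxy hy
    · rw [Function.update_self]
      refine lt_of_le_of_lt ?_ (hlt (by omega))
      rcases Nat.lt_or_ge x (y - 1) with hx | hx
      · exact (h4 x (y - 1) hx (by omega)).le
      · rw [show x = y - 1 by omega]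
  · rcases Nat.lt_succ_iff_lt_or_eq.1 hv with hv | rfl
    · obtain ⟨x, hx, hqx⟩ := h5 v hv
      exact ⟨x, by omega, by rw [Function.update_of_ne (by omega), hqx]⟩
    · exact ⟨N, by omega, by rw [Function.update_self, ← h1, Nat.add_sub_cancel]⟩
  · rcases Nat.lt_succ_iff_lt_or_eq.1 hx with hx | rfl
    · rw [Function.update_of_ne (by omega)]
      exact h6 x y hx (by omega) hyn
    · rw [Function.update_self]
      exact hz i y (by omega) hyn

/-- The entries with value in `G` lie in a stretch of positions, and `g` consecutive positions would
include one of the form `(v + 1) g - 1`, whose value is a separator. -/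
lemma CollectInv.occ_lt {z q : ℕ → ℝ} {n g N i u : ℕ} (h : CollectInv z q n g N i u) (hi : n ≤ i)
    (hg : 0 < g) (hz : ∀ x y, x ≤ y → y < n → z x ≤ z y) {G : Set ℝ} (hG : G.OrdConnected)
    (hGq : ∀ x, x < N → q x ∉ G) : occ z 0 n G < g := by
  classical
  obtain ⟨h1, h2, h3, h4, h5, h6⟩ := h
  set U := (Finset.Ico 0 n).filter fun x => z x ∈ G with hU
  have hmem : ∀ x, x ∈ U ↔ x < n ∧ z x ∈ G := fun x => by
    rw [hU, Finset.mem_filter, Finset.mem_Ico]; simp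
  rcases U.eq_empty_or_nonempty with h | hne
  · rw [occ, ← hU, h]; simpa
  obtain ⟨l, hl, hlmin⟩ := U.exists_min_image id hne
  obtain ⟨r, hr, hrmax⟩ := U.exists_max_image id hne
  have hl' := (hmem l).1 hl
  have hr' := (hmem r).1 hr
  have hcard : occ z 0 n G ≤ r + 1 - l := by
    rw [occ, ← hU, ← Nat.card_Icc]
    exact Finset.card_le_card fun x hx => Finset.mem_Icc.2 ⟨hlmin x hx, hrmax x hx⟩
  by_contra hcon
  have e1 : (l / g + 1) * g = l / g * g + g := by ring
  have e2 := Nat.lt_div_mul_add (a := l) (b := g) hg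
  have e3 := Nat.div_mul_le_self l g
  have hv : l / g < u := by
    by_contra hge
    have : (u + 1) * g ≤ (l / g + 1) * g := Nat.mul_le_mul_right _ (by omega)
    omega
  obtain ⟨x, hx, hqx⟩ := h5 _ hv
  apply hGq x hx
  rw [hqx]
  exact hG.out hl'.2 hr'.2 ⟨hz _ _ (by omega) (by omega), hz _ _ (by omega) hr'.1⟩

lemma ends_collectSeparators {s : Mem} {n g : ℕ} (hg : 0 < g) (h10 : s.nat 10 0 = n)
    (h18 : s.nat 18 0 = g) (hz : ∀ x y, x ≤ y → y < n → s.real 5 x ≤ s.real 5 y) :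
    Ends collectSeparators s (5 * n + 3) fun s' =>
      s'.nat 19 0 * g ≤ n ∧
      (∀ x y, x < y → y < s'.nat 19 0 → s'.real 7 x < s'.real 7 y) ∧
      ∀ G : Set ℝ, G.OrdConnected → (∀ x, x < s'.nat 19 0 → s'.real 7 x ∉ G) →
        occ (s.real 5) 0 n G < g := by
  refine Ends.mono (n := 1 + (1 + (5 * n + 1))) (Ends.seq (Ends.setNat (Ends.seq (Ends.setNat ?_))))
    (by omega) (fun _ h => h)
  set s₀ := (s.setNat 19 _ _).setNat 13 _ _ with hs₀
  have k10 : s₀.nat 10 0 = n := by simpa [hs₀] using h10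
  have k18 : s₀.nat 18 0 = g := by simpa [hs₀] using h18
  have k19 : s₀.nat 19 0 = 0 := by simp [hs₀, NExp.eval]
  have k13 : s₀.nat 13 0 = g - 1 := by simp [hs₀, NExp.eval, h18]
  have k5 : s₀.real 5 = s.real 5 := rfl
  refine Ends.mono (Ends.loop
    (fun s' => ∃ u, CollectInv (s.real 5) (s'.real 7) n g (s'.nat 19 0) (s'.nat 13 0) u)
    (fun s' => 5 * (n - s'.nat 13 0)) ⟨0, ?_⟩ ?_) (by omega) ?_
  · rw [k19, k13]
    exact ⟨by omega, le_rfl, by omega, by omega, by omega, by omega⟩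
  · rintro s' ⟨u, hI⟩ hF ht
    have e10 : s'.nat 10 0 = n := by rw [hF.nat 10 (by simp [Prog.KeepsNat]), k10]
    have e18 : s'.nat 18 0 = g := by rw [hF.nat 18 (by simp [Prog.KeepsNat]), k18]
    have e5 : s'.real 5 = s.real 5 := by rw [hF.real 5 (by simp [Prog.KeepsReal]), k5]
    simp only [Test.holds, NExp.eval, e10] at ht
    refine ⟨(1 + 1) + 1 + 1, Ends.seq (n := (1 + 1) + 1) (k := 1)
      (Ends.ite (n := 1 + 1) (fun hc => ?_) fun hc => ?_)⟩
    · simp only [Test.holds, NExp.eval, RExp.eval, e5, not_lt] at hc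
      refine Ends.mono (n := 1) (Ends.skip (Ends.setNat ?_)) (by omega) (fun _ h => h)
      simp only [Mem.setNat_nat, Mem.setNat_real, NExp.eval, if_true, Function.update_self, e18,
        Nat.reduceEqDiff, if_false]
      exact ⟨⟨u + 1, hI.skip ht hc.1 hc.2⟩, by omega⟩
    · simp only [Test.holds, NExp.eval, RExp.eval, e5, not_lt, not_and, not_le] at hc
      refine Ends.seq (n := 1) (k := 1) (Ends.setReal (Ends.setNat (Ends.setNat ?_)))
      simp only [Mem.setNat_nat, Mem.setNat_real, Mem.setReal_nat, Mem.setReal_real, NExp.eval,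
        RExp.eval, if_true, Function.update_self, e18, e5, Nat.reduceEqDiff, if_false]
      exact ⟨⟨u + 1, hI.append ht hz hc⟩, by omega⟩
  · rintro s' ⟨⟨u, hI⟩, hF, ht⟩
    have e10 : s'.nat 10 0 = n := by rw [hF.nat 10 (by simp [Prog.KeepsNat]), k10]
    simp only [Test.holds, NExp.eval, e10, not_lt] at ht
    exact ⟨(Nat.mul_le_mul_right _ hI.card).trans hI.le, hI.strict,
      fun G hG hGq => hI.occ_lt ht hg hz hG hGq⟩

/-- Compute separators of the points of the sample. -/
def separators : Prog :=
  .seq copyPoints (.seq coarsen (.seq pickStride collectSeparators))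

/-- An interval without separators holds at most `g - 1 ≤ η n / 4` entries of the summary, that is
at most `η m / 4` after weighting, and the error of the summary is at most `η m / 2`. -/
lemma ends_separators {s : Mem} {m H : ℕ} {η : ℝ} (hη0 : 0 < η) (hη1 : η < 1)
    (hH : 32 / η ≤ 2 ^ H) (h0 : s.nat 0 0 = m) (hη : s.real 1 0 = η) :
    Ends separators s (70 * (m * (2 + H)) + 10 * m + 10) fun s' =>
      (s'.nat 19 0 : ℝ) ≤ 4 / η ∧
      (∀ x y, x < y → y < s'.nat 19 0 → s'.real 7 x < s'.real 7 y) ∧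
      ∀ G : Set ℝ, G.OrdConnected → (∀ x, x < s'.nat 19 0 → s'.real 7 x ∉ G) →
        (occ (s.real 0) 0 m G : ℝ) ≤ η * m := by
  refine Ends.mono (n := (3 * m + 4) + ((70 * (m * (2 + H)) + 1) + ((2 * m + 2) + (5 * m + 3))))
    (Ends.seq (Ends.mono (Ends.frame (ends_copyPoints h0)) le_rfl ?_)) (by omega) (fun _ h => h)
  rintro s₁ ⟨⟨a10, a11, hx⟩, hF₁⟩
  have aη : s₁.real 1 0 = η := by
    rw [hF₁.real 1 (by simp [Prog.KeepsReal, copyPoints]), hη]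
  refine Ends.seq (Ends.mono (Ends.frame (ends_coarsen hη0 hH a10 a11 aη)) le_rfl ?_)
  rintro s₂ ⟨⟨w, E, hsort, hsum, hE⟩, hF₂⟩
  have bη : s₂.real 1 0 = η := by
    rw [hF₂.real 1 (by
      simp [Prog.KeepsReal, coarsen, coarsenRound, mergePass, mergeRuns, decimate]), aη]
  set n := s₂.nat 10 0 with hn
  have hnm := hsum.card
  refine Ends.seq (Ends.mono (Ends.frame (ends_pickStride hη1 hn.symm bη)) (by omega) ?_)
  rintro s₃ ⟨⟨hg1, hg2, hg3⟩, hF₃⟩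
  set g := s₃.nat 18 0 with hg
  have c10 : s₃.nat 10 0 = n := by rw [hF₃.nat 10 (by simp [Prog.KeepsNat, pickStride])]
  have c5 : s₃.real 5 = s₂.real 5 := hF₃.real 5 (by simp [Prog.KeepsReal, pickStride])
  refine Ends.mono (ends_collectSeparators hg1 c10 hg.symm (by rw [c5]; exact hsort)) (by omega) ?_
  rintro s₄ ⟨hN, hstrict, hG⟩
  refine ⟨?_, hstrict, fun G hGo hGq => ?_⟩
  · rw [le_div_iff₀ hη0]
    have h1 : (s₄.nat 19 0 : ℝ) * g ≤ n := by exact_mod_cast hN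
    have hg0 : (0 : ℝ) < g := by exact_mod_cast hg1
    have h2 : (s₄.nat 19 0 : ℝ) * η * g ≤ 4 * g := by nlinarith
    exact le_of_mul_le_mul_right h2 hg0
  · have h1 := hG G hGo hGq
    rw [c5] at h1
    have h2 := hsum.count G hGo
    rw [occ_congr (f' := s.real 0) (fun x _ hxm => hx x hxm)] at h2
    have h3 : (occ (s.real 0) 0 m G : ℝ) ≤ w * occ (s₂.real 5) 0 n G + E := by exact_mod_cast h2
    have hw : (w : ℝ) * n ≤ m := by exact_mod_cast hsum.weight
    have hm0 : (0 : ℝ) ≤ m := Nat.cast_nonneg m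
    have h4 : (w : ℝ) * occ (s₂.real 5) 0 n G ≤ η * m / 2 := by
      have h5 : (occ (s₂.real 5) 0 n G : ℝ) ≤ η * n / 4 := by
        have h6 : (occ (s₂.real 5) 0 n G : ℝ) + 1 ≤ g := by exact_mod_cast h1
        rcases hg3 with h | h
        · rw [h] at h6
          push_cast at h6
          have : (0 : ℝ) ≤ η * n / 4 := by positivity
          linarith
        · linarith
      have h7 := mul_le_mul_of_nonneg_left h5 (Nat.cast_nonneg w : (0 : ℝ) ≤ w)
      nlinarith
    linarith

end RealRAM

namespace RealRAM

/-! ### The atoms cut out by the separators -/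

/-- The number of separators among `q 0, …, q (N - 1)` that are less than `p`. -/
noncomputable def numLt (q : ℕ → ℝ) (N : ℕ) (p : ℝ) : ℕ :=
  ((Finset.range N).filter fun x => q x < p).card

/-- The number of separators among `q 0, …, q (N - 1)` that are at most `p`. -/
noncomputable def numLe (q : ℕ → ℝ) (N : ℕ) (p : ℝ) : ℕ :=
  ((Finset.range N).filter fun x => q x ≤ p).card

/-- The index of the atom that contains `p`: the atom `2 i + 1` is the separator `q i`, and the
atoms with even index are the gaps. -/
noncomputable def atomIndex (q : ℕ → ℝ) (N : ℕ) (p : ℝ) : ℕ := numLt q N p + numLe q N p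

lemma monotone_atomIndex (q : ℕ → ℝ) (N : ℕ) : Monotone (atomIndex q N) := by
  intro a b hab
  refine add_le_add (Finset.card_le_card fun x hx => ?_) (Finset.card_le_card fun x hx => ?_)
  · rw [Finset.mem_filter] at hx ⊢
    exact ⟨hx.1, hx.2.trans_le hab⟩
  · rw [Finset.mem_filter] at hx ⊢
    exact ⟨hx.1, hx.2.trans hab⟩

lemma lt_card_filter_range_iff {P : ℕ → Prop} [DecidablePred P] {N : ℕ}
    (hP : ∀ x y, x ≤ y → y < N → P y → P x) (i : ℕ) :
    i < ((Finset.range N).filter P).card ↔ i < N ∧ P i := by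
  constructor
  · intro h
    by_contra hcon
    have hsub : (Finset.range N).filter P ⊆ Finset.range i := fun x hx => by
      rw [Finset.mem_filter, Finset.mem_range] at hx
      rw [Finset.mem_range]
      by_contra hge
      exact hcon ⟨by omega, hP i x (by omega) hx.1 hx.2⟩
    have := Finset.card_le_card hsub
    rw [Finset.card_range] at this
    omega
  · rintro ⟨hi, hPi⟩
    have hsub : Finset.range (i + 1) ⊆ (Finset.range N).filter P := fun x hx => by
      rw [Finset.mem_range] at hx
      rw [Finset.mem_filter, Finset.mem_range]
      exact ⟨by omega, hP x i (by omega) hi hPi⟩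
    have := Finset.card_le_card hsub
    rw [Finset.card_range] at this
    omega

lemma separators_le {q : ℕ → ℝ} {N : ℕ} (hq : ∀ x y, x < y → y < N → q x < q y)
    {x y : ℕ} (hxy : x ≤ y) (hy : y < N) : q x ≤ q y := by
  rcases hxy.eq_or_lt with rfl | h
  · rfl
  · exact (hq x y h hy).le

lemma lt_numLt_iff {q : ℕ → ℝ} {N : ℕ} (hq : ∀ x y, x < y → y < N → q x < q y)
    {p : ℝ} {i : ℕ} : i < numLt q N p ↔ i < N ∧ q i < p :=
  lt_card_filter_range_iff (fun _ _ hxy hy h => (separators_le hq hxy hy).trans_lt h) i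

lemma lt_numLe_iff {q : ℕ → ℝ} {N : ℕ} (hq : ∀ x y, x < y → y < N → q x < q y)
    {p : ℝ} {i : ℕ} : i < numLe q N p ↔ i < N ∧ q i ≤ p :=
  lt_card_filter_range_iff (fun _ _ hxy hy h => (separators_le hq hxy hy).trans h) i

lemma numLt_le_numLe {q : ℕ → ℝ} {N : ℕ} (hq : ∀ x y, x < y → y < N → q x < q y)
    {p : ℝ} : numLt q N p ≤ numLe q N p := by
  by_contra h
  push Not at h
  have h1 := (lt_numLt_iff hq).1 h
  exact absurd ((lt_numLe_iff hq).2 ⟨h1.1, h1.2.le⟩) (lt_irrefl _)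

lemma numLe_le_numLt_add_one {q : ℕ → ℝ} {N : ℕ} (hq : ∀ x y, x < y → y < N → q x < q y)
    {p : ℝ} : numLe q N p ≤ numLt q N p + 1 := by
  by_contra h
  push Not at h
  have h1 := (lt_numLe_iff hq).1 h
  have h2 := (lt_numLt_iff hq).2 ⟨(by omega : numLt q N p < N),
    (hq _ _ (by omega : numLt q N p < numLt q N p + 1) h1.1).trans_le h1.2⟩
  omega

lemma odd_le_atomIndex_iff {q : ℕ → ℝ} {N : ℕ} (hq : ∀ x y, x < y → y < N → q x < q y)
    {p : ℝ} {i : ℕ} : 2 * i + 1 ≤ atomIndex q N p ↔ i < N ∧ q i ≤ p := by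
  have h1 := numLt_le_numLe hq (p := p)
  have h2 := numLe_le_numLt_add_one hq (p := p)
  rw [← lt_numLe_iff hq, atomIndex]
  omega

lemma even_le_atomIndex_iff {q : ℕ → ℝ} {N : ℕ} (hq : ∀ x y, x < y → y < N → q x < q y)
    {p : ℝ} {i : ℕ} : 2 * i + 2 ≤ atomIndex q N p ↔ i < N ∧ q i < p := by
  have h1 := numLt_le_numLe hq (p := p)
  have h2 := numLe_le_numLt_add_one hq (p := p)
  rw [← lt_numLt_iff hq, atomIndex]
  omega

lemma atomIndex_le {q : ℕ → ℝ} {N : ℕ} (hq : ∀ x y, x < y → y < N → q x < q y)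
    {p : ℝ} : atomIndex q N p ≤ 2 * N := by
  have h1 : ¬ N < numLe q N p := fun h => lt_irrefl _ ((lt_numLe_iff hq).1 h).1
  have h2 := numLt_le_numLe hq (p := p)
  rw [atomIndex]
  omega

/-- Translates the outcome `l` of the binary search: one more comparison, with `q l`, distinguishes
a separator from a gap. -/
lemma atomIndex_eq {q : ℕ → ℝ} {N : ℕ} (hq : ∀ x y, x < y → y < N → q x < q y)
    {p : ℝ} {l : ℕ} (h1 : ∀ x, x < l → x < N ∧ q x < p)
    (h2 : ∀ x, l ≤ x → x < N → p ≤ q x) :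
    atomIndex q N p = if l < N ∧ ¬ p < q l then 2 * l + 1 else 2 * l := by
  have hl : numLt q N p = l := by
    apply le_antisymm
    · by_contra h
      push Not at h
      have h3 := (lt_numLt_iff hq).1 h
      exact absurd h3.2 (not_lt.2 (h2 l le_rfl h3.1))
    · by_contra h
      push Not at h
      exact lt_irrefl _ ((lt_numLt_iff hq).2 (h1 _ h))
  have h3 := numLt_le_numLe hq (p := p)
  have h4 := numLe_le_numLt_add_one hq (p := p)
  have h5 := lt_numLe_iff hq (p := p) (i := l)
  rw [atomIndex]
  split_ifs with h <;> rw [not_lt, ← h5] at h <;> omega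

/-! ### Counting the points and the labels in the atoms -/

/-- Binary search for the number of separators less than the point with index `13`. -/
def binarySearch : Prog :=
  .loop (.natLt (.var 20) (.var 21))
    (.seq (.assign 22 (.half (.add (.var 20) (.var 21))))
      (.ite (.realLt (.get 7 (.var 22)) (.get 0 (.var 13)))
        (.assign 20 (.add (.var 22) (.lit 1)))
        (.assign 21 (.var 22))))

lemma ends_binarySearch {s : Mem} {N i : ℕ} {p : ℝ}
    (hq : ∀ x y, x < y → y < N → s.real 7 x < s.real 7 y) (h20 : s.nat 20 0 = 0)
    (h21 : s.nat 21 0 = N) (h13 : s.nat 13 0 = i) (hp : s.real 0 i = p) :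
    Ends binarySearch s (4 * Nat.size N + 1) fun s' =>
      (∀ x, x < s'.nat 20 0 → x < N ∧ s.real 7 x < p) ∧
      ∀ x, s'.nat 20 0 ≤ x → x < N → p ≤ s.real 7 x := by
  refine Ends.mono (Ends.loop
    (fun s' => s'.nat 21 0 ≤ N ∧ s'.nat 20 0 ≤ s'.nat 21 0 ∧
      (∀ x, x < s'.nat 20 0 → x < N ∧ s.real 7 x < p) ∧
      ∀ x, s'.nat 21 0 ≤ x → x < N → p ≤ s.real 7 x)
    (fun s' => 4 * Nat.size (s'.nat 21 0 - s'.nat 20 0)) ?_ ?_) (by rw [h20, h21]; simp) ?_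
  · rw [h20, h21]
    exact ⟨le_rfl, by omega, by omega, by omega⟩
  · rintro s' ⟨h1, h2, h3, h4⟩ hF ht
    have e13 : s'.nat 13 0 = i := by rw [hF.nat 13 (by simp [Prog.KeepsNat]), h13]
    have e7 : s'.real 7 = s.real 7 := hF.real 7 (by simp [Prog.KeepsReal])
    have e0 : s'.real 0 i = p := by rw [hF.real 0 (by simp [Prog.KeepsReal]), hp]
    simp only [Test.holds, NExp.eval] at ht
    set lo := s'.nat 20 0 with hlo
    set hi := s'.nat 21 0 with hhi
    -- Either half of the search range has a binary length smaller by at least one, which pays for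
    -- the four steps of an iteration.
    have hsize : ∀ d, d ≤ (hi - lo) / 2 → 4 * Nat.size d + 3 + 1 ≤ 4 * Nat.size (hi - lo) := by
      intro d hd
      have h5 := Nat.lt_size_self (hi - lo)
      have h6 : 0 < Nat.size (hi - lo) := Nat.size_pos.2 (by omega)
      obtain ⟨k, hk⟩ : ∃ k, Nat.size (hi - lo) = k + 1 := ⟨_, (Nat.succ_pred h6.ne').symm⟩
      rw [hk, pow_succ] at h5
      have : Nat.size d ≤ k := Nat.size_le.2 (by omega)
      omega
    refine ⟨3, Ends.seq (n := 1) (k := 2) (Ends.setNat (Ends.ite (n := 1) (fun hc => ?_)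
      fun hc => ?_))⟩
    · simp only [Test.holds, NExp.eval, RExp.eval, Mem.setNat_nat, Mem.setNat_real, if_true,
        Nat.reduceEqDiff, if_false, Function.update_self, e13, e7, e0, ← hlo, ← hhi] at hc
      refine Ends.setNat ?_
      simp only [NExp.eval, Mem.setNat_nat, if_true,
        Nat.reduceEqDiff, if_false, Function.update_self, ← hlo, ← hhi]
      refine ⟨⟨h1, by omega, fun x hx => ⟨by omega, ?_⟩, h4⟩, hsize _ (by omega)⟩
      exact (separators_le hq (by omega) (by omega)).trans_lt hc
    · simp only [Test.holds, NExp.eval, RExp.eval, Mem.setNat_nat, Mem.setNat_real, if_true,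
        Nat.reduceEqDiff, if_false, Function.update_self, e13, e7, e0, ← hlo, ← hhi, not_lt] at hc
      refine Ends.setNat ?_
      simp only [NExp.eval, Mem.setNat_nat, if_true,
        Nat.reduceEqDiff, if_false, Function.update_self, ← hlo, ← hhi]
      refine ⟨⟨by omega, by omega, h3, fun x hx hxN => ?_⟩, hsize _ (by omega)⟩
      exact hc.trans (separators_le hq hx hxN)
  · rintro s' ⟨⟨h1, h2, h3, h4⟩, hF, ht⟩
    simp only [Test.holds, NExp.eval, not_lt] at ht
    exact ⟨h3, fun x hx hxN => h4 x (by omega) hxN⟩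

/-- Count the points (integer array `30`) and the positive labels (integer array `31`) in the
atoms. -/
def countAtoms : Prog :=
  .seq (.assign 13 (.lit 0))
  (.loop (.natLt (.var 13) (.var 0))
    (.seq (.assign 20 (.lit 0))
    (.seq (.assign 21 (.var 19))
    (.seq binarySearch
    (.seq (.ite (.conj (.natLt (.var 20) (.var 19))
        (.neg (.realLt (.get 0 (.var 13)) (.get 7 (.var 20)))))
      (.assign 14 (.add (.add (.var 20) (.var 20)) (.lit 1)))
      (.assign 14 (.add (.var 20) (.var 20))))
    (.seq (.setNat 30 (.var 14) (.add (.get 30 (.var 14)) (.lit 1)))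
    (.seq (.setNat 31 (.var 14) (.add (.get 31 (.var 14)) (.get 1 (.var 13))))
      (.incr 13))))))))

lemma sum_ite_succ (a v : ℕ → ℕ) (i j : ℕ) (c : ℕ → ℕ)
    (hc : ∀ j, c j = ∑ x ∈ Finset.range i, if a x = j then v x else 0) :
    Function.update c (a i) (c (a i) + v i) j =
      ∑ x ∈ Finset.range (i + 1), if a x = j then v x else 0 := by
  rw [Finset.sum_range_succ, ← hc]
  rcases eq_or_ne (a i) j with rfl | h
  · simp
  · rw [Function.update_of_ne h.symm, if_neg h, add_zero]

lemma ends_countAtoms {s : Mem} {m N : ℕ} (hq : ∀ x y, x < y → y < N → s.real 7 x < s.real 7 y)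
    (h0 : s.nat 0 0 = m) (h19 : s.nat 19 0 = N) (h30 : ∀ j, s.nat 30 j = 0)
    (h31 : ∀ j, s.nat 31 j = 0) :
    Ends countAtoms s ((4 * Nat.size N + 9) * m + 2) fun s' =>
      (∀ j, s'.nat 30 j = ∑ x ∈ Finset.range m,
        if atomIndex (s.real 7) N (s.real 0 x) = j then 1 else 0) ∧
      ∀ j, s'.nat 31 j = ∑ x ∈ Finset.range m,
        if atomIndex (s.real 7) N (s.real 0 x) = j then s.nat 1 x else 0 := by
  refine Ends.mono (n := 1 + ((4 * Nat.size N + 9) * m + 1)) (Ends.seq (Ends.setNat ?_))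
    (by omega) (fun _ h => h)
  set s₀ := s.setNat 13 ((NExp.lit 0).eval s) ((NExp.lit 0).eval s) with hs₀
  have k0 : s₀.nat 0 0 = m := by simpa [hs₀] using h0
  have k1 : s₀.nat 1 = s.nat 1 := by simp [hs₀]
  have k19 : s₀.nat 19 0 = N := by simpa [hs₀] using h19
  have k13 : s₀.nat 13 0 = 0 := by simp [hs₀, NExp.eval]
  have kr : s₀.real = s.real := rfl
  refine Ends.mono (Ends.loop
    (fun s' => s'.nat 13 0 ≤ m ∧ (∀ j, s'.nat 30 j = ∑ x ∈ Finset.range (s'.nat 13 0),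
        if atomIndex (s.real 7) N (s.real 0 x) = j then 1 else 0) ∧
      ∀ j, s'.nat 31 j = ∑ x ∈ Finset.range (s'.nat 13 0),
        if atomIndex (s.real 7) N (s.real 0 x) = j then s.nat 1 x else 0)
    (fun s' => (4 * Nat.size N + 9) * (m - s'.nat 13 0)) ?_ ?_) (by simp [k13]) ?_
  · rw [k13]
    simp [hs₀, h30, h31]
  · rintro s' ⟨hm, h1, h2⟩ hF ht
    have e0 : s'.nat 0 0 = m := by
      rw [hF.nat 0 (by simp [Prog.KeepsNat, binarySearch]), k0]
    have e1 : s'.nat 1 = s.nat 1 := by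
      rw [hF.nat 1 (by simp [Prog.KeepsNat, binarySearch]), k1]
    have e19 : s'.nat 19 0 = N := by
      rw [hF.nat 19 (by simp [Prog.KeepsNat, binarySearch]), k19]
    have er0 : s'.real 0 = s.real 0 := by
      rw [hF.real 0 (by simp [Prog.KeepsReal, binarySearch]), kr]
    have er7 : s'.real 7 = s.real 7 := by
      rw [hF.real 7 (by simp [Prog.KeepsReal, binarySearch]), kr]
    simp only [Test.holds, NExp.eval, e0] at ht
    set i := s'.nat 13 0 with hi
    refine ⟨1 + (1 + ((4 * Nat.size N + 1) + (2 + (1 + (1 + 1))))), Ends.seq (Ends.setNat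
      (Ends.seq (Ends.setNat (Ends.seq ?_))))⟩
    set s₁ := (s'.setNat 20 _ _).setNat 21 _ _ with hs₁
    have f20 : s₁.nat 20 0 = 0 := by simp [hs₁, NExp.eval]
    have f21 : s₁.nat 21 0 = N := by simp [hs₁, NExp.eval, e19]
    have f13 : s₁.nat 13 0 = i := by simp [hs₁, hi]
    have f19 : s₁.nat 19 0 = N := by simpa [hs₁] using e19
    have f1 : s₁.nat 1 = s.nat 1 := by simpa [hs₁] using e1
    have f30 : s₁.nat 30 = s'.nat 30 := by simp [hs₁]
    have f31 : s₁.nat 31 = s'.nat 31 := by simp [hs₁]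
    have fr : s₁.real = s'.real := rfl
    refine Ends.mono (Ends.frame (ends_binarySearch (s := s₁) (p := s.real 0 i)
      (by rw [fr, er7]; exact hq) f20 f21 f13 (by rw [fr, er0]))) le_rfl ?_
    rintro s₂ ⟨⟨b1, b2⟩, hF₂⟩
    rw [fr, er7] at b1 b2
    have hatom := atomIndex_eq hq b1 b2
    have g13 : s₂.nat 13 0 = i := by
      rw [hF₂.nat 13 (by simp [Prog.KeepsNat, binarySearch]), f13]
    have g19 : s₂.nat 19 0 = N := by
      rw [hF₂.nat 19 (by simp [Prog.KeepsNat, binarySearch]), f19]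
    have g1 : s₂.nat 1 = s.nat 1 := by
      rw [hF₂.nat 1 (by simp [Prog.KeepsNat, binarySearch]), f1]
    have g30 : s₂.nat 30 = s'.nat 30 := by
      rw [hF₂.nat 30 (by simp [Prog.KeepsNat, binarySearch]), f30]
    have g31 : s₂.nat 31 = s'.nat 31 := by
      rw [hF₂.nat 31 (by simp [Prog.KeepsNat, binarySearch]), f31]
    have gr0 : s₂.real 0 = s.real 0 := by
      rw [hF₂.real 0 (by simp [Prog.KeepsReal, binarySearch]), fr, er0]
    have gr7 : s₂.real 7 = s.real 7 := by
      rw [hF₂.real 7 (by simp [Prog.KeepsReal, binarySearch]), fr, er7]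
    have hcond : (Test.conj (.natLt (.var 20) (.var 19))
        (.neg (.realLt (.get 0 (.var 13)) (.get 7 (.var 20))))).holds s₂ ↔
        s₂.nat 20 0 < N ∧ ¬ s.real 0 i < s.real 7 (s₂.nat 20 0) := by
      simp only [Test.holds, NExp.eval, RExp.eval, g19, g13, gr0, gr7]
    -- The common continuation of both branches, for any memory in which the variable `14` holds the
    -- atom.
    have hfin : ∀ s₃ : Mem, s₃.nat 14 0 = atomIndex (s.real 7) N (s.real 0 i) →
        s₃.nat 13 0 = i → s₃.nat 1 = s.nat 1 → s₃.nat 30 = s'.nat 30 → s₃.nat 31 = s'.nat 31 →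
        Ends (.seq (.setNat 30 (.var 14) (.add (.get 30 (.var 14)) (.lit 1)))
          (.seq (.setNat 31 (.var 14) (.add (.get 31 (.var 14)) (.get 1 (.var 13))))
          (.incr 13))) s₃ (1 + (1 + 1)) fun s'' =>
          (s''.nat 13 0 ≤ m ∧ (∀ j, s''.nat 30 j = ∑ x ∈ Finset.range (s''.nat 13 0),
            if atomIndex (s.real 7) N (s.real 0 x) = j then 1 else 0) ∧
          ∀ j, s''.nat 31 j = ∑ x ∈ Finset.range (s''.nat 13 0),
            if atomIndex (s.real 7) N (s.real 0 x) = j then s.nat 1 x else 0) ∧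
          (4 * Nat.size N + 9) * (m - s''.nat 13 0) +
            (1 + (1 + ((4 * Nat.size N + 1) + (2 + (1 + (1 + 1)))))) + 1 ≤
            (4 * Nat.size N + 9) * (m - i) := by
      intro s₃ d14 d13 d1 d30 d31
      refine Ends.seq (Ends.setNat (Ends.seq (Ends.setNat (Ends.setNat ?_))))
      simp only [NExp.eval, Mem.setNat_nat, if_true, Nat.reduceEqDiff, if_false,
        Function.update_self, d14, d13, d1, d30, d31]
      refine ⟨⟨ht, fun j => ?_, fun j => ?_⟩, ?_⟩
      · exact sum_ite_succ (fun x => atomIndex (s.real 7) N (s.real 0 x)) (fun _ => 1) i j _ h1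
      · exact sum_ite_succ (fun x => atomIndex (s.real 7) N (s.real 0 x)) (s.nat 1) i j _ h2
      · obtain ⟨k, hk⟩ : ∃ k, m - i = k + 1 := ⟨m - i - 1, by omega⟩
        rw [show m - (i + 1) = k by omega, hk, Nat.mul_succ]
        omega
    refine Ends.seq (n := 2) (k := 1 + (1 + 1)) (Ends.ite (n := 1) (fun hc => ?_) fun hc => ?_)
    · rw [hcond] at hc
      rw [if_pos hc] at hatom
      refine Ends.setNat (hfin _ ?_ ?_ ?_ ?_ ?_)
      · simp only [NExp.eval, Mem.setNat_nat, if_true, Function.update_self, hatom]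
        ring
      · simpa using g13
      · simpa using g1
      · simpa using g30
      · simpa using g31
    · rw [hcond] at hc
      rw [if_neg hc] at hatom
      refine Ends.setNat (hfin _ ?_ ?_ ?_ ?_ ?_)
      · simp only [NExp.eval, Mem.setNat_nat, if_true, Function.update_self, hatom]
        ring
      · simpa using g13
      · simpa using g1
      · simpa using g30
      · simpa using g31
  · rintro s' ⟨⟨hm, h1, h2⟩, hF, ht⟩
    have e0 : s'.nat 0 0 = m := by
      rw [hF.nat 0 (by simp [Prog.KeepsNat, binarySearch]), k0]
    simp only [Test.holds, NExp.eval, e0, not_lt] at ht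
    have : s'.nat 13 0 = m := by omega
    rw [this] at h1 h2
    exact ⟨h1, h2⟩

end RealRAM

namespace RealRAM

/-! ### Merging atoms into buckets -/

/-- The state of the greedy merge of the atoms `0, …, j - 1`: the buckets `0, …, e` start at the
atoms `st k`, hold `c k` points and `p k` positive labels. -/
structure GreedyInv (cnt pos : ℕ → ℕ) (M : ℝ) (st c p : ℕ → ℕ) (e j : ℕ) : Prop where
  zero : st 0 = 0
  last : st (e + 1) = j
  lt : ∀ k, k ≤ e → st k < st (k + 1)
  cnt_eq : ∀ k, k ≤ e → c k = ∑ x ∈ Finset.Ico (st k) (st (k + 1)), cnt x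
  pos_eq : ∀ k, k ≤ e → p k = ∑ x ∈ Finset.Ico (st k) (st (k + 1)), pos x
  small : ∀ k, k ≤ e → st (k + 1) = st k + 1 ∨ (c k : ℝ) ≤ M
  -- Two neighbouring buckets hold more than `M` points together. Summing over neighbours counts
  -- each bucket at most twice, and the current one once.
  card : e * M ≤ 2 * (∑ x ∈ Finset.range (st e), cnt x : ℕ) + c e
  -- A second bucket is opened only after some points have been seen; this excludes `m = 0` in the
  -- final division.
  nonempty : 0 < e → 0 < ∑ x ∈ Finset.range j, cnt x

lemma GreedyInv.extend {cnt pos : ℕ → ℕ} {M : ℝ} {st c p : ℕ → ℕ} {e j : ℕ}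
    (h : GreedyInv cnt pos M st c p e j) (hM : ((c e + cnt j : ℕ) : ℝ) ≤ M) :
    GreedyInv cnt pos M (Function.update st (e + 1) (j + 1))
      (Function.update c e (c e + cnt j)) (Function.update p e (p e + pos j)) e (j + 1) := by
  obtain ⟨h1, h2, h3, h4, h5, h6, h7, h8⟩ := h
  have hst : ∀ k, k ≤ e → Function.update st (e + 1) (j + 1) k = st k := fun k hk =>
    Function.update_of_ne (by omega) _ _
  have hst' : ∀ k, k < e → Function.update st (e + 1) (j + 1) (k + 1) = st (k + 1) := fun k hk =>
    Function.update_of_ne (by omega) _ _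
  have hlt := h3 e le_rfl
  rw [h2] at hlt
  refine ⟨by rw [hst 0 (by omega), h1], by simp, fun k hk => ?_, fun k hk => ?_, fun k hk => ?_,
    fun k hk => ?_, ?_, fun he => ?_⟩
  · rcases hk.lt_or_eq with hk' | rfl
    · rw [hst k hk, hst' k hk']; exact h3 k hk
    · rw [hst k hk, Function.update_self]; omega
  · rcases hk.lt_or_eq with hk' | rfl
    · rw [hst k hk, hst' k hk', Function.update_of_ne hk'.ne]; exact h4 k hk
    · rw [hst k hk, Function.update_self, Function.update_self, Finset.sum_Ico_succ_top hlt.le,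
        h4 k hk, h2]
  · rcases hk.lt_or_eq with hk' | rfl
    · rw [hst k hk, hst' k hk', Function.update_of_ne hk'.ne]; exact h5 k hk
    · rw [hst k hk, Function.update_self, Function.update_self, Finset.sum_Ico_succ_top hlt.le,
        h5 k hk, h2]
  · rcases hk.lt_or_eq with hk' | rfl
    · rw [hst k hk, hst' k hk', Function.update_of_ne hk'.ne]; exact h6 k hk
    · right; rw [Function.update_self]; exact hM
  · rw [hst e le_rfl, Function.update_self]
    push_cast at h7 ⊢
    have : (0 : ℝ) ≤ cnt j := Nat.cast_nonneg _
    linarith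
  · rw [Finset.sum_range_succ]
    have := h8 he
    omega

/-- The atom `j` did not fit, so `M < c e + cnt j`; adding this to the bound for `e` gives the bound
for `e + 1`. -/
lemma GreedyInv.new {cnt pos : ℕ → ℕ} {M : ℝ} (hM0 : 0 ≤ M) {st c p : ℕ → ℕ} {e j : ℕ}
    (h : GreedyInv cnt pos M st c p e j) (hM : M < (c e + cnt j : ℕ)) :
    GreedyInv cnt pos M (Function.update st (e + 1 + 1) (j + 1))
      (Function.update c (e + 1) (cnt j)) (Function.update p (e + 1) (pos j)) (e + 1) (j + 1) := by
  obtain ⟨h1, h2, h3, h4, h5, h6, h7, h8⟩ := h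
  have hst : ∀ k, k ≤ e + 1 → Function.update st (e + 1 + 1) (j + 1) k = st k := fun k hk =>
    Function.update_of_ne (by omega) _ _
  have hst' : ∀ k, k ≤ e → Function.update st (e + 1 + 1) (j + 1) (k + 1) = st (k + 1) :=
    fun k hk => Function.update_of_ne (by omega) _ _
  have hlt := h3 e le_rfl
  have hce := h4 e le_rfl
  rw [h2] at hlt hce
  refine ⟨by rw [hst 0 (by omega), h1], by simp, fun k hk => ?_, fun k hk => ?_, fun k hk => ?_,
    fun k hk => ?_, ?_, fun he => ?_⟩
  · rcases Nat.le_succ_iff.1 hk with hk' | rfl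
    · rw [hst k hk, hst' k hk']; exact h3 k hk'
    · rw [hst _ hk, Function.update_self, h2]; omega
  · rcases Nat.le_succ_iff.1 hk with hk' | rfl
    · rw [hst k hk, hst' k hk', Function.update_of_ne (by omega)]; exact h4 k hk'
    · rw [hst _ hk, Function.update_self, Function.update_self, h2]; simp
  · rcases Nat.le_succ_iff.1 hk with hk' | rfl
    · rw [hst k hk, hst' k hk', Function.update_of_ne (by omega)]; exact h5 k hk'
    · rw [hst _ hk, Function.update_self, Function.update_self, h2]; simp
  · rcases Nat.le_succ_iff.1 hk with hk' | rfl
    · rw [hst k hk, hst' k hk', Function.update_of_ne (by omega)]; exact h6 k hk'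
    · left; rw [hst _ hk, Function.update_self, h2]
  · rw [hst _ le_rfl, Function.update_self, h2,
      ← Finset.sum_range_add_sum_Ico _ hlt.le, ← hce]
    push_cast at h7 hM ⊢
    linarith
  · rw [← Finset.sum_range_add_sum_Ico _ (by omega : st e ≤ j + 1),
      Finset.sum_Ico_succ_top hlt.le, ← hce]
    have : (0 : ℝ) < (c e + cnt j : ℕ) := hM0.trans_lt hM
    have : 0 < c e + cnt j := by exact_mod_cast this
    omega

/-- Merge the atoms greedily: the integer arrays `32`, `33` and `34` receive the first atoms of the
buckets, the numbers of points and the numbers of positive labels in them. -/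
def mergeAtoms : Prog :=
  .seq (.assign 32 (.lit 0))
  (.seq (.setNat 32 (.lit 1) (.lit 1))
  (.seq (.assign 33 (.var 30))
  (.seq (.assign 34 (.var 31))
  (.seq (.assign 26 (.lit 0))
  (.seq (.assign 13 (.lit 1))
  (.loop (.natLt (.var 13) (.add (.add (.var 19) (.var 19)) (.lit 1)))
    (.seq
      (.ite (.realLt (.mul (.get 1 (.lit 0)) (.ofNat (.var 0)))
          (.ofNat (.add (.get 33 (.var 26)) (.get 30 (.var 13)))))
        (.seq (.incr 26)
          (.seq (.setNat 33 (.var 26) (.get 30 (.var 13)))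
            (.setNat 34 (.var 26) (.get 31 (.var 13)))))
        (.seq (.setNat 33 (.var 26) (.add (.get 33 (.var 26)) (.get 30 (.var 13))))
            (.setNat 34 (.var 26) (.add (.get 34 (.var 26)) (.get 31 (.var 13))))))
    (.seq (.setNat 32 (.add (.var 26) (.lit 1)) (.add (.var 13) (.lit 1)))
      (.incr 13)))))))))

lemma ends_mergeAtoms {s : Mem} {m N : ℕ} {η : ℝ} (hη0 : 0 < η) (h0 : s.nat 0 0 = m)
    (h19 : s.nat 19 0 = N) (hη : s.real 1 0 = η) :
    Ends mergeAtoms s (14 * N + 7) fun s' =>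
      GreedyInv (s.nat 30) (s.nat 31) (η * m) (s'.nat 32) (s'.nat 33) (s'.nat 34) (s'.nat 26 0)
        (2 * N + 1) := by
  refine Ends.mono (n := 1 + (1 + (1 + (1 + (1 + (1 + (14 * N + 1))))))) (Ends.seq (Ends.setNat
    (Ends.seq (Ends.setNat (Ends.seq (Ends.setNat (Ends.seq (Ends.setNat (Ends.seq (Ends.setNat
    (Ends.seq (Ends.setNat ?_)))))))))))) (by omega) (fun _ h => h)
  set s₀ := (((((s.setNat 32 _ _).setNat 32 _ _).setNat 33 _ _).setNat 34 _ _).setNat 26 _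
    _).setNat 13 _ _ with hs₀
  have k0 : s₀.nat 0 0 = m := by simpa [hs₀] using h0
  have k19 : s₀.nat 19 0 = N := by simpa [hs₀] using h19
  have k13 : s₀.nat 13 0 = 1 := by simp [hs₀, NExp.eval]
  have k26 : s₀.nat 26 0 = 0 := by simp [hs₀, NExp.eval]
  have k30 : s₀.nat 30 = s.nat 30 := by simp [hs₀]
  have k31 : s₀.nat 31 = s.nat 31 := by simp [hs₀]
  have k32 : s₀.nat 32 0 = 0 := by simp [hs₀, NExp.eval]
  have k32' : s₀.nat 32 1 = 1 := by simp [hs₀, NExp.eval]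
  have k33 : s₀.nat 33 0 = s.nat 30 0 := by simp [hs₀, NExp.eval]
  have k34 : s₀.nat 34 0 = s.nat 31 0 := by simp [hs₀, NExp.eval]
  have kη : s₀.real 1 0 = η := hη
  have hM0 : 0 ≤ η * m := by positivity
  clear_value s₀
  refine Ends.mono (Ends.loop
    (fun s' => s'.nat 13 0 ≤ 2 * N + 1 ∧ GreedyInv (s.nat 30) (s.nat 31) (η * m) (s'.nat 32)
      (s'.nat 33) (s'.nat 34) (s'.nat 26 0) (s'.nat 13 0))
    (fun s' => 7 * (2 * N + 1 - s'.nat 13 0)) ⟨by omega, ?_⟩ ?_) (by omega) ?_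
  · rw [k13, k26]
    refine ⟨k32, k32', ?_, ?_, ?_, ?_, ?_, ?_⟩ <;> simp [k32, k32', k33, k34]
  · rintro s' ⟨hj, hI⟩ hF ht
    have e0 : s'.nat 0 0 = m := by rw [hF.nat 0 (by simp [Prog.KeepsNat]), k0]
    have e19 : s'.nat 19 0 = N := by rw [hF.nat 19 (by simp [Prog.KeepsNat]), k19]
    have e30 : s'.nat 30 = s.nat 30 := by rw [hF.nat 30 (by simp [Prog.KeepsNat]), k30]
    have e31 : s'.nat 31 = s.nat 31 := by rw [hF.nat 31 (by simp [Prog.KeepsNat]), k31]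
    have eη : s'.real 1 0 = η := by rw [hF.real 1 (by simp [Prog.KeepsReal]), kη]
    simp only [Test.holds, NExp.eval, e19] at ht
    refine ⟨(3 + 1) + (1 + 1), Ends.seq (n := 3 + 1) (Ends.ite (n := 3) (fun hc => ?_)
      fun hc => ?_)⟩
    · simp only [Test.holds, NExp.eval, RExp.eval, e0, eη, e30] at hc
      refine Ends.seq (n := 1) (k := 2) (Ends.setNat (Ends.seq (n := 1) (k := 1)
        (Ends.setNat (Ends.setNat (Ends.seq (Ends.setNat (Ends.setNat ?_)))))))
      simp only [NExp.eval, Mem.setNat_nat, if_true, Nat.reduceEqDiff, if_false,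
        Function.update_self, e30, e31]
      exact ⟨⟨by omega, hI.new hM0 hc⟩, by omega⟩
    · simp only [Test.holds, NExp.eval, RExp.eval, e0, eη, e30, not_lt] at hc
      refine Ends.mono (n := 2) (Ends.seq (n := 1) (k := 1)
        (Ends.setNat (Ends.setNat (Ends.seq (Ends.setNat (Ends.setNat ?_)))))) (by omega)
        (fun _ h => h)
      simp only [NExp.eval, Mem.setNat_nat, if_true, Nat.reduceEqDiff, if_false,
        Function.update_self, e30, e31]
      exact ⟨⟨by omega, hI.extend hc⟩, by omega⟩
  · rintro s' ⟨⟨hj, hI⟩, hF, ht⟩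
    have e19 : s'.nat 19 0 = N := by rw [hF.nat 19 (by simp [Prog.KeepsNat]), k19]
    simp only [Test.holds, NExp.eval, e19, not_lt] at ht
    have : s'.nat 13 0 = 2 * N + 1 := by omega
    rwa [this] at hI

/-! ### Writing the buckets -/

/-- The left end point of a bucket that starts at the atom `a`. -/
noncomputable def leftEnd (q : ℕ → ℝ) (a : ℕ) : ℝ := if 0 < a then q ((a - 1) / 2) else 0

/-- Nonzero if the left end point of a bucket that starts at the atom `a` belongs to it. -/
def leftClosed (a : ℕ) : ℕ := if 0 < a then a - (a / 2 + a / 2) else 1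

/-- The right end point of a bucket that ends before the atom `a`. -/
noncomputable def rightEnd (q : ℕ → ℝ) (N a : ℕ) : ℝ :=
  if a < 2 * N + 1 then q ((a - 1) / 2) else 1

/-- Nonzero if the right end point of a bucket that ends before the atom `a` belongs to it. -/
def rightClosed (N a : ℕ) : ℕ :=
  if a < 2 * N + 1 then (a - 1) - ((a - 1) / 2 + (a - 1) / 2) else 1

/-- An odd atom `2 i + 1` is the point `q i`, so a bucket starting there is closed; a bucket
starting at `2 i + 2` begins just after `q i`. Both give `(a - 1) / 2 = i`, and the parity of `a` is
the closedness flag. -/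
lemma leftEnd_iff {q : ℕ → ℝ} {N : ℕ} (hq : ∀ x y, x < y → y < N → q x < q y) {a : ℕ}
    (ha : a ≤ 2 * N) {p : ℝ} (hp : 0 ≤ p) :
    (leftEnd q a < p ∨ (leftClosed a ≠ 0 ∧ leftEnd q a = p)) ↔ a ≤ atomIndex q N p := by
  rcases Nat.eq_zero_or_pos a with rfl | hpos
  · simpa [leftEnd, leftClosed] using hp.lt_or_eq
  rw [leftEnd, leftClosed, if_pos hpos, if_pos hpos]
  rcases Nat.even_or_odd' (a - 1) with ⟨i, hi | hi⟩
  · obtain rfl : a = 2 * i + 1 := by omega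
    rw [odd_le_atomIndex_iff hq, show (2 * i + 1 - 1) / 2 = i by omega,
      show 2 * i + 1 - ((2 * i + 1) / 2 + (2 * i + 1) / 2) = 1 by omega, le_iff_lt_or_eq]
    simp [show i < N by omega]
  · obtain rfl : a = 2 * i + 2 := by omega
    rw [even_le_atomIndex_iff hq, show (2 * i + 2 - 1) / 2 = i by omega,
      show 2 * i + 2 - ((2 * i + 2) / 2 + (2 * i + 2) / 2) = 0 by omega]
    simp [show i < N by omega]

lemma rightEnd_iff {q : ℕ → ℝ} {N : ℕ} (hq : ∀ x y, x < y → y < N → q x < q y) {a : ℕ}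
    (ha0 : 0 < a) (ha : a ≤ 2 * N + 1) {p : ℝ} (hp : p ≤ 1) :
    (p < rightEnd q N a ∨ (rightClosed N a ≠ 0 ∧ p = rightEnd q N a)) ↔ atomIndex q N p < a := by
  rcases ha.lt_or_eq with hlt | rfl
  · rw [rightEnd, rightClosed, if_pos hlt, if_pos hlt]
    rcases Nat.even_or_odd' (a - 1) with ⟨i, hi | hi⟩
    · obtain rfl : a = 2 * i + 1 := by omega
      rw [← not_le (a := 2 * i + 1), odd_le_atomIndex_iff hq, show (2 * i + 1 - 1) / 2 = i by omega,
        show 2 * i + 1 - 1 - (i + i) = 0 by omega]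
      simp [show i < N by omega]
    · obtain rfl : a = 2 * i + 2 := by omega
      rw [← not_le (a := 2 * i + 2), even_le_atomIndex_iff hq, show (2 * i + 2 - 1) / 2 = i by omega,
        show 2 * i + 2 - 1 - (i + i) = 1 by omega]
      simp [show i < N by omega, le_iff_lt_or_eq]
  · have := atomIndex_le hq (p := p)
    simp only [rightEnd, rightClosed, lt_irrefl, if_false]
    simp only [ne_eq, one_ne_zero, not_false_eq_true, true_and, ← le_iff_lt_or_eq, hp, true_iff]
    omega

/-- Write the end points and the means of the buckets to the output arrays. -/
def writeBuckets : Prog :=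
  .seq (.assign 2 (.add (.var 26) (.lit 1)))
  (.seq (.assign 13 (.lit 0))
  (.loop (.natLt (.var 13) (.var 2))
    (.seq
      (.ite (.natLt (.lit 0) (.get 32 (.var 13)))
        (.seq (.setReal 2 (.var 13) (.get 7 (.half (.sub (.get 32 (.var 13)) (.lit 1)))))
          (.setNat 3 (.var 13) (.sub (.get 32 (.var 13))
            (.add (.half (.get 32 (.var 13))) (.half (.get 32 (.var 13)))))))
        (.seq (.setReal 2 (.var 13) (.ofNat (.lit 0))) (.setNat 3 (.var 13) (.lit 1))))
    (.seq
      (.ite (.natLt (.get 32 (.add (.var 13) (.lit 1))) (.add (.add (.var 19) (.var 19)) (.lit 1)))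
        (.seq (.setReal 3 (.var 13)
            (.get 7 (.half (.sub (.get 32 (.add (.var 13) (.lit 1))) (.lit 1)))))
          (.setNat 4 (.var 13) (.sub (.sub (.get 32 (.add (.var 13) (.lit 1))) (.lit 1))
            (.add (.half (.sub (.get 32 (.add (.var 13) (.lit 1))) (.lit 1)))
              (.half (.sub (.get 32 (.add (.var 13) (.lit 1))) (.lit 1)))))))
        (.seq (.setReal 3 (.var 13) (.ofNat (.lit 1))) (.setNat 4 (.var 13) (.lit 1))))
    (.seq (.setReal 4 (.var 13) (.div (.ofNat (.get 34 (.var 13))) (.ofNat (.get 33 (.var 13)))))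
      (.incr 13))))))

/-- The entries with index `k` of the output arrays are correct. -/
def Written (q : ℕ → ℝ) (N : ℕ) (st c p : ℕ → ℕ) (s : Mem) (k : ℕ) : Prop :=
  s.real 2 k = leftEnd q (st k) ∧ s.nat 3 k = leftClosed (st k) ∧
  s.real 3 k = rightEnd q N (st (k + 1)) ∧ s.nat 4 k = rightClosed N (st (k + 1)) ∧
  s.real 4 k = p k / c k

lemma ends_writeBuckets {s : Mem} {N e : ℕ} (h19 : s.nat 19 0 = N) (h26 : s.nat 26 0 = e) :
    Ends writeBuckets s (9 * (e + 1) + 3) fun s' => s'.nat 2 0 = e + 1 ∧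
      ∀ k, k ≤ e → Written (s.real 7) N (s.nat 32) (s.nat 33) (s.nat 34) s' k := by
  refine Ends.mono (n := 1 + (1 + (9 * (e + 1) + 1))) (Ends.seq (Ends.setNat (Ends.seq
    (Ends.setNat ?_)))) (by omega) (fun _ h => h)
  set s₀ := (s.setNat 2 _ _).setNat 13 _ _ with hs₀
  have k2 : s₀.nat 2 0 = e + 1 := by simp [hs₀, NExp.eval, h26]
  have k13 : s₀.nat 13 0 = 0 := by simp [hs₀, NExp.eval]
  have k19 : s₀.nat 19 0 = N := by simpa [hs₀] using h19
  have k32 : s₀.nat 32 = s.nat 32 := by simp [hs₀]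
  have k33 : s₀.nat 33 = s.nat 33 := by simp [hs₀]
  have k34 : s₀.nat 34 = s.nat 34 := by simp [hs₀]
  have kr : s₀.real = s.real := rfl
  clear_value s₀
  refine Ends.mono (Ends.loop
    (fun s' => ∀ k, k < s'.nat 13 0 →
      Written (s.real 7) N (s.nat 32) (s.nat 33) (s.nat 34) s' k)
    (fun s' => 9 * (e + 1 - s'.nat 13 0)) (by rw [k13]; omega) ?_) (by omega) ?_
  · rintro s' hI hF ht
    have e2 : s'.nat 2 0 = e + 1 := by rw [hF.nat 2 (by simp [Prog.KeepsNat]), k2]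
    have e19 : s'.nat 19 0 = N := by rw [hF.nat 19 (by simp [Prog.KeepsNat]), k19]
    have e32 : s'.nat 32 = s.nat 32 := by rw [hF.nat 32 (by simp [Prog.KeepsNat]), k32]
    have e33 : s'.nat 33 = s.nat 33 := by rw [hF.nat 33 (by simp [Prog.KeepsNat]), k33]
    have e34 : s'.nat 34 = s.nat 34 := by rw [hF.nat 34 (by simp [Prog.KeepsNat]), k34]
    have e7 : s'.real 7 = s.real 7 := by rw [hF.real 7 (by simp [Prog.KeepsReal]), kr]
    simp only [Test.holds, NExp.eval, e2] at ht
    have h2N : N + N + 1 = 2 * N + 1 := by ring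
    refine ⟨3 + (3 + (1 + 1)), Ends.seq (n := 3) (Ends.mono (n := 3) (Q := fun s₁ =>
      s₁.nat = Function.update s'.nat 3 (Function.update (s'.nat 3) (s'.nat 13 0)
        (leftClosed (s.nat 32 (s'.nat 13 0)))) ∧
      s₁.real = Function.update s'.real 2 (Function.update (s'.real 2) (s'.nat 13 0)
        (leftEnd (s.real 7) (s.nat 32 (s'.nat 13 0))))) ?_ le_rfl ?_)⟩
    · refine Ends.ite (n := 2) (fun hc => ?_) fun hc => ?_
      · simp only [Test.holds, NExp.eval, e32] at hc
        refine Ends.seq (n := 1) (k := 1) (Ends.setReal (Ends.setNat ⟨?_, ?_⟩))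
        · simp only [Mem.setNat, Mem.setReal, NExp.eval, e32, leftClosed, if_pos hc]
        · simp only [Mem.setNat, Mem.setReal, NExp.eval, RExp.eval, e32, e7, leftEnd, if_pos hc]
      · simp only [Test.holds, NExp.eval, e32] at hc
        refine Ends.seq (n := 1) (k := 1) (Ends.setReal (Ends.setNat ⟨?_, ?_⟩))
        · simp only [Mem.setNat, Mem.setReal, NExp.eval, leftClosed, if_neg hc]
        · simp only [Mem.setNat, Mem.setReal, NExp.eval, RExp.eval, leftEnd, if_neg hc,
            Nat.cast_zero]
    rintro s₁ ⟨hn₁, hr₁⟩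
    refine Ends.seq (n := 3) (Ends.mono (n := 3) (Q := fun s₂ =>
      s₂.nat = Function.update s₁.nat 4 (Function.update (s₁.nat 4) (s'.nat 13 0)
        (rightClosed N (s.nat 32 (s'.nat 13 0 + 1)))) ∧
      s₂.real = Function.update s₁.real 3 (Function.update (s₁.real 3) (s'.nat 13 0)
        (rightEnd (s.real 7) N (s.nat 32 (s'.nat 13 0 + 1))))) ?_ le_rfl ?_)
    · have f13 : s₁.nat 13 = s'.nat 13 := by rw [hn₁]; simp
      have f19 : s₁.nat 19 0 = N := by rw [hn₁]; simpa using e19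
      have f32 : s₁.nat 32 = s.nat 32 := by rw [hn₁]; simpa using e32
      have f7 : s₁.real 7 = s.real 7 := by rw [hr₁]; simpa using e7
      refine Ends.ite (n := 2) (fun hc => ?_) fun hc => ?_
      · simp only [Test.holds, NExp.eval, f32, f13, f19, h2N] at hc
        refine Ends.seq (n := 1) (k := 1) (Ends.setReal (Ends.setNat ⟨?_, ?_⟩))
        · simp only [Mem.setNat, Mem.setReal, NExp.eval, f32, f13, rightClosed, if_pos hc]
        · simp only [Mem.setNat, Mem.setReal, NExp.eval, RExp.eval, f32, f13, f7, rightEnd,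
            if_pos hc]
      · simp only [Test.holds, NExp.eval, f32, f13, f19, h2N] at hc
        refine Ends.seq (n := 1) (k := 1) (Ends.setReal (Ends.setNat ⟨?_, ?_⟩))
        · simp only [Mem.setNat, Mem.setReal, NExp.eval, f13, rightClosed, if_neg hc]
        · simp only [Mem.setNat, Mem.setReal, NExp.eval, RExp.eval, f13, rightEnd, if_neg hc,
            Nat.cast_one]
    rintro s₂ ⟨hn₂, hr₂⟩
    have g13 : s₂.nat 13 0 = s'.nat 13 0 := by rw [hn₂, hn₁]; simp
    have g33 : s₂.nat 33 = s.nat 33 := by rw [hn₂, hn₁]; simpa using e33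
    have g34 : s₂.nat 34 = s.nat 34 := by rw [hn₂, hn₁]; simpa using e34
    refine Ends.seq (Ends.setReal (Ends.setNat ?_))
    simp only [Written, NExp.eval, RExp.eval, Mem.setNat_nat, Mem.setNat_real, Mem.setReal_nat,
      Mem.setReal_real, if_true, Nat.reduceEqDiff, if_false, Function.update_self, g13, g33, g34]
    refine ⟨fun k hk => ?_, by omega⟩
    rw [hn₂, hr₂, hn₁, hr₁]
    rcases Nat.lt_succ_iff_lt_or_eq.1 hk with hk | rfl
    · have := hI k hk
      rw [Written] at this
      simpa [Function.update_apply, hk.ne] using this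
    · simp
  · rintro s' ⟨hI, hF, ht⟩
    have e2 : s'.nat 2 0 = e + 1 := by rw [hF.nat 2 (by simp [Prog.KeepsNat]), k2]
    simp only [Test.holds, NExp.eval, e2, not_lt] at ht
    exact ⟨e2, fun k hk => hI k (by omega)⟩

end RealRAM

namespace RealRAM

/-! ### Correctness of the buckets -/

/-- The points whose atom has an index in `[a, b)`. -/
def atomRange (q : ℕ → ℝ) (N a b : ℕ) : Set unitInterval :=
  {p | a ≤ atomIndex q N p ∧ atomIndex q N p < b}

lemma ordConnected_atomRange (q : ℕ → ℝ) (N a b : ℕ) : (atomRange q N a b).OrdConnected := by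
  refine ⟨fun x hx y hy z hz => ⟨hx.1.trans ?_, lt_of_le_of_lt ?_ hy.2⟩⟩
  · exact monotone_atomIndex q N (show (x : ℝ) ≤ z from hz.1)
  · exact monotone_atomIndex q N (show (z : ℝ) ≤ y from hz.2)

lemma sum_Ico_sum_range_ite {m : ℕ} (f v : ℕ → ℕ) (a b : ℕ) :
    ∑ j ∈ Finset.Ico a b, ∑ x ∈ Finset.range m, (if f x = j then v x else 0) =
      ∑ i : Fin m, if a ≤ f i ∧ f i < b then v i else 0 := by
  rw [Finset.sum_comm, Finset.sum_range]
  refine Finset.sum_congr rfl fun i _ => ?_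
  rw [Finset.sum_ite_eq]
  simp only [Finset.mem_Ico]

lemma bucketCount_atomRange {m : ℕ} (S : Fin m → unitInterval × Bool) {X : ℕ → ℝ}
    (hX : ∀ i : Fin m, X i = (S i).1) (q : ℕ → ℝ) (N a b : ℕ) :
    bucketCount S (atomRange q N a b) = ∑ j ∈ Finset.Ico a b, ∑ x ∈ Finset.range m,
      if atomIndex q N (X x) = j then 1 else 0 := by
  classical
  rw [sum_Ico_sum_range_ite (fun x => atomIndex q N (X x)) (fun _ => 1), bucketCount,
    Finset.card_filter]
  refine Finset.sum_congr rfl fun i _ => ?_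
  simp only [atomRange, Set.mem_ofPred_eq, hX]
  congr

lemma bucketPositives_atomRange {m : ℕ} (S : Fin m → unitInterval × Bool) {X : ℕ → ℝ}
    {Y : ℕ → ℕ} (hX : ∀ i : Fin m, X i = (S i).1)
    (hY : ∀ i : Fin m, Y i = if (S i).2 = true then 1 else 0) (q : ℕ → ℝ) (N a b : ℕ) :
    bucketPositives S (atomRange q N a b) = ∑ j ∈ Finset.Ico a b, ∑ x ∈ Finset.range m,
      if atomIndex q N (X x) = j then Y x else 0 := by
  classical
  rw [sum_Ico_sum_range_ite (fun x => atomIndex q N (X x)) Y, bucketPositives,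
    Finset.card_filter]
  refine Finset.sum_congr rfl fun i _ => ?_
  simp only [atomRange, Set.mem_ofPred_eq, hX, hY]
  rw [← ite_and]
  congr

lemma GreedyInv.mono {cnt pos : ℕ → ℕ} {M : ℝ} {st c p : ℕ → ℕ} {e j : ℕ}
    (h : GreedyInv cnt pos M st c p e j) {k k' : ℕ} (hk : k ≤ k') (hk' : k' ≤ e + 1) :
    st k ≤ st k' := by
  induction k', hk using Nat.le_induction with
  | base => rfl
  | succ n hn ih => exact (ih (by omega)).trans (h.lt n (by omega)).le

lemma GreedyInv.le_start {cnt pos : ℕ → ℕ} {M : ℝ} {st c p : ℕ → ℕ} {e j : ℕ}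
    (h : GreedyInv cnt pos M st c p e j) {k : ℕ} (hk : k ≤ e + 1) : k ≤ st k := by
  induction k with
  | zero => exact Nat.zero_le _
  | succ n ih =>
    have := ih (by omega)
    have := h.lt n (by omega)
    omega

lemma GreedyInv.exists_bucket {cnt pos : ℕ → ℕ} {M : ℝ} {st c p : ℕ → ℕ} {e j : ℕ}
    (h : GreedyInv cnt pos M st c p e j) {v : ℕ} (hv : v < j) :
    ∃ k, k ≤ e ∧ st k ≤ v ∧ v < st (k + 1) := by
  classical
  have hex : ∃ k, v < st (k + 1) := ⟨e, by rwa [h.last]⟩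
  refine ⟨Nat.find hex, Nat.find_min' hex (by rwa [h.last]), ?_, Nat.find_spec hex⟩
  rcases Nat.eq_zero_or_pos (Nat.find hex) with h0 | h0
  · rw [h0, h.zero]; exact Nat.zero_le _
  · have := Nat.find_min hex (Nat.sub_lt h0 one_pos)
    rwa [show Nat.find hex - 1 + 1 = Nat.find hex by omega, not_lt] at this

section Partition

variable {m : ℕ} {S : Fin m → unitInterval × Bool} {X : ℕ → ℝ} {q : ℕ → ℝ} {N : ℕ} {η : ℝ}
  {pos st c p : ℕ → ℕ} {e : ℕ}

lemma isUniformMassPartition_atomRange (hη : 0 < η) (hX : ∀ i : Fin m, X i = (S i).1)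
    (hq : ∀ x y, x < y → y < N → q x < q y)
    (hgap : ∀ G : Set ℝ, G.OrdConnected → (∀ x, x < N → q x ∉ G) → (occ X 0 m G : ℝ) ≤ η * m)
    (h : GreedyInv (fun j => ∑ x ∈ Finset.range m, if atomIndex q N (X x) = j then 1 else 0) pos
      (η * m) st c p e (2 * N + 1)) :
    IsUniformMassPartition S η fun k : Fin (e + 1) => atomRange q N (st k) (st (k + 1)) := by
  classical
  have hcount : ∀ k, k ≤ e → bucketCount S (atomRange q N (st k) (st (k + 1))) = c k :=
    fun k hk => by rw [bucketCount_atomRange S hX, h.cnt_eq k hk]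
  refine ⟨fun k => ordConnected_atomRange _ _ _ _, ?_, ?_, ?_, ?_⟩
  · have key : ∀ k k' : Fin (e + 1), k < k' → Disjoint (atomRange q N (st k) (st (k + 1)))
        (atomRange q N (st k') (st (k' + 1))) := fun k k' hk => by
      rw [Set.disjoint_left]
      intro x hx hx'
      have := h.mono (k := k + 1) (k' := k') hk (by omega)
      exact absurd (hx.2.trans_le (this.trans hx'.1)) (lt_irrefl _)
    intro k k' hk
    rcases lt_or_gt_of_ne hk with h' | h'
    · exact key k k' h'
    · exact (key k' k h').symm
  · refine Set.eq_univ_of_forall fun x => ?_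
    obtain ⟨k, hk, h1, h2⟩ := h.exists_bucket (v := atomIndex q N x)
      (Nat.lt_succ_of_le (atomIndex_le hq))
    exact Set.mem_iUnion.2 ⟨⟨k, by omega⟩, h1, h2⟩
  -- From `e η m ≤ 2 m`, by the counting invariant; the last bucket is the extra one.
  · push_cast
    gcongr
    rw [le_div_iff₀ hη]
    rcases Nat.eq_zero_or_pos e with he | he
    · rw [he]; push_cast; linarith
    set cnt : ℕ → ℕ := fun j => ∑ x ∈ Finset.range m, if atomIndex q N (X x) = j then 1 else 0
    have htot : ∑ j ∈ Finset.range (2 * N + 1), cnt j ≤ m := by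
      rw [Finset.range_eq_Ico, sum_Ico_sum_range_ite (fun x => atomIndex q N (X x)) (fun _ => 1)]
      refine (Finset.sum_le_card_nsmul _ _ 1 fun i _ => ?_).trans (by simp)
      split_ifs <;> omega
    have hm : 0 < m := (h.nonempty he).trans_le htot
    have hm' : (0 : ℝ) < m := by exact_mod_cast hm
    have hlast : st (e + 1) = 2 * N + 1 := h.last
    have hsplit : ∑ x ∈ Finset.range (st e), cnt x + c e ≤ m := by
      rw [h.cnt_eq e le_rfl, Finset.sum_range_add_sum_Ico _ (h.lt e le_rfl).le, hlast]
      exact htot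
    have hcard := h.card
    have h1 : ((∑ x ∈ Finset.range (st e), cnt x : ℕ) : ℝ) + c e ≤ m := by exact_mod_cast hsplit
    have h2 : (0 : ℝ) ≤ c e := Nat.cast_nonneg _
    have h3 : (e * η) * m ≤ 2 * m := by nlinarith
    exact le_of_mul_le_mul_right h3 hm'
  · intro k
    have hk : (k : ℕ) ≤ e := Nat.lt_succ_iff.1 k.2
    rcases h.small k hk with hs | hs
    -- Nothing assumed here places the separators in [0,1], so a one-atom bucket may be empty; it
    -- then counts as small.
    · rcases (atomRange q N (st k) (st (k + 1))).eq_empty_or_nonempty with hempty | ⟨a, ha⟩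
      · left
        rw [hempty]
        simp only [bucketCount, Set.mem_empty_iff_false, Finset.filter_false, Finset.card_empty,
          Nat.cast_zero]
        positivity
      rw [hs] at ha ⊢
      -- A single even atom is a gap, hence small by `hgap`; a single odd atom is one point.
      rcases Nat.even_or_odd' (st k) with ⟨i, hi | hi⟩
      · left
        have hG := hgap {x : ℝ | atomIndex q N x = 2 * i} ?_ ?_
        · refine le_trans (le_of_eq ?_) hG
          rw [bucketCount_atomRange S hX, occ_eq_sum, Nat.Ico_succ_singleton, Finset.sum_singleton,
            hi, Finset.range_eq_Ico]
          simp only [Set.mem_ofPred_eq]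
          congr 2
          funext x
          congr
        · refine ⟨fun x hx y hy z hz => le_antisymm ?_ ?_⟩
          · exact (monotone_atomIndex q N hz.2).trans (le_of_eq hy)
          · exact (le_of_eq hx.symm).trans (monotone_atomIndex q N hz.1)
        · intro x hx hxG
          have h1 := (odd_le_atomIndex_iff hq (p := q x) (i := x)).2 ⟨hx, le_rfl⟩
          have h2 : ¬ 2 * x + 2 ≤ atomIndex q N (q x) := fun h =>
            lt_irrefl _ ((even_le_atomIndex_iff hq).1 h).2
          rw [Set.mem_ofPred_eq] at hxG
          omega
      · right
        have huniq : ∀ x ∈ atomRange q N (st k) (st k + 1), (x : ℝ) = q i := by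
          intro x hx
          rw [hi] at hx
          have h1 := (odd_le_atomIndex_iff hq).1 hx.1
          have h2 : ¬ 2 * i + 2 ≤ atomIndex q N x := not_le.2 hx.2
          rw [even_le_atomIndex_iff hq, not_and, not_lt] at h2
          exact le_antisymm (h2 h1.1) h1.2
        refine ⟨a, Set.eq_singleton_iff_unique_mem.2 ⟨ha, fun x hx => Subtype.ext ?_⟩⟩
        rw [huniq x hx, huniq a ha]
    · left
      rw [hcount k hk]
      exact hs

end Partition

lemma bucketMean_mem_Icc {m : ℕ} (S : Fin m → unitInterval × Bool) (A : Set unitInterval) :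
    bucketMean S A ∈ unitInterval :=
  ⟨by unfold bucketMean; positivity,
    div_le_one_of_le₀ (by exact_mod_cast bucketPositives_le S A) (Nat.cast_nonneg _)⟩

lemma exists_piecewise_mean {m t : ℕ} {S : Fin m → unitInterval × Bool} {η : ℝ}
    {A : Fin t → Set unitInterval} (hA : IsUniformMassPartition S η A) :
    ∃ khat : unitInterval → unitInterval, IsUMBOutput S η khat ∧
      ∀ j, ∀ p ∈ A j, (khat p : ℝ) = bucketMean S (A j) := by
  classical
  have hval : ∀ j, ∀ p ∈ A j, (∑ i, if p ∈ A i then bucketMean S (A i) else 0) =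
      bucketMean S (A j) := by
    intro j p hp
    rw [Finset.sum_eq_single j]
    · rw [if_pos hp]
    · intro i _ hij
      exact if_neg fun hi => Set.disjoint_left.1 (hA.disjoint hij) hi hp
    · simp
  have hmem : ∀ p, (∑ i, if p ∈ A i then bucketMean S (A i) else 0) ∈ unitInterval := by
    intro p
    obtain ⟨j, hj⟩ := Set.mem_iUnion.1 (hA.cover.ge (Set.mem_univ p))
    rw [hval j p hj]
    exact bucketMean_mem_Icc S _
  exact ⟨fun p => ⟨_, hmem p⟩, ⟨t, A, hA, fun p => rfl⟩, hval⟩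

/-! ### The program -/

/-- Uniform-mass binning and recalibration. -/
def umbProgram : Prog :=
  .seq separators (.seq countAtoms (.seq mergeAtoms writeBuckets))

theorem ends_umbProgram {m H : ℕ} (S : Fin m → unitInterval × Bool) {η : ℝ} (hη0 : 0 < η)
    (hη1 : η < 1) (hH : 32 / η ≤ 2 ^ H) :
    Ends umbProgram (input S η)
      (70 * (m * (2 + H)) + 10 * m + 10 + (((4 * H + 9) * m + 2) + ((14 * ⌊4 / η⌋₊ + 7) +
        (9 * (2 * ⌊4 / η⌋₊ + 1) + 3))))
      fun s => ∃ khat, Describes s khat ∧ IsUMBOutput S η khat := by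
  classical
  have i0 : (input S η).nat 0 0 = m := by simp [input]
  have iη : (input S η).real 1 0 = η := by simp [input]
  have iX : ∀ i : Fin m, (input S η).real 0 i = (S i).1 := fun i => by simp [input]
  have iY : ∀ i : Fin m, (input S η).nat 1 i = if (S i).2 = true then 1 else 0 := fun i => by
    simp [input]
  have i30 : ∀ j, (input S η).nat 30 j = 0 := fun j => by simp [input]
  have i31 : ∀ j, (input S η).nat 31 j = 0 := fun j => by simp [input]
  set s₀ := input S η
  refine Ends.seq (Ends.mono (Ends.frame (ends_separators hη0 hη1 hH i0 iη)) le_rfl ?_)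
  rintro s₁ ⟨⟨hN, hq, hgap⟩, hF₁⟩
  set N := s₁.nat 19 0 with hNdef
  set q := s₁.real 7 with hqdef
  have hNle : N ≤ ⌊4 / η⌋₊ := Nat.le_floor hN
  have hsize : Nat.size N ≤ H := by
    rw [Nat.size_le]
    have h1 : (4 : ℝ) / η < 32 / η := by gcongr; norm_num
    exact_mod_cast (hN.trans_lt h1).trans_le hH
  have kn : ∀ a, separators.KeepsNat a → s₁.nat a = s₀.nat a := hF₁.nat
  have kr : ∀ a, separators.KeepsReal a → s₁.real a = s₀.real a := hF₁.real
  have a0 : s₁.nat 0 0 = m := by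
    rw [kn 0 (by simp [Prog.KeepsNat, separators, copyPoints, coarsen, coarsenRound, mergePass,
      mergeRuns, decimate, pickStride, collectSeparators]), i0]
  have a1 : s₁.nat 1 = s₀.nat 1 := kn 1 (by simp [Prog.KeepsNat, separators, copyPoints, coarsen,
    coarsenRound, mergePass, mergeRuns, decimate, pickStride, collectSeparators])
  have a30 : s₁.nat 30 = s₀.nat 30 := kn 30 (by simp [Prog.KeepsNat, separators, copyPoints,
    coarsen, coarsenRound, mergePass, mergeRuns, decimate, pickStride, collectSeparators])
  have a31 : s₁.nat 31 = s₀.nat 31 := kn 31 (by simp [Prog.KeepsNat, separators, copyPoints,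
    coarsen, coarsenRound, mergePass, mergeRuns, decimate, pickStride, collectSeparators])
  have aX : s₁.real 0 = s₀.real 0 := kr 0 (by simp [Prog.KeepsReal, separators, copyPoints,
    coarsen, coarsenRound, mergePass, mergeRuns, decimate, pickStride, collectSeparators])
  have aη : s₁.real 1 0 = η := by
    rw [kr 1 (by simp [Prog.KeepsReal, separators, copyPoints, coarsen, coarsenRound, mergePass,
      mergeRuns, decimate, pickStride, collectSeparators]), iη]
  refine Ends.seq (Ends.mono (Ends.frame (ends_countAtoms hq a0 hNdef.symm
    (by rw [a30]; exact i30) (by rw [a31]; exact i31))) (by gcongr) ?_)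
  rintro s₂ ⟨⟨hcnt, hpos⟩, hF₂⟩
  rw [← hqdef, aX] at hcnt hpos
  rw [a1] at hpos
  have b0 : s₂.nat 0 0 = m := by
    rw [hF₂.nat 0 (by simp [Prog.KeepsNat, countAtoms, binarySearch]), a0]
  have b19 : s₂.nat 19 0 = N := by
    rw [hF₂.nat 19 (by simp [Prog.KeepsNat, countAtoms, binarySearch])]
  have b7 : s₂.real 7 = q := by
    rw [hF₂.real 7 (by simp [Prog.KeepsReal, countAtoms, binarySearch])]
  have bη : s₂.real 1 0 = η := by
    rw [hF₂.real 1 (by simp [Prog.KeepsReal, countAtoms, binarySearch]), aη]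
  refine Ends.seq (Ends.mono (Ends.frame (ends_mergeAtoms hη0 b0 b19 bη)) (by omega) ?_)
  rintro s₃ ⟨hI, hF₃⟩
  rw [funext hcnt, funext hpos] at hI
  set e := s₃.nat 26 0 with he
  have hele : e + 1 ≤ 2 * N + 1 := by
    rw [← hI.last]; exact hI.le_start le_rfl
  have c19 : s₃.nat 19 0 = N := by
    rw [hF₃.nat 19 (by simp [Prog.KeepsNat, mergeAtoms]), b19]
  have c7 : s₃.real 7 = q := by
    rw [hF₃.real 7 (by simp [Prog.KeepsReal, mergeAtoms]), b7]
  refine Ends.mono (ends_writeBuckets c19 he.symm) (by omega) ?_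
  rintro s₄ ⟨d2, hW⟩
  rw [c7] at hW
  have hpart := isUniformMassPartition_atomRange hη0 iX hq hgap hI
  obtain ⟨khat, hkhat, hmean⟩ := exists_piecewise_mean hpart
  refine ⟨khat, fun p => ?_, hkhat⟩
  have hout : ∀ k, k ≤ e → outInterval s₄ k =
      atomRange q N (s₃.nat 32 k) (s₃.nat 32 (k + 1)) := by
    intro k hk
    obtain ⟨w1, w2, w3, w4, -⟩ := hW k hk
    have hl := hI.lt k hk
    have hle : s₃.nat 32 (k + 1) ≤ 2 * N + 1 := by
      rw [← hI.last]; exact hI.mono (by omega) le_rfl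
    ext p
    rw [outInterval, atomRange, Set.mem_ofPred_eq, Set.mem_ofPred_eq, w1, w2, w3, w4,
      leftEnd_iff hq (by omega) p.2.1, rightEnd_iff hq (by omega) hle p.2.2]
  obtain ⟨j, hj⟩ := Set.mem_iUnion.1 (hpart.cover.ge (Set.mem_univ p))
  have hjle : (j : ℕ) ≤ e := Nat.lt_succ_iff.1 j.2
  rw [hmean j p hj, d2, Finset.sum_eq_single (j : ℕ)]
  · rw [hout j hjle, if_pos hj, (hW j hjle).2.2.2.2, bucketMean, bucketCount_atomRange S iX,
      bucketPositives_atomRange S iX iY, hI.cnt_eq j hjle, hI.pos_eq j hjle]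
  · intro k hk hkj
    have hk' : k ≤ e := Nat.lt_succ_iff.1 (Finset.mem_range.1 hk)
    rw [hout k hk', if_neg]
    intro hp
    exact Set.disjoint_left.1 (hpart.disjoint (i := ⟨k, by omega⟩) (j := j)
      (fun h => hkj (congrArg Fin.val h))) hp hj
  · intro h
    exact absurd (Finset.mem_range.2 j.2) h

theorem exists_performsUMB {m H : ℕ} (S : Fin m → unitInterval × Bool) {η : ℝ} (hη0 : 0 < η)
    (hη1 : η < 1) (hH : 32 / η ≤ 2 ^ H) :
    ∃ n : ℕ, PerformsUMB umbProgram S η n ∧ (n : ℝ) ≤ (74 * H + 160) * m + 128 / η + 32 := by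
  obtain ⟨s, n, h1, h2, khat, h3, h4⟩ := ends_umbProgram S hη0 hη1 hH
  refine ⟨n, ⟨s, khat, h1, h3, h4⟩, ?_⟩
  have h5 : (n : ℝ) ≤ _ := Nat.cast_le.2 h2
  refine h5.trans ?_
  push_cast
  have h6 : (⌊4 / η⌋₊ : ℝ) ≤ 4 / η := Nat.floor_le (by positivity)
  have h7 : 128 / η = 32 * (4 / η) := by ring
  rw [h7]
  have h8 : (0 : ℝ) ≤ m := Nat.cast_nonneg m
  nlinarith

end RealRAM

/-! ### The main theorem -/

lemma sq_le_two_mul_two_pow (n : ℕ) : n * n ≤ 2 * 2 ^ n := by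
  induction n with
  | zero => norm_num
  | succ n ih =>
    have : n + 1 ≤ 2 ^ n := Nat.lt_two_pow_self
    rw [pow_succ]
    nlinarith

/-- The sample size carries a factor `H` and the running time another one; `H² = O(T)` is what
absorbs both. -/
lemma exists_log_scale {T : ℝ} (hT : 1 ≤ T) :
    ∃ H : ℕ, 256 * T ≤ 2 ^ H ∧ (1 : ℝ) ≤ H ∧ (H : ℝ) ^ 2 ≤ 1028 * T := by
  have h1 : 1 < ⌈256 * T⌉₊ := by
    rw [Nat.lt_ceil]; push_cast; linarith
  have h2 : ⌈256 * T⌉₊ ≤ 2 ^ Nat.clog 2 ⌈256 * T⌉₊ := Nat.le_pow_clog (by norm_num) _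
  have h3 := Nat.pow_pred_clog_lt_self (by norm_num : 1 < 2) h1
  have h4 : 0 < Nat.clog 2 ⌈256 * T⌉₊ := Nat.clog_pos (by norm_num) h1
  have h5 : (⌈256 * T⌉₊ : ℝ) < 256 * T + 1 := Nat.ceil_lt_add_one (by linarith)
  refine ⟨Nat.clog 2 ⌈256 * T⌉₊, ?_, by exact_mod_cast h4, ?_⟩
  · exact (Nat.le_ceil _).trans (by exact_mod_cast h2)
  · obtain ⟨k, hk⟩ : ∃ k, Nat.clog 2 ⌈256 * T⌉₊ = k + 1 := ⟨_, (Nat.succ_pred h4.ne').symm⟩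
    rw [hk] at h3 ⊢
    rw [Nat.pred_succ] at h3
    have h6 : ((k + 1) * (k + 1) : ℝ) ≤ 2 * 2 ^ (k + 1) := by
      exact_mod_cast sq_le_two_mul_two_pow (k + 1)
    have h7 : (2 : ℝ) ^ k < ⌈256 * T⌉₊ := by exact_mod_cast h3
    push_cast
    rw [pow_succ] at h6
    nlinarith

theorem mainTheorem6 :
    ∃ (C : ℝ) (c : RealRAM.Prog), 0 < C ∧
      (∀ (m : ℕ) (S : Fin m → unitInterval × Bool) (η : ℝ), 0 < η → η < 1 →
        ∃ n : ℕ, RealRAM.PerformsUMB c S η n) ∧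
      ∀ (ε δ : ℝ) (r : ℕ), 0 < ε → ε < 1 → 0 < δ → δ < 1 → 1 ≤ r →
        (∀ m : ℕ, C * umbBound ε δ r ≤ (m : ℝ) → UMBLearns ε δ r m) ∧
        ∃ m : ℕ, (m : ℝ) ≤ C * umbBound ε δ r ∧ UMBLearns ε δ r m ∧
          ∀ S : Fin m → unitInterval × Bool, ∃ n : ℕ,
            RealRAM.PerformsUMB c S (ε / (8 * r)) n ∧ (n : ℝ) ≤ C * umbBound ε δ r := by
  -- The running time dominates: it is about `468 m₀ H`, and `468 * 1500000 * 2056` is below `1.5 *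
  -- 10 ^ 12`.
  refine ⟨2000000000000, RealRAM.umbProgram, by norm_num, fun m S η hη0 hη1 => ?_, ?_⟩
  · obtain ⟨H, hH⟩ := pow_unbounded_of_one_lt (32 / η) (by norm_num : (1 : ℝ) < 2)
    obtain ⟨n, hn, -⟩ := RealRAM.exists_performsUMB S hη0 hη1 hH.le
    exact ⟨n, hn⟩
  intro ε δ r hε hε1 hδ hδ1 hr
  have hr' : (1 : ℝ) ≤ r := by exact_mod_cast hr
  set T : ℝ := r / ε with hT
  set L : ℝ := max 1 (Real.log (1 / δ)) with hL
  have hT1 : 1 ≤ T := by rw [hT, le_div_iff₀ hε]; linarith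
  have hL1 : 1 ≤ L := le_max_left _ _
  have hB : umbBound ε δ r = T ^ 2 * L / ε ^ 2 := by
    rw [umbBound, hT, ← hL]; field_simp
  obtain ⟨H, hH, hH1, hH2⟩ := exists_log_scale hT1
  have hε2 : 0 < ε ^ 2 := by positivity
  have hε2' : ε ^ 2 ≤ 1 := pow_le_one₀ hε.le hε1.le
  set B := umbBound ε δ r with hBdef
  have hBT : ∀ x, x ≤ T ^ 2 * L → x / ε ^ 2 ≤ B := fun x hx => by rw [hB]; gcongr
  have hT2L : T ^ 2 ≤ T ^ 2 * L := le_mul_of_one_le_right (by positivity) hL1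
  have hTT : T ≤ T ^ 2 := by nlinarith
  have hTB : T ≤ B := by
    refine le_trans ?_ (hBT (T ^ 2 * L) le_rfl)
    rw [le_div_iff₀ hε2]
    nlinarith
  have hTH2 : T * H ^ 2 / ε ^ 2 ≤ 1028 * B := by
    have h1 := hBT (T ^ 2) hT2L
    have h2 : T * (H : ℝ) ^ 2 / ε ^ 2 ≤ T * (1028 * T) / ε ^ 2 := by gcongr
    have h3 : T * (1028 * T) / ε ^ 2 = 1028 * (T ^ 2 / ε ^ 2) := by ring
    linarith
  -- Here `H ≤ H² ≤ 1028 T`. The product `L * H` is the reason why the running time may contain `log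
  -- (r / ε)` but not `log m`.
  have hLH : L * H / ε ^ 2 ≤ 1028 * B := by
    have h1 := hBT (T * L) (by nlinarith)
    have h2 : L * (H : ℝ) / ε ^ 2 ≤ L * (1028 * T) / ε ^ 2 := by
      gcongr
      nlinarith
    have h3 : L * (1028 * T) / ε ^ 2 = 1028 * (T * L / ε ^ 2) := by ring
    linarith
  set m₀ : ℝ := 1500000 * (T * H + L) / ε ^ 2 with hm₀
  have hm₀H : m₀ * H ≤ 1500000 * 2056 * B := by
    have : m₀ * H = 1500000 * (T * H ^ 2 / ε ^ 2 + L * H / ε ^ 2) := by rw [hm₀]; ring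
    linarith
  have hm₀1 : 1 ≤ m₀ := by
    rw [hm₀, le_div_iff₀ hε2]
    nlinarith
  have hm₀B : m₀ ≤ 1500000 * 2056 * B := (le_mul_of_one_le_right (by linarith) hH1).trans hm₀H
  refine ⟨fun m hm => umbLearns_of_sample_size hε hε1 hδ hr hH (le_trans ?_ hm), ⌈m₀⌉₊, ?_,
    umbLearns_of_sample_size hε hε1 hδ hr hH (Nat.le_ceil _), fun S => ?_⟩
  · change m₀ ≤ _
    linarith
  · have := Nat.ceil_lt_add_one (by linarith : 0 ≤ m₀)
    linarith
  · have hη0 : 0 < ε / (8 * r) := by positivity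
    have hη1 : ε / (8 * r) < 1 := by
      rw [div_lt_one (by positivity)]; linarith
    have hη : 32 / (ε / (8 * r)) = 256 * T := by rw [hT]; field_simp; norm_num
    obtain ⟨n, hn, hle⟩ := RealRAM.exists_performsUMB S hη0 hη1 (hη.le.trans hH)
    refine ⟨n, hn, hle.trans ?_⟩
    have h1 : 128 / (ε / (8 * r)) = 4 * (256 * T) := by rw [← hη]; ring
    have h2 := Nat.ceil_lt_add_one (by linarith : 0 ≤ m₀)
    have h3 : (74 * H + 160 : ℝ) * ⌈m₀⌉₊ ≤ (234 * H) * (2 * m₀) := by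
      gcongr
      · linarith
      · linarith
    rw [h1]
    linarith
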